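/- A \emph{network} is a finite directed multigraph $G=(V,E)$ with two distinct designated nodes, a source and a sink, such that every node and every edge of $G$ lies on a simple directed path from the source to the sink. A \emph{capacitated cost-sharing game with multiple sources and sinks} played on $G$ consists of a number $n$ of agents, a source node $s_i\in V$ and a sink node $t_i\in V$ for each agent $i$ (arbitrary nodes of $G$), and a cost $p_e\in\mathbb{R}_{\ge 0}$ and a capacity $c_e\in\mathbb{N}\cup\{0\}$ for each edge $e\in E$. A strategy of agent $i$ is a simple directed path from $s_i$ to $t_i$. For a strategy profile $\sigma$ let $x_e(\sigma)$ be the number of agents whose path uses $e$; $\sigma$ is \emph{feasible} if $x_e(\sigma)\le c_e$ for all $e\in E$, and the game is feasible if it has a feasible profile. The cost of agent $i$ is $p_i(\sigma)=\sum_{e\in\sigma_i}p_e/x_e(\sigma)$ if $\sigma$ is feasible and $p_i(\sigma)=\infty$ otherwise. A profile $\sigma$ is a \emph{strong equilibrium (SE)} if for every nonempty coalition $C$ of agents and all strategies $\sigma'_C$ of its members there is $j\in C$ with $p_j(\sigma)\le p_j(\sigma'_C,\sigma_{-C})$. The network $G$ \emph{admits an SE} (in games with multiple sources and sinks) if every feasible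 such game played on $G$, for all numbers of agents, agents' sources and sinks, costs and capacities, has an SE. The series composition $G_1\to G_2$ is the disjoint union of $G_1$ and $G_2$ with the sink of $G_1$ identified with the source of $G_2$; its source is that of $G_1$ and its sink that of $G_2$. The parallel composition of $G_1$ and $G_2$ is their disjoint union with the two sources identified with each other and the two sinks identified with each other. A \emph{network of parallel paths} is a parallel composition of one or more networks each of which is a single simple path with at least one edge; a \emph{network of parallel edges} is a parallel composition of one or more single edges. \textbf{Theorem.} A network $G$ admits an SE in games with multiple sources and sinks if and only if there are $k\ge 1$ and networks $G_1,\dots,G_k$ such that $G$ is isomorphic to $G_1\to G_2\to\cdots\to G_k$, where one of $G_1,\dots,G_k$ is a network of parallel paths and all the others are networks of parallel edges. -/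

import Mathlib

open scoped NNReal ENNReal

universe u v u' v'

/-- A network: a directed multigraph with node set `V`, edge set `E`, and two designated nodes,
a source and a sink. -/
structure Network where
  /-- The nodes. -/
  V : Type u
  /-- The edges; parallel edges are allowed. -/
  E : Type v
  /-- The tail of an edge. -/
  src : E → V
  /-- The head of an edge. -/
  tgt : E → V
  /-- The designated source node. -/
  source : V
  /-- The designated sink node. -/
  sink : V

namespace Network

/-- `G.IsWalk a p b`: the list of edges `p` is a directed walk from `a` to `b`. -/
def IsWalk (G : Network.{u, v}) : G.V → List G.E → G.V → Prop
  | a, [], b => a = b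
  | a, e :: p, b => G.src e = a ∧ G.IsWalk (G.tgt e) p b

/-- The list of nodes visited by a walk `p` that starts at `a`. -/
def support (G : Network.{u, v}) (a : G.V) (p : List G.E) : List G.V :=
  a :: p.map G.tgt

/-- `p` is a (simple) directed path from `a` to `b`: a walk that visits no node twice. -/
def IsPath (G : Network.{u, v}) (a : G.V) (p : List G.E) (b : G.V) : Prop :=
  G.IsWalk a p b ∧ (G.support a p).Nodup

/-- The type of directed paths from `a` to `b`. -/
def Path (G : Network.{u, v}) (a b : G.V) : Type v :=
  {p : List G.E // G.IsPath a p b}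

/-- `G` is a two-terminal network: source and sink are distinct, and every node and every edge
lies on a path from the source to the sink. -/
structure IsTwoTerminal (G : Network.{u, v}) : Prop where
  source_ne_sink : G.source ≠ G.sink
  node_on_path : ∀ x : G.V, ∃ p, G.IsPath G.source p G.sink ∧ x ∈ G.support G.source p
  edge_on_path : ∀ e : G.E, ∃ p, G.IsPath G.source p G.sink ∧ e ∈ p

/-- An isomorphism of networks. -/
structure Iso (G : Network.{u, v}) (H : Network.{u', v'}) where
  /-- The bijection between the nodes. -/
  node : G.V ≃ H.V
  /-- The bijection between the edges. -/
  edge : G.E ≃ H.E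
  map_src : ∀ e, H.src (edge e) = node (G.src e)
  map_tgt : ∀ e, H.tgt (edge e) = node (G.tgt e)
  map_source : node G.source = H.source
  map_sink : node G.sink = H.sink

/-- The series composition `G → H`: in the disjoint union of `G` and `H`, the sink of `G` is
identified with the source of `H`. -/
def series (G : Network.{u, v}) (H : Network.{u, v}) : Network.{u, v} where
  V := Quot fun x y : G.V ⊕ H.V => x = Sum.inl G.sink ∧ y = Sum.inr H.source
  E := G.E ⊕ H.E
  src := Sum.elim (fun e => Quot.mk _ (Sum.inl (G.src e))) fun e => Quot.mk _ (Sum.inr (H.src e))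
  tgt := Sum.elim (fun e => Quot.mk _ (Sum.inl (G.tgt e))) fun e => Quot.mk _ (Sum.inr (H.tgt e))
  source := Quot.mk _ (Sum.inl G.source)
  sink := Quot.mk _ (Sum.inr H.sink)

/-- The parallel composition `G ∥ H`: in the disjoint union of `G` and `H`, the two sources are
identified with each other, and the two sinks are identified with each other. -/
def parallel (G : Network.{u, v}) (H : Network.{u, v}) : Network.{u, v} where
  V := Quot fun x y : G.V ⊕ H.V =>
    (x = Sum.inl G.source ∧ y = Sum.inr H.source) ∨ (x = Sum.inl G.sink ∧ y = Sum.inr H.sink)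
  E := G.E ⊕ H.E
  src := Sum.elim (fun e => Quot.mk _ (Sum.inl (G.src e))) fun e => Quot.mk _ (Sum.inr (H.src e))
  tgt := Sum.elim (fun e => Quot.mk _ (Sum.inl (G.tgt e))) fun e => Quot.mk _ (Sum.inr (H.tgt e))
  source := Quot.mk _ (Sum.inl G.source)
  sink := Quot.mk _ (Sum.inl G.sink)

/-- The series composition `B 0 → B 1 → ⋯ → B k`. -/
def seriesAll : {k : ℕ} → (Fin (k + 1) → Network.{u, v}) → Network.{u, v}
  | 0, B => B 0
  | _ + 1, B => (B 0).series (seriesAll fun i => B i.succ)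

/-- The network that is a single simple path with `m + 1` edges. -/
def simplePath (m : ℕ) : Network.{0, 0} where
  V := Fin (m + 2)
  E := Fin (m + 1)
  src := Fin.castSucc
  tgt := Fin.succ
  source := 0
  sink := Fin.last (m + 1)

/-- Networks of parallel paths: parallel compositions of one or more simple paths. -/
inductive IsParallelPaths : Network.{0, 0} → Prop
  | path (m : ℕ) : IsParallelPaths (simplePath m)
  | parallel {G H : Network.{0, 0}} :
      IsParallelPaths G → IsParallelPaths H → IsParallelPaths (G.parallel H)

/-- Networks of parallel edges: parallel compositions of one or more single edges. -/
inductive IsParallelEdges : Network.{0, 0} → Prop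
  | edge : IsParallelEdges (simplePath 0)
  | parallel {G H : Network.{0, 0}} :
      IsParallelEdges G → IsParallelEdges H → IsParallelEdges (G.parallel H)

end Network

/-- A capacitated cost-sharing game with multiple sources and sinks played on the network `G`:
agent `i` wants to build a path from her source node to her sink node, which are arbitrary nodes
of `G`. -/
structure CCSGame (G : Network.{u, v}) where
  /-- The number of agents. -/
  n : ℕ
  /-- The source node of each agent. -/
  source : Fin n → G.V
  /-- The sink node of each agent. -/
  sink : Fin n → G.V
  /-- The cost of each edge. -/
  cost : G.E → ℝ≥0
  /-- The capacity of each edge. -/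
  cap : G.E → ℕ

namespace CCSGame

variable {G : Network.{u, v}}

/-- Strategy profiles: every agent chooses a path from her source to her sink. -/
def Profile (Γ : CCSGame G) : Type v :=
  ∀ i : Fin Γ.n, G.Path (Γ.source i) (Γ.sink i)

open Classical in
/-- The number of agents that use the edge `e` in the profile `s`. -/
noncomputable def load (Γ : CCSGame G) (s : Γ.Profile) (e : G.E) : ℕ :=
  (Finset.univ.filter fun i : Fin Γ.n => e ∈ (s i).1).card

/-- A profile is feasible if no edge is used by more agents than its capacity. -/
def IsFeasible (Γ : CCSGame G) (s : Γ.Profile) : Prop :=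
  ∀ e : G.E, Γ.load s e ≤ Γ.cap e

open Classical in
/-- The cost of agent `i` in the profile `s`: the cost of every edge is shared equally between the
agents who use it, and the cost is infinite if the profile is not feasible. -/
noncomputable def agentCost (Γ : CCSGame G) (s : Γ.Profile) (i : Fin Γ.n) : ℝ≥0∞ :=
  if Γ.IsFeasible s then
    (((s i).1.map fun e => Γ.cost e / (Γ.load s e : ℝ≥0)).sum : ℝ≥0)
  else ⊤

/-- The profile `(s'_C, s_{-C})` in which the agents of the coalition `C` play according to `s'`
and all others according to `s`. -/
def deviate (Γ : CCSGame G) (s s' : Γ.Profile) (C : Finset (Fin Γ.n)) : Γ.Profile :=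
  fun i => if i ∈ C then s' i else s i

/-- `s` is a strong equilibrium: no coalition can deviate jointly in a way that strictly
decreases the cost of each of its members. -/
def IsStrongEquilibrium (Γ : CCSGame G) (s : Γ.Profile) : Prop :=
  ∀ C : Finset (Fin Γ.n), C.Nonempty → ∀ s' : Γ.Profile,
    ∃ j ∈ C, Γ.agentCost s j ≤ Γ.agentCost (Γ.deviate s s' C) j

end CCSGame

/-- The network `G` admits a strong equilibrium in games with multiple sources and sinks: every
feasible such game played on `G` has a strong equilibrium. -/
def Network.AdmitsSE (G : Network.{u, v}) : Prop :=
  ∀ Γ : CCSGame G, (∃ s : Γ.Profile, Γ.IsFeasible s) → ∃ s : Γ.Profile, Γ.IsStrongEquilibrium s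

/-! Call a node a cut if every walk from the source to the sink visits it.

Necessity. Two games with two agents have no strong equilibrium, and they are embedded into `G` by
giving capacity 0 to all edges outside a chosen acyclic set `F`. In the first (`HasTriple`) both
agents have the same terminals and three kinds of routes, two of which share an edge. The second
(`HasDilemma`) is a prisoner's dilemma, in which a strong equilibrium fails because the pair leaves
the profile of mutual defection. If a node that is not a cut had two outgoing edges, then a walk
leading to it, together with a walk avoiding it, would form a fork (`exists_isFork`) and hence a
triple. So nodes that are not cuts have at most one outgoing edge and, by reversal, at most one
incoming edge. This holds relative to every acyclic set of edges in which each edge lies on a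
source-sink walk; applied to a maximal such set, it shows that `G` has no directed cycle
(`exists_isRanking_univ`). Two forks, one above `u` and one below `w`, yield a dilemma if a cut lies
between nodes `u` and `w` that are not cuts (`false_of_isCut_between`). Now split `G` at its cuts.
No block has a cut as inner node, so inner nodes have degree one both ways and the block consists of
parallel paths; and at most one block has inner nodes at all (`IsThin.exists_seriesAll`).

Sufficiency. Rank the agents by priority. A feasible profile is a strong equilibrium if no agent
gains from a deviation in which everybody of higher priority stays put, because in each coalition
the member of highest priority then does not gain. Such profiles of two networks combine to one of
their series composition, provided that the order is the same. On parallel edges every order works.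
On parallel paths the agents who travel from the source to the sink have to come before all others.
Both facts rest on a greedy assignment (`exists_greedy`): the path that is cheapest when filled as
far as possible is given to the first agents. Since only one block prescribes an order, the orders
do not conflict. -/

namespace Network

variable {G : Network.{u, v}}

/-! ### Walks, reachability and rankings -/

@[simp] theorem isWalk_nil {a b : G.V} : G.IsWalk a [] b ↔ a = b := Iff.rfl

@[simp] theorem isWalk_cons {a b : G.V} {e : G.E} {p : List G.E} :
    G.IsWalk a (e :: p) b ↔ G.src e = a ∧ G.IsWalk (G.tgt e) p b := Iff.rfl

theorem isWalk_append {a b : G.V} {p q : List G.E} :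
    G.IsWalk a (p ++ q) b ↔ ∃ c, G.IsWalk a p c ∧ G.IsWalk c q b := by
  induction p generalizing a with
  | nil => simp
  | cons e p ih => simp [ih, and_assoc]

theorem IsWalk.append {a b c : G.V} {p q : List G.E} (hp : G.IsWalk a p b) (hq : G.IsWalk b q c) :
    G.IsWalk a (p ++ q) c := isWalk_append.2 ⟨b, hp, hq⟩

theorem isWalk_append_cons {a b : G.V} {e : G.E} {p q : List G.E} :
    G.IsWalk a (p ++ e :: q) b ↔ G.IsWalk a p (G.src e) ∧ G.IsWalk (G.tgt e) q b := by
  rw [isWalk_append]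
  constructor
  · rintro ⟨c, h1, h2, h3⟩
    exact ⟨h2 ▸ h1, h3⟩
  · rintro ⟨h1, h2⟩
    exact ⟨_, h1, rfl, h2⟩

theorem mem_support {a x : G.V} {p : List G.E} :
    x ∈ G.support a p ↔ x = a ∨ ∃ e ∈ p, G.tgt e = x := by
  simp [support]

@[simp] theorem support_nil {a : G.V} : G.support a [] = [a] := rfl

@[simp] theorem support_cons {a : G.V} {e : G.E} {p : List G.E} :
    G.support a (e :: p) = a :: G.support (G.tgt e) p := rfl

theorem IsWalk.end_mem_support {a b : G.V} {p : List G.E} (hp : G.IsWalk a p b) :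
    b ∈ G.support a p := by
  induction p generalizing a with
  | nil => simp_all
  | cons e p ih => simp [ih hp.2]

theorem IsWalk.src_mem_support {a b : G.V} {p : List G.E} (hp : G.IsWalk a p b) {e : G.E}
    (he : e ∈ p) : G.src e ∈ G.support a p := by
  obtain ⟨p1, p2, rfl⟩ := List.append_of_mem he
  have := (isWalk_append_cons.1 hp).1.end_mem_support
  rw [mem_support] at this ⊢
  rcases this with h | ⟨d, hd, h⟩
  · exact Or.inl h
  · exact Or.inr ⟨d, by simp [hd], h⟩

theorem tgt_mem_support {a : G.V} {p : List G.E} {e : G.E} (he : e ∈ p) :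
    G.tgt e ∈ G.support a p := mem_support.2 (Or.inr ⟨e, he, rfl⟩)

/-- A walk can be split at any node that it visits. -/
theorem IsWalk.split {a b x : G.V} {p : List G.E} (hp : G.IsWalk a p b)
    (hx : x ∈ G.support a p) : ∃ p1 p2, p = p1 ++ p2 ∧ G.IsWalk a p1 x ∧ G.IsWalk x p2 b := by
  rcases mem_support.1 hx with rfl | ⟨e, he, rfl⟩
  · exact ⟨[], p, rfl, rfl, hp⟩
  · obtain ⟨p1, p2, rfl⟩ := List.append_of_mem he
    have h := isWalk_append_cons.1 hp
    exact ⟨p1 ++ [e], p2, by simp, h.1.append ⟨rfl, rfl⟩, h.2⟩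

/-- `b` can be reached from `a` along edges of `F`. -/
def Conn (G : Network.{u, v}) (F : Set G.E) (a b : G.V) : Prop :=
  ∃ p, G.IsWalk a p b ∧ ∀ e ∈ p, e ∈ F

theorem Conn.refl {F : Set G.E} (a : G.V) : G.Conn F a a := ⟨[], rfl, by simp⟩

theorem Conn.trans {F : Set G.E} {a b c : G.V} (h : G.Conn F a b) (h' : G.Conn F b c) :
    G.Conn F a c := by
  obtain ⟨p, hp, hp'⟩ := h
  obtain ⟨q, hq, hq'⟩ := h'
  refine ⟨p ++ q, hp.append hq, fun e he => ?_⟩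
  rcases List.mem_append.1 he with h | h
  · exact hp' e h
  · exact hq' e h

theorem conn_edge {F : Set G.E} {e : G.E} (he : e ∈ F) : G.Conn F (G.src e) (G.tgt e) :=
  ⟨[e], ⟨rfl, rfl⟩, by simpa using he⟩

theorem Conn.mono {F F' : Set G.E} (h : F ⊆ F') {a b : G.V} (hc : G.Conn F a b) :
    G.Conn F' a b := by
  obtain ⟨p, hp, hp'⟩ := hc
  exact ⟨p, hp, fun e he => h (hp' e he)⟩

theorem IsWalk.conn_src {F : Set G.E} {a b : G.V} {p : List G.E} (hp : G.IsWalk a p b)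
    (hF : ∀ e ∈ p, e ∈ F) {e : G.E} (he : e ∈ p) : G.Conn F a (G.src e) := by
  obtain ⟨p1, p2, rfl⟩ := List.append_of_mem he
  exact ⟨p1, (isWalk_append_cons.1 hp).1, fun d hd => hF d (by simp [hd])⟩

theorem IsWalk.conn_tgt {F : Set G.E} {a b : G.V} {p : List G.E} (hp : G.IsWalk a p b)
    (hF : ∀ e ∈ p, e ∈ F) {e : G.E} (he : e ∈ p) : G.Conn F (G.tgt e) b := by
  obtain ⟨p1, p2, rfl⟩ := List.append_of_mem he
  exact ⟨p2, (isWalk_append_cons.1 hp).2, fun d hd => hF d (by simp [hd])⟩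

theorem IsWalk.conn_of_mem {F : Set G.E} {a b x : G.V} {p : List G.E} (hp : G.IsWalk a p b)
    (hF : ∀ e ∈ p, e ∈ F) (hx : x ∈ G.support a p) : G.Conn F a x ∧ G.Conn F x b := by
  obtain ⟨p1, p2, rfl, h1, h2⟩ := hp.split hx
  exact ⟨⟨p1, h1, fun d hd => hF d (by simp [hd])⟩, ⟨p2, h2, fun d hd => hF d (by simp [hd])⟩⟩

/-- A ranking of the nodes that increases along the edges of `F`; it exists if and only if `F`
contains no directed cycle. -/
def IsRanking (G : Network.{u, v}) (F : Set G.E) (r : G.V → ℕ) : Prop :=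
  ∀ e ∈ F, r (G.src e) < r (G.tgt e)

theorem IsRanking.mono {F F' : Set G.E} {r : G.V → ℕ} (hr : G.IsRanking F' r) (h : F ⊆ F') :
    G.IsRanking F r := fun e he => hr e (h he)

theorem IsRanking.le_of_conn {F : Set G.E} {r : G.V → ℕ} (hr : G.IsRanking F r) {a b : G.V}
    (h : G.Conn F a b) : r a ≤ r b := by
  obtain ⟨p, hp, hF⟩ := h
  induction p generalizing a with
  | nil => exact le_of_eq (congrArg r hp)
  | cons e p ih =>
    have h1 := ih hp.2 fun d hd => hF d (by simp [hd])
    have h2 := hr e (hF e (by simp))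
    rw [hp.1] at h2
    omega

theorem IsRanking.lt_of_conn {F : Set G.E} {r : G.V → ℕ} (hr : G.IsRanking F r) {a b : G.V}
    (h : G.Conn F a b) (hab : a ≠ b) : r a < r b := by
  obtain ⟨p, hp, hF⟩ := h
  cases p with
  | nil => exact absurd hp hab
  | cons e p =>
    have h1 := hr.le_of_conn ⟨p, hp.2, fun d hd => hF d (by simp [hd])⟩
    have h2 := hr e (hF e (by simp))
    rw [hp.1] at h2
    omega

theorem IsRanking.support_nodup {F : Set G.E} {r : G.V → ℕ} (hr : G.IsRanking F r) {a b : G.V}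
    {p : List G.E} (hp : G.IsWalk a p b) (hF : ∀ e ∈ p, e ∈ F) : (G.support a p).Nodup := by
  induction p generalizing a with
  | nil => simp
  | cons e p ih =>
    have hF' : ∀ d ∈ p, d ∈ F := fun d hd => hF d (by simp [hd])
    rw [support_cons, List.nodup_cons]
    refine ⟨fun h => ?_, ih hp.2 hF'⟩
    have h1 := hr.le_of_conn (hp.2.conn_of_mem hF' h).1
    have h2 := hr e (hF e (by simp))
    rw [hp.1] at h2
    omega

theorem IsRanking.isPath {F : Set G.E} {r : G.V → ℕ} (hr : G.IsRanking F r) {a b : G.V}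
    {p : List G.E} (hp : G.IsWalk a p b) (hF : ∀ e ∈ p, e ∈ F) : G.IsPath a p b :=
  ⟨hp, hr.support_nodup hp hF⟩

/-- A walk along ranked edges does not leave a node twice. -/
theorem IsRanking.eq_of_src_eq {F : Set G.E} {r : G.V → ℕ} (hr : G.IsRanking F r) {a b : G.V}
    {p : List G.E} (hp : G.IsWalk a p b) (hF : ∀ e ∈ p, e ∈ F) {d e : G.E} (hd : d ∈ p)
    (he : e ∈ p) (h : G.src d = G.src e) : d = e := by
  induction p generalizing a with
  | nil => simp at hd
  | cons c p ih =>
    have hF' : ∀ d ∈ p, d ∈ F := fun d hd => hF d (by simp [hd])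
    have key : ∀ d ∈ p, G.src d ≠ G.src c := fun d hd hdc => by
      have h1 := hr.le_of_conn (hp.2.conn_src hF' hd)
      have h2 := hr c (hF c (by simp))
      rw [hdc] at h1
      omega
    rcases List.mem_cons.1 hd with rfl | hd' <;> rcases List.mem_cons.1 he with rfl | he'
    · rfl
    · exact absurd h.symm (key e he')
    · exact absurd h (key d hd')
    · exact ih hp.2 hF' hd' he'

theorem IsPath.edges_nodup {a b : G.V} {p : List G.E} (hp : G.IsPath a p b) : p.Nodup :=
  List.Nodup.of_map G.tgt (List.nodup_cons.1 hp.2).2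

theorem IsWalk.src_getElem {a b : G.V} {p : List G.E} (hp : G.IsWalk a p b) (i : ℕ)
    (hi : i < p.length) : G.src p[i] = (G.support a p)[i]'(by simp [support]; omega) := by
  induction p generalizing a i with
  | nil => simp at hi
  | cons e p ih =>
    cases i with
    | zero => exact hp.1
    | succ i => simpa using ih hp.2 i (by simpa using hi)

theorem tgt_getElem {a : G.V} {p : List G.E} (i : ℕ) (hi : i < p.length) :
    G.tgt p[i] = (G.support a p)[i + 1]'(by simp [support]; omega) := by
  simp [support]

/-- A walk that visits `X` but ends outside of `X` has a last edge that starts in `X`. -/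
theorem IsWalk.last_exit {a b : G.V} {p : List G.E} (hp : G.IsWalk a p b) (X : Set G.V)
    (ha : a ∈ X ∨ ∃ d ∈ p, G.tgt d ∈ X) (hb : b ∉ X) :
    ∃ p1 e p2, p = p1 ++ e :: p2 ∧ G.src e ∈ X ∧ ∀ d ∈ e :: p2, G.tgt d ∉ X := by
  induction p generalizing a with
  | nil =>
    rcases ha with ha | ⟨d, hd, -⟩
    · exact absurd (hp ▸ ha) hb
    · simp at hd
  | cons c p ih =>
    by_cases h : G.tgt c ∈ X ∨ ∃ d ∈ p, G.tgt d ∈ X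
    · obtain ⟨p1, e, p2, rfl, h1, h2⟩ := ih hp.2 h
      exact ⟨c :: p1, e, p2, rfl, h1, h2⟩
    · push Not at h
      refine ⟨[], c, p, rfl, ?_, by simpa using h⟩
      rcases ha with ha | ⟨d, hd, hdX⟩
      · exact hp.1 ▸ ha
      · rcases List.mem_cons.1 hd with rfl | hd
        · exact absurd hdX h.1
        · exact absurd hdX (h.2 d hd)

/-- A nonempty walk that ends in `X` has a first edge that ends in `X`. -/
theorem exists_first_entry {X : Set G.V} {p : List G.E} (h : ∃ d ∈ p, G.tgt d ∈ X) :
    ∃ p1 e p2, p = p1 ++ e :: p2 ∧ G.tgt e ∈ X ∧ ∀ d ∈ p1, G.tgt d ∉ X := by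
  induction p with
  | nil => simp at h
  | cons c p ih =>
    by_cases hc : G.tgt c ∈ X
    · exact ⟨[], c, p, rfl, hc, by simp⟩
    · obtain ⟨d, hd, hdX⟩ := h
      rcases List.mem_cons.1 hd with rfl | hd
      · exact absurd hdX hc
      obtain ⟨p1, e, p2, rfl, h1, h2⟩ := ih ⟨d, hd, hdX⟩
      exact ⟨c :: p1, e, p2, rfl, h1, by simpa [hc] using h2⟩

theorem IsWalk.exists_tgt_eq {a b : G.V} {p : List G.E} (hp : G.IsWalk a p b) (h : p ≠ []) :
    ∃ d ∈ p, G.tgt d = b := by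
  rcases mem_support.1 hp.end_mem_support with rfl | h'
  · obtain ⟨p', e, rfl⟩ := List.eq_nil_or_concat p |>.resolve_left h
    rw [List.concat_eq_append] at hp ⊢
    exact ⟨e, by simp, (isWalk_append_cons.1 hp).2⟩
  · exact h'

/-- The network with all edges reversed. -/
def rev (G : Network.{u, v}) : Network.{u, v} where
  V := G.V
  E := G.E
  src := G.tgt
  tgt := G.src
  source := G.sink
  sink := G.source

theorem IsWalk.rev {a b : G.V} {p : List G.E} (hp : G.IsWalk a p b) :
    G.rev.IsWalk b p.reverse a := by
  induction p generalizing a with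
  | nil => exact hp.symm
  | cons e p ih =>
    rw [List.reverse_cons]
    exact IsWalk.append (G := G.rev) (ih hp.2) ⟨rfl, hp.1⟩

theorem Conn.rev {F : Set G.E} {a b : G.V} (h : G.Conn F a b) : G.rev.Conn F b a := by
  obtain ⟨p, hp, hF⟩ := h
  exact ⟨p.reverse, hp.rev, fun e he => hF e (List.mem_reverse.1 he)⟩

theorem IsWalk.mem_support_rev {a b x : G.V} {p : List G.E} (hp : G.IsWalk a p b) :
    x ∈ G.rev.support b p.reverse ↔ x ∈ G.support a p := by
  constructor
  · intro h
    rcases mem_support.1 h with rfl | ⟨e, he, rfl⟩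
    · exact hp.end_mem_support
    · exact hp.src_mem_support (List.mem_reverse.1 he)
  · intro h
    rcases mem_support.1 h with rfl | ⟨e, he, rfl⟩
    · exact hp.rev.end_mem_support
    · exact hp.rev.src_mem_support (List.mem_reverse.2 he)

/-- Finiteness bounds the ranks, and subtracting them from a bound reverses their order. -/
theorem IsRanking.exists_rev [Finite G.V] {F : Set G.E} {r : G.V → ℕ} (hr : G.IsRanking F r) :
    ∃ r', G.rev.IsRanking F r' := by
  obtain ⟨M, hM⟩ := (Set.finite_range r).bddAbove
  refine ⟨fun x => M - r x, fun e he => ?_⟩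
  have h1 := hr e he
  have h2 := hM (Set.mem_range_self (G.tgt e))
  show M - r (G.tgt e) < M - r (G.src e)
  omega

end Network

/-! ### Two-agent games without a strong equilibrium -/

namespace CCSGame

variable {G : Network.{u, v}}

/-- The sum of the cost shares of agent `i` in the profile `s`. -/
noncomputable def share (Γ : CCSGame G) (s : Γ.Profile) (i : Fin Γ.n) : ℝ≥0 :=
  ((s i).1.map fun e => Γ.cost e / (Γ.load s e : ℝ≥0)).sum

theorem agentCost_of_feasible {Γ : CCSGame G} {s : Γ.Profile} (hs : Γ.IsFeasible s)
    (i : Fin Γ.n) : Γ.agentCost s i = (Γ.share s i : ℝ≥0∞) := if_pos hs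

theorem agentCost_of_not_feasible {Γ : CCSGame G} {s : Γ.Profile} (hs : ¬ Γ.IsFeasible s)
    (i : Fin Γ.n) : Γ.agentCost s i = ⊤ := if_neg hs

theorem deviate_eq {Γ : CCSGame G} {s s' : Γ.Profile} {C : Finset (Fin Γ.n)}
    (h : ∀ i ∉ C, s' i = s i) : Γ.deviate s s' C = s' := by
  funext i
  unfold deviate
  split_ifs with hi
  · rfl
  · exact (h i hi).symm

/-- A game has no strong equilibrium if in every feasible profile some coalition can profitably
deviate to a feasible profile. -/
theorem not_isStrongEquilibrium {Γ : CCSGame G} (hn : 0 < Γ.n) {s₀ : Γ.Profile}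
    (h₀ : Γ.IsFeasible s₀)
    (h : ∀ s, Γ.IsFeasible s → ∃ s', Γ.IsFeasible s' ∧ ∃ C : Finset (Fin Γ.n), C.Nonempty ∧
      (∀ i ∉ C, s' i = s i) ∧ ∀ j ∈ C, Γ.share s' j < Γ.share s j)
    (s : Γ.Profile) : ¬ Γ.IsStrongEquilibrium s := by
  intro hs
  by_cases hf : Γ.IsFeasible s
  · obtain ⟨s', hf', C, hC, hC', hlt⟩ := h s hf
    obtain ⟨j, hj, hle⟩ := hs C hC s'
    rw [deviate_eq hC', agentCost_of_feasible hf, agentCost_of_feasible hf'] at hle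
    exact absurd (hlt j hj) (not_lt.2 (by exact_mod_cast hle))
  -- From an infeasible profile the coalition of all agents moves to `s₀`, which turns infinite
  -- costs into finite ones.
  · obtain ⟨j, -, hle⟩ := hs Finset.univ ⟨⟨0, hn⟩, Finset.mem_univ _⟩ s₀
    rw [deviate_eq (by simp), agentCost_of_feasible h₀, agentCost_of_not_feasible hf] at hle
    simp at hle

open Classical in
theorem load_eq_sum (Γ : CCSGame G) (s : Γ.Profile) (e : G.E) :
    Γ.load s e = ∑ i, if e ∈ (s i).1 then 1 else 0 := by
  rw [load, Finset.card_filter]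

open Classical in
theorem sum_map_ite {α : Type*} {p : List α} (hp : p.Nodup) (a : α) (c : ℝ≥0) :
    (p.map fun e => if e = a then c else 0).sum = if a ∈ p then c else 0 := by
  rw [← List.sum_toFinset _ hp, Finset.sum_ite_eq' p.toFinset a]
  simp

end CCSGame

namespace Network

variable {G : Network.{u, v}}

open Classical in
/-- The load of an edge when two agents use the walks `p` and `q`. -/
noncomputable def pairLoad (p q : List G.E) (e : G.E) : ℕ :=
  (if e ∈ p then 1 else 0) + (if e ∈ q then 1 else 0)

/-- The sum of the cost shares on the walk `l` when two agents use the walks `p` and `q`. -/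
noncomputable def pairShare (c : G.E → ℝ≥0) (p q l : List G.E) : ℝ≥0 :=
  (l.map fun e => c e / (pairLoad p q e : ℝ≥0)).sum

open Classical in
theorem pairShare_four {c : G.E → ℝ≥0} {e₁ e₂ e₃ e₄ : G.E} {c₁ c₂ c₃ c₄ : ℝ≥0}
    (h : ∀ e, c e = (if e = e₁ then c₁ else 0) + (if e = e₂ then c₂ else 0) +
      (if e = e₃ then c₃ else 0) + (if e = e₄ then c₄ else 0)) (p q : List G.E) {l : List G.E}
    (hl : l.Nodup) :
    pairShare c p q l = (if e₁ ∈ l then c₁ / pairLoad p q e₁ else 0) +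
      (if e₂ ∈ l then c₂ / pairLoad p q e₂ else 0) +
      (if e₃ ∈ l then c₃ / pairLoad p q e₃ else 0) +
      (if e₄ ∈ l then c₄ / pairLoad p q e₄ else 0) := by
  have key : ∀ (a e : G.E) (x : ℝ≥0), (if e = a then x else 0) / (pairLoad p q e : ℝ≥0) =
      if e = a then x / (pairLoad p q a : ℝ≥0) else 0 := by
    intro a e x
    split_ifs with h
    · rw [h]
    · simp
  simp only [← CCSGame.sum_map_ite hl, ← List.sum_map_add, pairShare, h, add_div, key]

/-- A criterion for a game with two agents to have no strong equilibrium. -/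
theorem not_admitsSE_of_pair {x₁ y₁ x₂ y₂ : G.V} (c : G.E → ℝ≥0) (k : G.E → ℕ)
    (h₀ : ∃ p q, G.IsPath x₁ p y₁ ∧ G.IsPath x₂ q y₂ ∧ ∀ e, pairLoad p q e ≤ k e)
    (h : ∀ p q, G.IsPath x₁ p y₁ → G.IsPath x₂ q y₂ → (∀ e, pairLoad p q e ≤ k e) →
      (∃ p', G.IsPath x₁ p' y₁ ∧ (∀ e, pairLoad p' q e ≤ k e) ∧
        pairShare c p' q p' < pairShare c p q p) ∨
      (∃ q', G.IsPath x₂ q' y₂ ∧ (∀ e, pairLoad p q' e ≤ k e) ∧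
        pairShare c p q' q' < pairShare c p q q) ∨
      (∃ p' q', G.IsPath x₁ p' y₁ ∧ G.IsPath x₂ q' y₂ ∧ (∀ e, pairLoad p' q' e ≤ k e) ∧
        pairShare c p' q' p' < pairShare c p q p ∧ pairShare c p' q' q' < pairShare c p q q)) :
    ¬ G.AdmitsSE := by
  intro hG
  let Γ : CCSGame G := ⟨2, ![x₁, x₂], ![y₁, y₂], c, k⟩
  have hload : ∀ (s : Γ.Profile) e,
      Γ.load s e = pairLoad (s (0 : Fin 2)).1 (s (1 : Fin 2)).1 e := by
    intro s e
    rw [CCSGame.load_eq_sum]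
    exact Fin.sum_univ_two _
  have hshare : ∀ (s : Γ.Profile) i,
      Γ.share s i = pairShare c (s (0 : Fin 2)).1 (s (1 : Fin 2)).1 (s i).1 := by
    intro s i
    simp only [CCSGame.share, hload]
    rfl
  have hfeas : ∀ s : Γ.Profile, Γ.IsFeasible s ↔
      ∀ e, pairLoad (s (0 : Fin 2)).1 (s (1 : Fin 2)).1 e ≤ k e := by
    intro s
    simp only [CCSGame.IsFeasible, hload]
    rfl
  have mk : ∀ p q, G.IsPath x₁ p y₁ → G.IsPath x₂ q y₂ →
      ∃ s : Γ.Profile, (s (0 : Fin 2)).1 = p ∧ (s (1 : Fin 2)).1 = q := by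
    intro p q hp hq
    refine ⟨fun i => if h : i = (0 : Fin 2) then ⟨p, ?_⟩ else ⟨q, ?_⟩, rfl, rfl⟩
    · subst h
      exact hp
    · obtain rfl : i = (1 : Fin 2) := by
        have : ∀ i : Fin 2, i ≠ 0 → i = 1 := by decide
        exact this i h
      exact hq
  obtain ⟨p₀, q₀, hp₀, hq₀, hf₀⟩ := h₀
  obtain ⟨s₀, hs₀, hs₀'⟩ := mk p₀ q₀ hp₀ hq₀
  have hs₀f : Γ.IsFeasible s₀ := (hfeas s₀).2 (by rw [hs₀, hs₀']; exact hf₀)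
  obtain ⟨s, hs⟩ := hG Γ ⟨s₀, hs₀f⟩
  refine CCSGame.not_isStrongEquilibrium (Γ := Γ) (Nat.zero_lt_two) hs₀f (fun s hs => ?_) s hs
  have h01 : ∀ i : Fin Γ.n, i = (0 : Fin 2) ∨ i = (1 : Fin 2) := by
    have : ∀ i : Fin 2, i = 0 ∨ i = 1 := by decide
    exact this
  rcases h _ _ (s (0 : Fin 2)).2 (s (1 : Fin 2)).2 ((hfeas s).1 hs) with
    ⟨p', hp', hk, hlt⟩ | ⟨q', hq', hk, hlt⟩ | ⟨p', q', hp', hq', hk, hlt, hlt'⟩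
  · obtain ⟨s', h0, h1⟩ := mk p' _ hp' (s (1 : Fin 2)).2
    refine ⟨s', (hfeas s').2 (by rw [h0, h1]; exact hk), {(0 : Fin 2)},
      Finset.singleton_nonempty _, fun i hi => ?_, fun j hj => ?_⟩
    · rcases h01 i with rfl | rfl
      · simp at hi
      · exact Subtype.ext h1
    · rw [Finset.mem_singleton] at hj
      subst hj
      rw [hshare, hshare, h0, h1]
      exact hlt
  · obtain ⟨s', h0, h1⟩ := mk _ q' (s (0 : Fin 2)).2 hq'
    refine ⟨s', (hfeas s').2 (by rw [h0, h1]; exact hk), {(1 : Fin 2)},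
      Finset.singleton_nonempty _, fun i hi => ?_, fun j hj => ?_⟩
    · rcases h01 i with rfl | rfl
      · exact Subtype.ext h0
      · simp at hi
    · rw [Finset.mem_singleton] at hj
      subst hj
      rw [hshare, hshare, h0, h1]
      exact hlt
  · obtain ⟨s', h0, h1⟩ := mk p' q' hp' hq'
    refine ⟨s', (hfeas s').2 (by rw [h0, h1]; exact hk), Finset.univ,
      ⟨(0 : Fin 2), Finset.mem_univ _⟩, fun i hi => absurd (Finset.mem_univ i) hi,
      fun j _ => ?_⟩
    rcases h01 j with rfl | rfl
    · rw [hshare, hshare, h0, h1]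
      exact hlt
    · rw [hshare, hshare, h0, h1]
      exact hlt'

/-- Capacity 0 outside `F` confines a game to the edges of `F`. -/
theorem mem_of_pairLoad_le {F : Set G.E} {p q : List G.E} {k : G.E → ℕ}
    (h : ∀ e, pairLoad p q e ≤ k e) (hk : ∀ e ∉ F, k e = 0) :
    (∀ e ∈ p, e ∈ F) ∧ ∀ e ∈ q, e ∈ F := by
  constructor <;> intro e he <;> by_contra hF <;> have := h e <;>
    simp [pairLoad, hk e hF, he] at this

/-- There are three types of walks from `x` to `y` along edges of `F`: those that use `e₁` and `f`,
those that use `e₂` and `f`, and those that use `g`. -/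
structure HasTriple (G : Network.{u, v}) (F : Set G.E) (x y : G.V) (e₁ e₂ f g : G.E) :
    Prop where
  ranking : ∃ r, G.IsRanking F r
  trace : ∀ p, G.IsWalk x p y → (∀ e ∈ p, e ∈ F) →
    (e₁ ∈ p ∧ e₂ ∉ p ∧ f ∈ p ∧ g ∉ p) ∨ (e₁ ∉ p ∧ e₂ ∈ p ∧ f ∈ p ∧ g ∉ p) ∨
      (e₁ ∉ p ∧ e₂ ∉ p ∧ f ∉ p ∧ g ∈ p)
  exists₁ : ∃ p, G.IsWalk x p y ∧ (∀ e ∈ p, e ∈ F) ∧ e₁ ∈ p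
  exists₂ : ∃ p, G.IsWalk x p y ∧ (∀ e ∈ p, e ∈ F) ∧ e₂ ∈ p
  exists₃ : ∃ p, G.IsWalk x p y ∧ (∀ e ∈ p, e ∈ F) ∧ g ∈ p

instance [h : Finite G.V] : Finite G.rev.V := h

theorem HasTriple.of_rev [Finite G.V] {F : Set G.E} {x y : G.V} {e₁ e₂ f g : G.E}
    (h : G.rev.HasTriple F y x e₁ e₂ f g) : G.HasTriple F x y e₁ e₂ f g := by
  obtain ⟨⟨r, hr⟩, h0, ⟨p1, h1, h1', h1''⟩, ⟨p2, h2, h2', h2''⟩, ⟨p3, h3, h3', h3''⟩⟩ := h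
  have key : ∀ (e : G.E) (p : List G.E), e ∈ p.reverse ↔ e ∈ p := fun e p => List.mem_reverse
  refine ⟨IsRanking.exists_rev (G := G.rev) hr, fun p hp hF => ?_,
    ⟨p1.reverse, IsWalk.rev (G := G.rev) h1, fun e he => h1' e ((key _ _).1 he), (key _ _).2 h1''⟩,
    ⟨p2.reverse, IsWalk.rev (G := G.rev) h2, fun e he => h2' e ((key _ _).1 he), (key _ _).2 h2''⟩,
    ⟨p3.reverse, IsWalk.rev (G := G.rev) h3, fun e he => h3' e ((key _ _).1 he), (key _ _).2 h3''⟩⟩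
  have h : (e₁ ∈ p.reverse ∧ e₂ ∉ p.reverse ∧ f ∈ p.reverse ∧ g ∉ p.reverse) ∨
      (e₁ ∉ p.reverse ∧ e₂ ∈ p.reverse ∧ f ∈ p.reverse ∧ g ∉ p.reverse) ∨
      (e₁ ∉ p.reverse ∧ e₂ ∉ p.reverse ∧ f ∉ p.reverse ∧ g ∈ p.reverse) :=
    h0 p.reverse hp.rev fun e he => hF e ((key _ _).1 he)
  simpa only [key] using h

open Classical in
theorem HasTriple.not_admitsSE {F : Set G.E} {x y : G.V} {e₁ e₂ f g : G.E}
    (h : G.HasTriple F x y e₁ e₂ f g) : ¬ G.AdmitsSE := by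
  obtain ⟨⟨r, hr⟩, htr, ⟨p1, hw1, hF1, h1⟩, ⟨p2, hw2, hF2, h2⟩, ⟨p3, hw3, hF3, h3⟩⟩ := h
  have t1 := htr p1 hw1 hF1
  have t2 := htr p2 hw2 hF2
  have t3 := htr p3 hw3 hF3
  simp only [h1, h2, h3, not_true_eq_false, true_and, false_and, and_false, or_false, false_or,
    and_true] at t1 t2 t3
  have hP1 := hr.isPath hw1 hF1
  have hP2 := hr.isPath hw2 hF2
  have hP3 := hr.isPath hw3 hF3
  let c : G.E → ℝ≥0 := fun e =>
    (if e = e₂ then 4 else 0) + (if e = f then 8 else 0) + (if e = g then 7 else 0)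
  let k : G.E → ℕ := fun e => if e ∈ F then if e = e₁ ∨ e = g then 1 else 2 else 0
  have hk : ∀ p q : List G.E, (∀ e ∈ p, e ∈ F) → (∀ e ∈ q, e ∈ F) →
      ¬ (e₁ ∈ p ∧ e₁ ∈ q) → ¬ (g ∈ p ∧ g ∈ q) → ∀ e, pairLoad p q e ≤ k e := by
    intro p q hp hq h1 h3 e
    by_cases he : e ∈ F
    · by_cases h : e = e₁ ∨ e = g
      · simp only [k, if_pos he, if_pos h, pairLoad]
        rcases h with rfl | rfl <;> split_ifs <;> simp_all
      · simp only [k, if_pos he, if_neg h, pairLoad]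
        split_ifs <;> simp
    · have hep : e ∉ p := fun h => he (hp _ h)
      have heq : e ∉ q := fun h => he (hq _ h)
      simp [pairLoad, hep, heq]
  -- Only three edges have a cost; the fourth slot repeats `g` with cost 0.
  have hs := pairShare_four (c := c) (e₁ := e₂) (e₂ := f) (e₃ := g) (e₄ := g) (c₁ := 4) (c₂ := 8) (c₃ := 7)
    (c₄ := 0) (by simp [c])
  refine not_admitsSE_of_pair (x₁ := x) (y₁ := y) (x₂ := x) (y₂ := y) c k
    ⟨p1, p2, hP1, hP2, hk p1 p2 hF1 hF2 ?_ ?_⟩ ?_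
  · simp [t2]
  · simp [t1]
  intro p q hp hq hpq
  obtain ⟨hpF, hqF⟩ := mem_of_pairLoad_le hpq (F := F) fun e he => if_neg he
  have hc1 : ¬ (e₁ ∈ p ∧ e₁ ∈ q) := by
    intro h
    have := hpq e₁
    simp [k, hpF _ h.1, pairLoad, h.1, h.2] at this
  have hcg : ¬ (g ∈ p ∧ g ∈ q) := by
    intro h
    have := hpq g
    simp [k, hpF _ h.1, pairLoad, h.1, h.2] at this
  have n1 := hP1.edges_nodup
  have n2 := hP2.edges_nodup
  have n3 := hP3.edges_nodup
  have np := hp.edges_nodup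
  have nq := hq.edges_nodup
  rcases htr p hp.1 hpF with tp | tp | tp <;> rcases htr q hq.1 hqF with tq | tq | tq
  · exact absurd ⟨tp.1, tq.1⟩ hc1
  · refine Or.inr (Or.inl ⟨p3, hP3, hk _ _ hpF hF3 (by simp [t3]) (by simp [tp]), ?_⟩)
    rw [hs _ _ n3, hs _ _ nq]
    norm_num [pairLoad, tp, tq, t3, h3]
  · refine Or.inr (Or.inr ⟨p2, p2, hP2, hP2, hk _ _ hF2 hF2 (by simp [t2]) (by simp [t2]), ?_⟩)
    rw [hs _ _ n2, hs _ _ nq, hs _ _ np]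
    norm_num [pairLoad, tp, tq, t2, h2]
  · refine Or.inl ⟨p3, hP3, hk _ _ hF3 hqF (by simp [t3]) (by simp [tq]), ?_⟩
    rw [hs _ _ n3, hs _ _ np]
    norm_num [pairLoad, tp, tq, t3, h3]
  · refine Or.inl ⟨p1, hP1, hk _ _ hF1 hqF (by simp [tq]) (by simp [tq]), ?_⟩
    rw [hs _ _ n1, hs _ _ np]
    norm_num [pairLoad, tp, tq, t1, h1]
  · refine Or.inl ⟨p1, hP1, hk _ _ hF1 hqF (by simp [tq]) (by simp [t1]), ?_⟩
    rw [hs _ _ n1, hs _ _ np]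
    norm_num [pairLoad, tp, tq, t1, h1]
  · refine Or.inr (Or.inr ⟨p2, p2, hP2, hP2, hk _ _ hF2 hF2 (by simp [t2]) (by simp [t2]), ?_⟩)
    rw [hs _ _ n2, hs _ _ nq, hs _ _ np]
    norm_num [pairLoad, tp, tq, t2, h2]
  · refine Or.inr (Or.inl ⟨p1, hP1, hk _ _ hpF hF1 (by simp [tp]) (by simp [t1]), ?_⟩)
    rw [hs _ _ n1, hs _ _ nq]
    norm_num [pairLoad, tp, tq, t1, h1]
  · exact absurd ⟨tp.2.2.2, tq.2.2.2⟩ hcg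

/-- The configuration of a prisoner's dilemma: an agent from `x₁` to `y₁` always uses `b₁`, and she
can choose between `b₂` and `g₂`; an agent from `x₂` to `y₂` always uses `b₂`, and she can choose
between `b₁` and `g₁`. -/
structure HasDilemma (G : Network.{u, v}) (F : Set G.E) (x₁ y₁ x₂ y₂ : G.V)
    (b₁ g₁ b₂ g₂ : G.E) : Prop where
  ranking : ∃ r, G.IsRanking F r
  trace₁ : ∀ p, G.IsWalk x₁ p y₁ → (∀ e ∈ p, e ∈ F) →
    b₁ ∈ p ∧ g₁ ∉ p ∧ ((b₂ ∈ p ∧ g₂ ∉ p) ∨ (b₂ ∉ p ∧ g₂ ∈ p))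
  trace₂ : ∀ p, G.IsWalk x₂ p y₂ → (∀ e ∈ p, e ∈ F) →
    b₂ ∈ p ∧ g₂ ∉ p ∧ ((b₁ ∈ p ∧ g₁ ∉ p) ∨ (b₁ ∉ p ∧ g₁ ∈ p))
  existsb₁ : ∃ p, G.IsWalk x₁ p y₁ ∧ (∀ e ∈ p, e ∈ F) ∧ b₂ ∈ p
  existsg₁ : ∃ p, G.IsWalk x₁ p y₁ ∧ (∀ e ∈ p, e ∈ F) ∧ g₂ ∈ p
  existsb₂ : ∃ p, G.IsWalk x₂ p y₂ ∧ (∀ e ∈ p, e ∈ F) ∧ b₁ ∈ p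
  existsg₂ : ∃ p, G.IsWalk x₂ p y₂ ∧ (∀ e ∈ p, e ∈ F) ∧ g₁ ∈ p

open Classical in
-- The edges `b₁`, `b₂` cost 4 and `g₁`, `g₂` cost 1. An agent cooperates if she uses both of `b₁`,
-- `b₂`. Defection pays 3 instead of 4 against a cooperating agent and 5 instead of 6 against a
-- defecting one, so a cooperating agent always deviates. If both defect, they pay 5 each, and the
-- pair deviates to mutual cooperation at 4 each.
theorem HasDilemma.not_admitsSE {F : Set G.E} {x₁ y₁ x₂ y₂ : G.V} {b₁ g₁ b₂ g₂ : G.E}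
    (h : G.HasDilemma F x₁ y₁ x₂ y₂ b₁ g₁ b₂ g₂) : ¬ G.AdmitsSE := by
  obtain ⟨⟨r, hr⟩, htr1, htr2, ⟨p1, hp1, hpF1, hpb⟩, ⟨p2, hp2, hpF2, hpg⟩, ⟨q1, hq1, hqF1, hqb⟩,
    ⟨q2, hq2, hqF2, hqg⟩⟩ := h
  have tp1 := htr1 p1 hp1 hpF1
  have tp2 := htr1 p2 hp2 hpF2
  have tq1 := htr2 q1 hq1 hqF1
  have tq2 := htr2 q2 hq2 hqF2
  simp only [hpb, hpg, hqb, hqg, not_true_eq_false, true_and, false_and, and_false, or_false,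
    false_or, and_true] at tp1 tp2 tq1 tq2
  have hP1 := hr.isPath hp1 hpF1
  have hP2 := hr.isPath hp2 hpF2
  have hQ1 := hr.isPath hq1 hqF1
  have hQ2 := hr.isPath hq2 hqF2
  let c : G.E → ℝ≥0 := fun e => (if e = b₁ then 4 else 0) + (if e = b₂ then 4 else 0) +
    (if e = g₁ then 1 else 0) + (if e = g₂ then 1 else 0)
  let k : G.E → ℕ := fun e => if e ∈ F then 2 else 0
  have hk : ∀ p q : List G.E, (∀ e ∈ p, e ∈ F) → (∀ e ∈ q, e ∈ F) →
      ∀ e, pairLoad p q e ≤ k e := by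
    intro p q hp hq e
    by_cases he : e ∈ F
    · simp only [k, if_pos he, pairLoad]
      split_ifs <;> simp
    · have hep : e ∉ p := fun h => he (hp _ h)
      have heq : e ∉ q := fun h => he (hq _ h)
      simp [pairLoad, hep, heq]
  have hs := pairShare_four (c := c) (e₁ := b₁) (e₂ := b₂) (e₃ := g₁) (e₄ := g₂) fun e => rfl
  refine not_admitsSE_of_pair c k ⟨p1, q1, hP1, hQ1, hk _ _ hpF1 hqF1⟩ ?_
  intro p q hp hq hpq
  obtain ⟨hpF, hqF⟩ := mem_of_pairLoad_le hpq (F := F) fun e he => if_neg he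
  have n1 := hP1.edges_nodup
  have n2 := hP2.edges_nodup
  have m1 := hQ1.edges_nodup
  have m2 := hQ2.edges_nodup
  have np := hp.edges_nodup
  have nq := hq.edges_nodup
  obtain ⟨tp, tp', tp'' | tp''⟩ := htr1 p hp.1 hpF
  · refine Or.inl ⟨p2, hP2, hk _ _ hpF2 hqF, ?_⟩
    obtain ⟨tq, tq', tq'' | tq''⟩ := htr2 q hq.1 hqF <;> rw [hs _ _ n2, hs _ _ np] <;>
      norm_num [pairLoad, tp, tp', tp'', tq, tq', tq'', tp2, hpg]
  obtain ⟨tq, tq', tq'' | tq''⟩ := htr2 q hq.1 hqF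
  · refine Or.inr (Or.inl ⟨q2, hQ2, hk _ _ hpF hqF2, ?_⟩)
    rw [hs _ _ m2, hs _ _ nq]
    norm_num [pairLoad, tp, tp', tp'', tq, tq', tq'', tq2, hqg]
  · refine Or.inr (Or.inr ⟨p1, q1, hP1, hQ1, hk _ _ hpF1 hqF1, ?_⟩)
    rw [hs _ _ n1, hs _ _ np, hs _ _ m1, hs _ _ nq]
    norm_num [pairLoad, tp, tp', tp'', tq, tq', tq'', tp1, tq1, hpb, hqb]

end Network

/-! ### Forks, and the degrees of nodes that are not cuts -/

namespace Network

variable {G : Network.{u, v}}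

/-- Every edge of `F` lies on a walk from the source to the sink along edges of `F`. -/
def IsSpanned (G : Network.{u, v}) (F : Set G.E) : Prop :=
  ∀ e ∈ F, G.Conn F G.source (G.src e) ∧ G.Conn F (G.tgt e) G.sink

/-- Every walk from the source to the sink along edges of `F` visits `x`. -/
def IsCut (G : Network.{u, v}) (F : Set G.E) (x : G.V) : Prop :=
  ∀ p, G.IsWalk G.source p G.sink → (∀ e ∈ p, e ∈ F) → x ∈ G.support G.source p

theorem IsSpanned.rev {F : Set G.E} (h : G.IsSpanned F) : G.rev.IsSpanned F :=
  fun e he => ⟨(h e he).2.rev, (h e he).1.rev⟩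

theorem not_isCut_iff {F : Set G.E} {x : G.V} : ¬ G.IsCut F x ↔
    ∃ p, G.IsWalk G.source p G.sink ∧ (∀ e ∈ p, e ∈ F) ∧ x ∉ G.support G.source p := by
  simp [IsCut]

theorem IsCut.rev {F : Set G.E} {x : G.V} (h : G.rev.IsCut F x) : G.IsCut F x :=
  fun p hp hF => hp.mem_support_rev.1 (h p.reverse hp.rev fun e he => hF e (List.mem_reverse.1 he))

/-- The fork above a node `v` that is avoided by some walk `p` from the source to the sink: from
some node `x` on `p` one can continue either along `p`, by `g`, or to `v`, by `f`, and `F` is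
the set of edges of these two continuations and of all edges that can be reached from `v`. -/
structure IsFork (G : Network.{u, v}) (F₀ : Set G.E) (v : G.V) (p : List G.E) (x : G.V)
    (f g : G.E) (F : Set G.E) : Prop where
  subset : F ⊆ F₀
  conn_mem : ∀ e ∈ F₀, G.Conn F₀ v (G.src e) → e ∈ F
  src_f : G.src f = x
  src_g : G.src g = x
  conn_x : G.Conn F₀ x v
  ne : x ≠ v
  branch : ∃ q, G.IsWalk x q v ∧ (∀ e ∈ q, e ∈ F) ∧ f ∈ q
  main : ∃ p₁ p₂, p = p₁ ++ g :: p₂ ∧ ∀ e ∈ g :: p₂, e ∈ F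
  trace : ∀ y, G.Conn F₀ v y → y ≠ v → ∀ q, G.IsWalk x q y → (∀ e ∈ q, e ∈ F) →
    (g ∈ q ∧ f ∉ q ∧ ∀ e ∈ q, G.src e ≠ v) ∨ (g ∉ q ∧ f ∈ q ∧ ∃ e ∈ q, G.src e = v)

/-- Follow a walk from the source to `v` up to its last node `x` on `p`. The rest of it, the branch,
meets `p` only in `x`. A walk from `x` therefore commits itself with its first edge: after `g` it
never gets back to the branch or to `v`, and after `f` it has to follow the branch to `v`. -/
theorem exists_isFork {F₀ : Set G.E} {r : G.V → ℕ} (hr : G.IsRanking F₀ r) {v : G.V}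
    (hsv : G.Conn F₀ G.source v) (hvt : G.Conn F₀ v G.sink) {p : List G.E}
    (hp : G.IsWalk G.source p G.sink) (hpF : ∀ e ∈ p, e ∈ F₀) (hv : v ∉ G.support G.source p) :
    ∃ x f g F, G.IsFork F₀ v p x f g F := by
  obtain ⟨q, hq, hqF⟩ := hsv
  obtain ⟨q₁, f, q₂, rfl, hfX, hq₂⟩ := hq.last_exit {x | x ∈ G.support G.source p}
    (Or.inl (by simp [support])) hv
  have hqv := isWalk_append_cons.1 hq
  have hfq : G.IsWalk (G.src f) (f :: q₂) v := ⟨rfl, hqv.2⟩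
  have hfqF : ∀ e ∈ f :: q₂, e ∈ F₀ := fun e he => hqF e (List.mem_append_right _ he)
  have hxv : G.Conn F₀ (G.src f) v := ⟨_, hfq, hfqF⟩
  have hxv' : G.src f ≠ v := fun h => hv (h ▸ hfX)
  have hrx := hr.lt_of_conn hxv hxv'
  obtain ⟨p₁, p₂', rfl, hp₁, hp₂⟩ := hp.split hfX
  cases p₂' with
  | nil =>
    have h1 : G.src f = G.sink := hp₂
    have := hr.le_of_conn hvt
    rw [← h1] at this
    omega
  | cons g p₂ =>
  have hgF : ∀ e ∈ g :: p₂, e ∈ F₀ := fun e he => hpF e (List.mem_append_right _ he)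
  let F : Set G.E := {e | e ∈ f :: q₂ ∨ e ∈ g :: p₂ ∨ (e ∈ F₀ ∧ G.Conn F₀ v (G.src e))}
  have hgx := hp₂.1
  have hpv : ∀ e ∈ g :: p₂, G.src e ≠ v := by
    rintro e he rfl
    exact hv (hp.src_mem_support (List.mem_append_right _ he))
  -- facts about the edges of the branch
  have hfsrc : ∀ e ∈ f :: q₂, G.src e ≠ G.src f → G.src e ∉ G.support G.source (p₁ ++ g :: p₂) := by
    intro e he hne
    have h1 := hfq.src_mem_support he
    rcases mem_support.1 h1 with h | ⟨d, hd, hde⟩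
    · exact absurd h hne
    · rw [← hde]
      exact hq₂ d hd
  have hrf : ∀ e ∈ f :: q₂, r (G.src e) < r v := by
    intro e he
    have h1 := hr.le_of_conn (hfq.conn_tgt hfqF he)
    have h2 := hr e (hfqF e he)
    omega
  have hrt : ∀ e ∈ f :: q₂, r (G.src f) < r (G.tgt e) := by
    intro e he
    have h1 := hr.le_of_conn (hfq.conn_src hfqF he)
    have h2 := hr e (hfqF e he)
    omega
  have hrg : ∀ e ∈ p₂, r (G.src f) < r (G.src e) := by
    intro e he
    have h1 := hr.le_of_conn (hp₂.2.conn_src (fun d hd => hgF d (by simp [hd])) he)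
    have h2 := hr g (hgF g (by simp))
    rw [hgx] at h2
    omega
  -- after leaving the branch, a walk stays off the branch
  let Z : Set G.V := {z | (z ≠ v ∧ G.Conn F₀ v z) ∨ ∃ e ∈ g :: p₂, G.tgt e = z}
  have hZx : ∀ z ∈ Z, r (G.src f) < r z := by
    rintro z (⟨-, h⟩ | ⟨e, he, rfl⟩)
    · have := hr.le_of_conn h
      omega
    · have h1 := hr.le_of_conn (hp₂.conn_src hgF he)
      have h2 := hr e (hgF e he)
      omega
  have hZv : v ∉ Z := by
    rintro (⟨h, -⟩ | ⟨e, he, rfl⟩)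
    · exact h rfl
    · exact hv (tgt_mem_support (List.mem_append_right _ he))
  have hZf : ∀ e ∈ f :: q₂, G.src e ∉ Z := by
    intro e he hZ
    by_cases hx : G.src e = G.src f
    · have := hZx _ hZ
      rw [hx] at this
      omega
    · rcases hZ with ⟨-, h⟩ | ⟨d, hd, hde⟩
      · have h1 := hr.le_of_conn h
        have h2 := hrf e he
        omega
      · exact hfsrc e he hx (hde ▸ tgt_mem_support (List.mem_append_right _ hd))
  have L1 : ∀ (q : List G.E) (z y : G.V), z ∈ Z → G.IsWalk z q y → (∀ e ∈ q, e ∈ F) →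
      g ∉ q ∧ f ∉ q ∧ ∀ e ∈ q, G.src e ≠ v := by
    intro q
    induction q with
    | nil => simp
    | cons e q ih =>
      rintro z y hz ⟨rfl, hw⟩ hF
      have hne : G.src e ≠ v := fun h => hZv (h ▸ hz)
      have he : e ∉ f :: q₂ := fun h => hZf e h hz
      have hf : f ≠ e := fun h => he (h ▸ List.mem_cons_self)
      have hg : g ≠ e := by
        rintro rfl
        have := hZx _ hz
        rw [hgx] at this
        omega
      have htZ : G.tgt e ∈ Z := by
        rcases hF e (by simp) with h | h | ⟨h, h'⟩
        · exact absurd h he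
        · exact Or.inr ⟨e, h, rfl⟩
        · refine Or.inl ⟨?_, h'.trans (conn_edge h)⟩
          have h1 := hr.le_of_conn h'
          have h2 := hr e h
          intro h3
          rw [h3] at h2
          omega
      obtain ⟨h1, h2, h3⟩ := ih _ y htZ hw fun d hd => hF d (by simp [hd])
      simp only [List.mem_cons, not_or, forall_eq_or_imp]
      exact ⟨⟨hg, h1⟩, ⟨hf, h2⟩, hne, h3⟩
  -- On the branch before `v` only branch edges are available: the nodes there are not on `p`, and
  -- their ranks are too small for nodes reachable from `v`.
  have L3 : ∀ (q : List G.E) (z y : G.V), (∃ e ∈ f :: q₂, G.tgt e = z) → G.Conn F₀ v y → y ≠ v →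
      G.IsWalk z q y → (∀ e ∈ q, e ∈ F) → g ∉ q ∧ f ∉ q ∧ ∃ e ∈ q, G.src e = v := by
    intro q
    induction q with
    | nil =>
      rintro z y ⟨e, he, rfl⟩ hvy hyv hw -
      obtain rfl : G.tgt e = y := hw
      have h1 := hr.le_of_conn (hfq.conn_tgt hfqF he)
      have h2 := hr.lt_of_conn hvy (Ne.symm hyv)
      omega
    | cons e q ih =>
      rintro z y ⟨d, hd, hdz⟩ hvy hyv ⟨rfl, hw⟩ hF
      have hrd := hrt d hd
      rw [hdz] at hrd
      have hge : g ≠ e := by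
        rintro rfl
        rw [hgx] at hrd
        omega
      have hfe : f ≠ e := by
        rintro rfl
        omega
      by_cases hev : G.src e = v
      · have htZ : G.tgt e ∈ Z := by
          rcases hF e (by simp) with h | h | ⟨h, h'⟩
          · have := hrf e h
            rw [hev] at this
            omega
          · exact absurd hev (hpv e h)
          · refine Or.inl ⟨?_, h'.trans (conn_edge h)⟩
            have h2 := hr e h
            rw [hev] at h2
            intro h3
            rw [h3] at h2
            omega
        obtain ⟨h1, h2, -⟩ := L1 q _ y htZ hw fun d hd => hF d (by simp [hd])
        simp only [List.mem_cons, not_or]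
        exact ⟨⟨hge, h1⟩, ⟨hfe, h2⟩, e, Or.inl rfl, hev⟩
      · have hed : e ∈ f :: q₂ := by
          rcases hF e (by simp) with h | h | ⟨h, h'⟩
          · exact h
          · refine absurd ?_ (hq₂ d hd)
            rw [hdz]
            exact hp.src_mem_support (List.mem_append_right _ h)
          · have h1 := hr.lt_of_conn h' (Ne.symm hev)
            have h2 := hr.le_of_conn (hfq.conn_tgt hfqF hd)
            rw [hdz] at h2
            omega
        obtain ⟨h1, h2, e', he', h3⟩ := ih _ y ⟨e, hed, rfl⟩ hvy hyv hw
          fun d hd => hF d (by simp [hd])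
        simp only [List.mem_cons, not_or]
        exact ⟨⟨hge, h1⟩, ⟨hfe, h2⟩, e', Or.inr he', h3⟩
  have hfg : f ≠ g := by
    rintro rfl
    exact hq₂ f (by simp) (tgt_mem_support (by simp))
  refine ⟨G.src f, f, g, F, ?_, fun e he h => Or.inr (Or.inr ⟨he, h⟩), rfl, hgx, hxv, hxv',
    ⟨_, hfq, fun e he => Or.inl he, by simp⟩, ⟨p₁, p₂, rfl, fun e he => Or.inr (Or.inl he)⟩, ?_⟩
  · rintro e (h | h | h)
    · exact hfqF e h
    · exact hgF e h
    · exact h.1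
  · intro y hvy hyv q hw hF
    cases q with
    | nil =>
      obtain rfl : G.src f = y := hw
      have := hr.le_of_conn hvy
      omega
    | cons e q =>
      obtain ⟨hex, hw⟩ := hw
      have hF' : ∀ d ∈ q, d ∈ F := fun d hd => hF d (by simp [hd])
      have hef : e = f ∨ e = g := by
        rcases hF e (by simp) with h | h | ⟨h, h'⟩
        · exact Or.inl (hr.eq_of_src_eq hfq hfqF h (by simp) hex)
        · exact Or.inr (hr.eq_of_src_eq hp₂ hgF h (by simp) (hex.trans hgx.symm))
        · have := hr.le_of_conn h'
          rw [hex] at this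
          omega
      rcases hef with rfl | rfl
      · obtain ⟨h1, h2, d, hd, h3⟩ := L3 q _ y ⟨e, by simp, rfl⟩ hvy hyv hw hF'
        refine Or.inr ⟨?_, by simp, d, by simp [hd], h3⟩
        simp [h1, Ne.symm hfg]
      · obtain ⟨h1, h2, h3⟩ := L1 q _ y (Or.inr ⟨e, by simp, rfl⟩) hw hF'
        refine Or.inl ⟨by simp, by simp [h2, hfg], ?_⟩
        simp only [List.mem_cons, forall_eq_or_imp]
        exact ⟨hpv e (by simp), h3⟩

/-- On a network that admits a strong equilibrium, no node with two outgoing edges can be avoided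
by a walk from the source to the sink. -/
theorem eq_of_src_eq_of_not_isCut (hno : ∀ F x y e₁ e₂ f g, ¬ G.HasTriple F x y e₁ e₂ f g)
    {F : Set G.E} {r : G.V → ℕ} (hr : G.IsRanking F r) (hF : G.IsSpanned F) {d e : G.E}
    (hd : d ∈ F) (he : e ∈ F) (hde : G.src d = G.src e) (hcut : ¬ G.IsCut F (G.src e)) :
    d = e := by
  by_contra hne
  obtain ⟨p, hp, hpF, hv⟩ := not_isCut_iff.1 hcut
  have hvt : ∀ e' ∈ F, G.Conn F (G.src e') G.sink := fun e' he' =>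
    (conn_edge he').trans (hF e' he').2
  obtain ⟨x, f, g, F', hfork⟩ := exists_isFork hr (hF e he).1 (hvt e he) hp hpF hv
  -- Of the edges leaving the node `src e`, only `d` and `e` are kept. The triple is then `d`, `e`,
  -- `f`, `g` for agents from `x` to the sink.
  let F'' : Set G.E := {c | c ∈ F' ∧ (G.src c = G.src e → c = d ∨ c = e)}
  have hsink : G.sink ≠ G.src e := by
    intro h
    have h1 := hr e he
    have h2 := hr.le_of_conn (hF e he).2
    rw [h] at h2
    omega
  obtain ⟨q, hq, hqF, hfq⟩ := hfork.branch
  have hqF'' : ∀ c ∈ q, c ∈ F'' := by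
    intro c hc
    refine ⟨hqF c hc, fun h => ?_⟩
    have h1 := hr.le_of_conn (hq.conn_tgt (fun d hd => hfork.subset (hqF d hd)) hc)
    have h2 := hr c (hfork.subset (hqF c hc))
    rw [h] at h2
    omega
  have hex : ∀ c, (c = d ∨ c = e) → ∃ q, G.IsWalk x q G.sink ∧ (∀ c ∈ q, c ∈ F'') ∧ c ∈ q := by
    intro c hc
    have hcF : c ∈ F := by rcases hc with rfl | rfl <;> assumption
    have hcv : G.src c = G.src e := by rcases hc with rfl | rfl <;> simp [hde]
    obtain ⟨w, hw, hwF⟩ := (hF c hcF).2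
    refine ⟨q ++ c :: w, hq.append ⟨hcv, hw⟩, fun a ha => ?_, by simp⟩
    rcases List.mem_append.1 ha with ha | ha
    · exact hqF'' a ha
    · rcases List.mem_cons.1 ha with rfl | ha
      · exact ⟨hfork.conn_mem _ hcF (hcv ▸ Conn.refl _), fun _ => hc⟩
      · have h1 : G.Conn F (G.tgt c) (G.src a) := hw.conn_src hwF ha
        have h2 : G.Conn F (G.src e) (G.src a) := hcv ▸ (conn_edge hcF).trans h1
        refine ⟨hfork.conn_mem _ (hwF a ha) h2, fun h => ?_⟩
        have h3 := hr.le_of_conn h1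
        have h4 := hr c hcF
        rw [h] at h3
        rw [hcv] at h4
        omega
  have hF''F : ∀ c ∈ F'', c ∈ F := fun c hc => hfork.subset hc.1
  refine hno F'' x G.sink d e f g ⟨⟨r, hr.mono hF''F⟩, fun q hq hqF => ?_, hex d (Or.inl rfl),
    hex e (Or.inr rfl), ?_⟩
  -- A walk by `g` misses `src e` and so both edges; a walk by `f` leaves `src e`, and by acyclicity
  -- only once.
  · rcases hfork.trace _ (hvt e he) hsink q hq fun c hc => (hqF c hc).1 with
      ⟨h1, h2, h3⟩ | ⟨h1, h2, c, hc, h3⟩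
    · exact Or.inr (Or.inr ⟨fun h => h3 d h hde, fun h => h3 e h rfl, h2, h1⟩)
    · have huniq : ∀ a b, a ∈ q → b ∈ q → G.src a = G.src b → a = b := fun a b ha hb hab =>
        hr.eq_of_src_eq hq (fun c hc => hF''F c (hqF c hc)) ha hb hab
      rcases (hqF c hc).2 h3 with rfl | rfl
      · exact Or.inl ⟨hc, fun h => hne (huniq _ _ hc h hde), h2, h1⟩
      · exact Or.inr (Or.inl ⟨fun h => hne (huniq _ _ h hc hde), hc, h2, h1⟩)
  · obtain ⟨p₁, p₂, rfl, hg⟩ := hfork.main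
    refine ⟨g :: p₂, ?_, fun c hc => ⟨hg c hc, fun h => ?_⟩, by simp⟩
    · exact ⟨hfork.src_g, (isWalk_append_cons.1 hp).2⟩
    · exact absurd (hp.src_mem_support (List.mem_append_right _ hc)) (h ▸ hv)

theorem eq_of_tgt_eq_of_not_isCut [Finite G.V]
    (hno : ∀ F x y e₁ e₂ f g, ¬ G.HasTriple F x y e₁ e₂ f g)
    {F : Set G.E} {r : G.V → ℕ} (hr : G.IsRanking F r) (hF : G.IsSpanned F) {d e : G.E}
    (hd : d ∈ F) (he : e ∈ F) (hde : G.tgt d = G.tgt e) (hcut : ¬ G.IsCut F (G.tgt e)) :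
    d = e := by
  obtain ⟨r', hr'⟩ := hr.exists_rev
  exact eq_of_src_eq_of_not_isCut (G := G.rev) (fun F x y e₁ e₂ f g h => hno F y x e₁ e₂ f g h.of_rev)
    hr' hF.rev hd he hde fun h => hcut h.rev

end Network

/-! ### Absence of directed cycles -/

namespace Network

variable {G : Network.{u, v}}

/-- The nodes touched by `F`, together with the source and the sink. -/
def touched (G : Network.{u, v}) (F : Set G.E) : Set G.V :=
  {x | x = G.source ∨ x = G.sink ∨ ∃ e ∈ F, G.src e = x ∨ G.tgt e = x}

theorem IsSpanned.conn_source {F : Set G.E} (hF : G.IsSpanned F) {x : G.V}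
    (hx : x ∈ G.touched F) (h : x ≠ G.sink) : G.Conn F G.source x := by
  rcases hx with rfl | rfl | ⟨e, he, rfl | rfl⟩
  · exact Conn.refl _
  · exact absurd rfl h
  · exact (hF e he).1
  · exact (hF e he).1.trans (conn_edge he)

theorem IsSpanned.conn_sink {F : Set G.E} (hF : G.IsSpanned F) {x : G.V}
    (hx : x ∈ G.touched F) (h : x ≠ G.source) : G.Conn F x G.sink := by
  rcases hx with rfl | rfl | ⟨e, he, rfl | rfl⟩
  · exact absurd rfl h
  · exact Conn.refl _
  · exact (conn_edge he).trans (hF e he).2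
  · exact (hF e he).2

open Classical in
/-- Adding a path `q` from `a` to `b` with fresh inner nodes creates no directed cycle unless `a`
can be reached from `b`. -/
theorem IsRanking.exists_union {F : Set G.E} {r : G.V → ℕ} (hr : G.IsRanking F r) {a b : G.V}
    {q : List G.E} (hq : G.IsPath a q b)
    (hfresh : ∀ x ∈ G.support a q, x ∈ G.touched F → x = a ∨ x = b) (hba : ¬ G.Conn F b a) :
    ∃ r', G.IsRanking (F ∪ {e | e ∈ q}) r' := by
  let L := G.support a q
  let K := q.length + 1
  -- Shifting all that is reachable from `b` keeps the edges of `F` increasing and lifts `b` above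
  -- `a`, which is itself not shifted.
  let r₁ : G.V → ℕ := fun x => r x + if G.Conn F b x then r a + 1 else 0
  have hr₁ : ∀ e ∈ F, r₁ (G.src e) < r₁ (G.tgt e) := by
    intro e he
    have h1 := hr e he
    by_cases h : G.Conn F b (G.src e)
    · have h' := h.trans (conn_edge he)
      simp only [r₁, if_pos h, if_pos h']
      omega
    · simp only [r₁, if_neg h]
      omega
  have hab : r₁ a < r₁ b := by
    simp only [r₁, if_neg hba, if_pos (Conn.refl b)]
    omega
  -- Scaling by `K` makes room above `a` for the inner nodes of `q`. Since `a` has index 0, both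
  -- rules agree there.
  let r₂ : G.V → ℕ := fun x => if x ∈ L ∧ x ≠ b then K * r₁ a + L.idxOf x else K * r₁ x
  have hL : L.Nodup := hq.2
  have htouched : ∀ x ∈ G.touched F, r₂ x = K * r₁ x := by
    intro x hx
    by_cases h : x ∈ L ∧ x ≠ b
    · obtain rfl := (hfresh x h.1 hx).resolve_right h.2
      simp [r₂, h, L, support]
    · simp only [r₂, if_neg h]
  refine ⟨r₂, ?_⟩
  rintro e (he | he)
  · rw [htouched _ (Or.inr (Or.inr ⟨e, he, Or.inl rfl⟩)),
      htouched _ (Or.inr (Or.inr ⟨e, he, Or.inr rfl⟩))]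
    exact Nat.mul_lt_mul_of_pos_left (hr₁ e he) (Nat.succ_pos _)
  · obtain ⟨i, hi, rfl⟩ := List.getElem_of_mem (show e ∈ q from he)
    have hlen : L.length = q.length + 1 := by simp [L, support]
    have hsrc : G.src q[i] = L[i] := hq.1.src_getElem i hi
    have htgt : G.tgt q[i] = L[i + 1] := tgt_getElem i hi
    have hsb : G.src q[i] ≠ b := by
      intro h
      obtain ⟨p₁, p₂, hp⟩ := List.append_of_mem (List.getElem_mem hi)
      have h1 := hq.1
      rw [hp] at h1
      have h2 := (isWalk_append_cons.1 h1).2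
      have h3 : b ∈ G.support (G.tgt q[i]) p₂ := h2.end_mem_support
      have h4 : G.src q[i] ∈ G.support a p₁ := (isWalk_append_cons.1 h1).1.end_mem_support
      have h5 := hq.2
      have h6 : G.support a q = G.support a p₁ ++ G.support (G.tgt q[i]) p₂ := by
        conv_lhs => rw [hp]
        simp [support]
      rw [h6] at h5
      exact (List.disjoint_of_nodup_append h5) (h ▸ h4) h3
    have h1 : r₂ (G.src q[i]) = K * r₁ a + i := by
      have : G.src q[i] ∈ L ∧ G.src q[i] ≠ b := ⟨hsrc ▸ List.getElem_mem _, hsb⟩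
      simp only [r₂, if_pos this]
      rw [hsrc, hL.idxOf_getElem]
    rw [h1]
    by_cases htb : G.tgt q[i] = b
    · have h2 : r₂ (G.tgt q[i]) = K * r₁ b := by
        simp [r₂, htb]
      rw [h2]
      calc K * r₁ a + i < K * r₁ a + K := by simp only [K]; omega
        _ = K * (r₁ a + 1) := by ring
        _ ≤ K * r₁ b := Nat.mul_le_mul_left _ hab
    · have h2 : r₂ (G.tgt q[i]) = K * r₁ a + (i + 1) := by
        have : G.tgt q[i] ∈ L ∧ G.tgt q[i] ≠ b := ⟨htgt ▸ List.getElem_mem _, htb⟩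
        simp only [r₂, if_pos this]
        rw [htgt, hL.idxOf_getElem]
      omega

theorem IsSpanned.union {F : Set G.E} (hF : G.IsSpanned F) {a b : G.V} {q : List G.E}
    (hq : G.IsWalk a q b) (ha : G.Conn F G.source a) (hb : G.Conn F b G.sink) :
    G.IsSpanned (F ∪ {e | e ∈ q}) := by
  have hq' : ∀ e ∈ q, e ∈ F ∪ {e | e ∈ q} := fun e he => Or.inr he
  rintro e (he | he)
  · exact ⟨(hF e he).1.mono Set.subset_union_left, (hF e he).2.mono Set.subset_union_left⟩
  · exact ⟨(ha.mono Set.subset_union_left).trans (hq.conn_src hq' he),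
      (hq.conn_tgt hq' he).trans (hb.mono Set.subset_union_left)⟩

/-- `F` is maximal among the sets of edges that contain no directed cycle and are spanned. -/
def IsMaxAcyclic (G : Network.{u, v}) (F : Set G.E) : Prop :=
  Maximal (fun F => (∃ r, G.IsRanking F r) ∧ G.IsSpanned F) F

theorem IsPath.of_append_right {a c : G.V} {p q : List G.E} (h : G.IsPath a (p ++ q) c) {b : G.V}
    (hp : G.IsWalk a p b) (hq : G.IsWalk b q c) : G.IsPath b q c := by
  refine ⟨hq, ?_⟩
  have h2 := h.2
  rcases List.eq_nil_or_concat p with rfl | ⟨p', e, rfl⟩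
  · obtain rfl : a = b := hp
    exact h2
  · have h3 : G.support a (p'.concat e ++ q) = G.support a p' ++ G.support (G.tgt e) q := by
      simp [support]
    rw [List.concat_eq_append] at hp
    obtain rfl : G.tgt e = b := (isWalk_append_cons.1 hp).2
    rw [h3] at h2
    exact h2.of_append_right

theorem IsPath.of_append_left {a c : G.V} {p q : List G.E} (h : G.IsPath a (p ++ q) c) {b : G.V}
    (hp : G.IsWalk a p b) : G.IsPath a p b := by
  refine ⟨hp, ?_⟩
  have h2 := h.2
  have h3 : G.support a (p ++ q) = G.support a p ++ q.map G.tgt := by simp [support]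
  rw [h3] at h2
  exact h2.of_append_left

theorem IsPath.source_ne {a c : G.V} {p : List G.E} (h : G.IsPath a p c) {e : G.E} (he : e ∈ p) :
    G.tgt e ≠ a := by
  rintro rfl
  exact (List.nodup_cons.1 h.2).1 (List.mem_map_of_mem he)

/-- A path that leaves a maximal acyclic set `F` of edges returns to a node from which its starting
node can be reached along `F`. -/
theorem IsMaxAcyclic.exists_return {F : Set G.E} (hF : G.IsMaxAcyclic F) {a : G.V}
    (ha : a ∈ G.touched F) (has : a ≠ G.sink) {e : G.E} {q : List G.E}
    (hq : G.IsPath a (e :: q) G.sink) (he : e ∉ F) (hqs : ∀ d ∈ e :: q, G.tgt d ≠ G.source) :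
    ∃ q₁ q₂ b, e :: q = q₁ ++ q₂ ∧ q₁ ≠ [] ∧ G.IsWalk a q₁ b ∧ G.IsWalk b q₂ G.sink ∧
      G.Conn F b a := by
  -- The segment ends at the first touched node after `a`, so its inner nodes are fresh.
  obtain ⟨q₁, d, q₂, hd, hdX, hq₁⟩ := exists_first_entry (G := G) (X := G.touched F)
    (p := e :: q) (by
      obtain ⟨d, hd, hds⟩ := hq.1.exists_tgt_eq (by simp)
      exact ⟨d, hd, hds ▸ Or.inr (Or.inl rfl)⟩)
  have hq' := hq
  rw [hd] at hq'
  have hw := isWalk_append_cons.1 hq'.1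
  have hw₁ : G.IsWalk a (q₁ ++ [d]) (G.tgt d) := hw.1.append ⟨rfl, rfl⟩
  refine ⟨q₁ ++ [d], q₂, G.tgt d, by simpa using hd, by simp, hw₁, hw.2, ?_⟩
  -- Otherwise `F` could be enlarged by the segment, which contains `e`, and would stay acyclic and
  -- spanned, against maximality.
  by_contra hba
  obtain ⟨⟨r, hr⟩, hsp⟩ := hF.prop
  have hp₁ : G.IsPath a (q₁ ++ [d]) (G.tgt d) := by
    refine IsPath.of_append_left (q := q₂) (c := G.sink) ?_ hw₁
    simpa using hq'
  have hrank := hr.exists_union hp₁ (fun x hx hxt => ?_) hba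
  · have hspan := hsp.union hw₁ (hsp.conn_source ha has)
      (hsp.conn_sink hdX (hqs d (by rw [hd]; simp)))
    have hle := hF.le_of_ge ⟨hrank, hspan⟩ Set.subset_union_left
    refine he (hle (Or.inr ?_))
    cases q₁ with
    | nil =>
      simp only [List.nil_append, List.cons.injEq] at hd
      simp [hd.1]
    | cons c q₁ =>
      simp only [List.cons_append, List.cons.injEq] at hd
      simp [hd.1]
  · rcases mem_support.1 hx with rfl | ⟨c, hc, rfl⟩
    · exact Or.inl rfl
    · rcases List.mem_append.1 hc with hc | hc
      · exact absurd hxt (hq₁ c hc)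
      · rw [List.mem_singleton] at hc
        exact Or.inr (by rw [hc])

/-- On a network that admits a strong equilibrium there is no directed cycle. -/
theorem exists_isRanking_univ [Finite G.V] [Finite G.E]
    (hno : ∀ F x y e₁ e₂ f g, ¬ G.HasTriple F x y e₁ e₂ f g) (hG : G.IsTwoTerminal) :
    ∃ r, G.IsRanking Set.univ r := by
  obtain ⟨F, hF⟩ : ∃ F, G.IsMaxAcyclic F := by
    apply (Set.toFinite {F | (∃ r, G.IsRanking F r) ∧ G.IsSpanned F}).exists_maximal
    exact ⟨∅, ⟨fun _ => 0, by simp [IsRanking]⟩, by simp [IsSpanned]⟩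
  obtain ⟨⟨r, hr⟩, hsp⟩ := hF.prop
  suffices h : ∀ e, e ∈ F by
    exact ⟨r, fun e _ => hr e (h e)⟩
  intro e₀
  by_contra he₀
  obtain ⟨Q, hQ, heQ⟩ := hG.edge_on_path e₀
  -- the first edge of `Q` that is not in `F`
  obtain ⟨Q₁, e, Q₂, rfl, he, hQ₁⟩ : ∃ Q₁ e Q₂, Q = Q₁ ++ e :: Q₂ ∧ e ∉ F ∧ ∀ d ∈ Q₁, d ∈ F := by
    clear hQ
    induction Q with
    | nil => simp at heQ
    | cons c Q ih =>
      by_cases hc : c ∈ F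
      · rcases List.mem_cons.1 heQ with rfl | h
        · exact absurd hc he₀
        · obtain ⟨Q₁, e, Q₂, rfl, he, h⟩ := ih h
          exact ⟨c :: Q₁, e, Q₂, rfl, he, by simpa [hc] using h⟩
      · exact ⟨[], c, Q, rfl, hc, by simp⟩
  have hw := isWalk_append_cons.1 hQ.1
  have hQs : ∀ d ∈ Q₁ ++ e :: Q₂, G.tgt d ≠ G.source := fun d hd => hQ.source_ne hd
  have hpe := hQ.of_append_right hw.1 ⟨rfl, hw.2⟩
  have hyF : G.src e ∈ G.touched F := by
    rcases mem_support.1 hw.1.end_mem_support with h | ⟨d, hd, h⟩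
    · exact Or.inl h
    · exact Or.inr (Or.inr ⟨d, hQ₁ d hd, Or.inr h⟩)
  have hyt : G.src e ≠ G.sink := by
    intro h
    obtain ⟨d, hd, hde⟩ := hpe.1.exists_tgt_eq (by simp)
    exact hpe.source_ne hd (hde.trans h.symm)
  obtain ⟨q₁, q₂, z, hqq, hq₁, hwz, hwz', W, hW, hWF⟩ := hF.exists_return hyF hyt hpe he
    fun d hd => hQs d (List.mem_append_right _ hd)
  -- `z` is not on the first part of `Q`
  have hdisj : ∀ d ∈ e :: Q₂, G.tgt d ∉ G.support G.source Q₁ := by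
    intro d hd h
    have h2 := hQ.2
    have h3 : G.support G.source (Q₁ ++ e :: Q₂) =
        G.support G.source Q₁ ++ (e :: Q₂).map G.tgt := by simp [support]
    rw [h3] at h2
    exact List.disjoint_of_nodup_append h2 h (List.mem_map_of_mem hd)
  obtain ⟨d₀, hd₀, hd₀z⟩ := hwz.exists_tgt_eq hq₁
  have hd₀Q : d₀ ∈ e :: Q₂ := hqq ▸ List.mem_append_left _ hd₀
  have hzX : z ∉ G.support G.source Q₁ := hd₀z ▸ hdisj d₀ hd₀Q
  have hWne : W ≠ [] := by
    rintro rfl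
    obtain rfl : z = G.src e := hW
    exact hzX hw.1.end_mem_support
  obtain ⟨W₁, d, W₂, rfl, hdX, hW₁⟩ := exists_first_entry (G := G)
    (X := {x | x ∈ G.support G.source Q₁}) (p := W) (by
      obtain ⟨d, hd, hde⟩ := hW.exists_tgt_eq hWne
      exact ⟨d, hd, hde ▸ hw.1.end_mem_support⟩)
  have hWw := isWalk_append_cons.1 hW
  have hdF : d ∈ F := hWF d (by simp)
  have hdsrc : G.src d ∉ G.support G.source Q₁ := by
    rcases mem_support.1 hWw.1.end_mem_support with h | ⟨c, hc, h⟩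
    · rw [h]
      exact hzX
    · rw [← h]
      exact hW₁ c hc
  -- The walk `W` leads back to the first part `Q₁` of the path, and `d` is where it enters. The
  -- node `tgt d` is also entered by an edge of `Q₁`, which starts on `Q₁` while `d` does not. Two
  -- incoming edges force a cut. The source, the only node of `Q₁` without such an edge, has no
  -- incoming edge in `F`.
  have hcut : G.IsCut F (G.tgt d) := by
    by_contra hcut
    rcases mem_support.1 (show G.tgt d ∈ G.support G.source Q₁ from hdX) with h | ⟨c, hc, h⟩
    · have h1 := hr.le_of_conn (hsp d hdF).1
      have h2 := hr d hdF
      rw [h] at h2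
      omega
    · have := eq_of_tgt_eq_of_not_isCut hno hr hsp (hQ₁ c hc) hdF h hcut
      subst this
      exact hdsrc (hw.1.src_mem_support hc)
  have hmt : G.Conn F (G.tgt d) G.sink := (hsp d hdF).2
  -- the rest of `Q` is stuck below the node `tgt d`
  have key : ∀ (N : ℕ) (q : List G.E) (a : G.V), q.length ≤ N → G.IsPath a q G.sink →
      (∀ c ∈ q, G.tgt c ≠ G.source ∧ G.tgt c ≠ G.tgt d) → G.Conn F a (G.tgt d) →
      a ≠ G.tgt d → a ∈ G.touched F → False := by
    intro N
    induction N with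
    | zero =>
      intro q a hN hq hqd ham hne _
      obtain rfl : q = [] := List.length_eq_zero_iff.1 (Nat.le_zero.1 hN)
      obtain rfl : a = G.sink := hq.1
      have h1 := hr.lt_of_conn ham hne
      have h2 := hr.le_of_conn hmt
      omega
    | succ N ih =>
      intro q a hN hq hqd ham hne hat
      have has : a ≠ G.sink := by
        rintro rfl
        have h1 := hr.lt_of_conn ham hne
        have h2 := hr.le_of_conn hmt
        omega
      cases q with
      | nil => exact has hq.1
      | cons c q =>
        by_cases hc : c ∈ F
        · have hca : G.src c = a := hq.1.1
          have htc := hqd c (by simp)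
          refine ih q (G.tgt c) (by simpa using hN)
            (IsPath.of_append_right (p := [c]) hq ⟨hca, rfl⟩ hq.1.2)
            (fun x hx => hqd x (by simp [hx])) ?_ htc.2 (Or.inr (Or.inr ⟨c, hc, Or.inr rfl⟩))
          -- Extend `c` within `F` to a walk from the source to the sink. It meets the cut `tgt d`,
          -- and not before `c`, because `tgt d` is reachable from `a` and distinct from it. So `tgt
          -- d` is still reachable after `c`.
          obtain ⟨A, hA, hAF⟩ := (hsp c hc).1
          obtain ⟨B, hB, hBF⟩ := (hsp c hc).2
          have hmem := hcut (A ++ c :: B) (isWalk_append_cons.2 ⟨hA, hB⟩) (by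
            intro x hx
            rcases List.mem_append.1 hx with hx | hx
            · exact hAF x hx
            · rcases List.mem_cons.1 hx with rfl | hx
              · exact hc
              · exact hBF x hx)
          have h3 : G.support G.source (A ++ c :: B) =
              G.support G.source A ++ G.support (G.tgt c) B := by simp [support]
          rw [h3] at hmem
          rcases List.mem_append.1 hmem with h | h
          · have h1 := hr.le_of_conn (hA.conn_of_mem hAF h).2
            have h2 := hr.lt_of_conn ham hne
            rw [hca] at h1
            omega
          · exact (hB.conn_of_mem hBF h).1
        -- When the path leaves `F`, it comes back to a node `b` above `a`, from which `tgt d` is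
        -- reachable as well.
        · obtain ⟨q₁, q₂, b, hqq, hq₁, hwb, hwb', hba⟩ := hF.exists_return hat has hq hc
            fun x hx => (hqd x hx).1
          obtain ⟨x, hx, hxb⟩ := hwb.exists_tgt_eq hq₁
          have hxq : x ∈ c :: q := hqq ▸ List.mem_append_left _ hx
          have hlen : (c :: q).length = q₁.length + q₂.length := by rw [hqq, List.length_append]
          have hpos := List.length_pos_iff.2 hq₁
          refine ih q₂ b (by omega) (IsPath.of_append_right (hqq ▸ hq) hwb hwb')
            (fun x hx => hqd x (hqq ▸ List.mem_append_right _ hx)) (hba.trans ham)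
            (hxb ▸ (hqd x hxq).2) ?_
          obtain ⟨p, hp, hpF⟩ := hba
          cases p with
          | nil =>
            obtain rfl : b = a := hp
            exact hat
          | cons y p => exact Or.inr (Or.inr ⟨y, hpF y (by simp), Or.inl hp.1⟩)
  refine key _ q₂ z le_rfl (IsPath.of_append_right (hqq ▸ hpe) hwz hwz') (fun c hc => ?_)
    ⟨W₁ ++ [d], hWw.1.append ⟨rfl, rfl⟩, fun x hx => hWF x ?_⟩ ?_ ?_
  · have hcQ : c ∈ e :: Q₂ := hqq ▸ List.mem_append_right _ hc
    exact ⟨hQs c (List.mem_append_right _ hcQ), fun h => hdisj c hcQ (h ▸ hdX)⟩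
  · rcases List.mem_append.1 hx with h | h
    · exact List.mem_append_left _ h
    · rw [List.mem_singleton] at h
      simp [h]
  · rintro rfl
    exact hzX hdX
  · cases W₁ with
    | nil => exact Or.inr (Or.inr ⟨d, hdF, Or.inl hWw.1.symm⟩)
    | cons y W₁ => exact Or.inr (Or.inr ⟨y, hWF y (by simp), Or.inl hWw.1.1⟩)

end Network

/-! ### Cuts between two nodes that are not cuts -/

namespace Network

variable {G : Network.{u, v}}

theorem eq_of_reverse_eq {α : Type*} {p p₁ p₂ : List α} {a : α} (h : p.reverse = p₁ ++ a :: p₂) :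
    p = p₂.reverse ++ a :: p₁.reverse := by
  rw [← List.reverse_reverse p, h]
  simp

/-- The fork below `w`, read off from the fork above `w` in the reversed network: walks into `y`
arrive either through `w` or by `g`. -/
theorem exists_isFork_rev [Finite G.V] {F₀ : Set G.E} {r : G.V → ℕ} (hr : G.IsRanking F₀ r)
    {w : G.V} (hsw : G.Conn F₀ G.source w) (hwt : G.Conn F₀ w G.sink) {p : List G.E}
    (hp : G.IsWalk G.source p G.sink) (hpF : ∀ e ∈ p, e ∈ F₀) (hw : w ∉ G.support G.source p) :
    ∃ (y : G.V) (f g : G.E) (F : Set G.E), (∀ e ∈ F₀, G.Conn F₀ (G.tgt e) w → e ∈ F) ∧ G.tgt g = y ∧ G.Conn F₀ w y ∧ y ≠ w ∧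
      (∃ q, G.IsWalk w q y ∧ (∀ e ∈ q, e ∈ F) ∧ f ∈ q) ∧
      (∃ p₁ p₂, p = p₁ ++ g :: p₂ ∧ (∀ e ∈ p₁, e ∈ F) ∧ g ∈ F) ∧
      ∀ x, G.Conn F₀ x w → x ≠ w → ∀ q, G.IsWalk x q y → (∀ e ∈ q, e ∈ F) →
        (g ∈ q ∧ ∀ e ∈ q, G.tgt e ≠ w) ∨ (g ∉ q ∧ ∃ e ∈ q, G.tgt e = w) := by
  obtain ⟨r', hr'⟩ := hr.exists_rev
  have hmem : ∀ (e : G.E) (q : List G.E), e ∈ q.reverse ↔ e ∈ q := fun e q => List.mem_reverse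
  obtain ⟨y, f, g, F, hfork⟩ := exists_isFork (G := G.rev) (v := w) hr' hwt.rev hsw.rev hp.rev
    (fun e he => hpF e ((hmem _ _).1 he)) fun h => hw (hp.mem_support_rev.1 h)
  refine ⟨y, f, g, F, fun e he h => hfork.conn_mem e he h.rev, hfork.src_g,
    Conn.rev (G := G.rev) hfork.conn_x, hfork.ne, ?_, ?_, fun x hx hxw q hq hqF => ?_⟩
  · obtain ⟨q, hq, hqF, hf⟩ := hfork.branch
    exact ⟨q.reverse, IsWalk.rev (G := G.rev) hq, fun e he => hqF e ((hmem _ _).1 he),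
      (hmem _ _).2 hf⟩
  · obtain ⟨p₁, p₂, hpp, hF⟩ := hfork.main
    refine ⟨List.reverse (α := G.E) p₂, List.reverse (α := G.E) p₁, ?_,
      fun e he => hF e (List.mem_cons_of_mem _ ((hmem _ _).1 he)), hF g List.mem_cons_self⟩
    exact eq_of_reverse_eq hpp
  · rcases hfork.trace x hx.rev hxw q.reverse hq.rev fun e he => hqF e ((hmem _ _).1 he) with
      ⟨h1, -, h3⟩ | ⟨h1, -, e, he, h3⟩
    · exact Or.inl ⟨(hmem _ _).1 h1, fun e he => h3 e ((hmem _ _).2 he)⟩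
    · exact Or.inr ⟨fun h => h1 ((hmem _ _).2 h), e, (hmem _ _).1 he, h3⟩

/-- On a network that admits a strong equilibrium, no node that is visited by all walks from the
source to the sink separates two nodes that are not. -/
theorem false_of_isCut_between [Finite G.V]
    (hno : ∀ F x y e₁ e₂ f g, ¬ G.HasTriple F x y e₁ e₂ f g)
    (hno' : ∀ F x₁ y₁ x₂ y₂ b₁ g₁ b₂ g₂, ¬ G.HasDilemma F x₁ y₁ x₂ y₂ b₁ g₁ b₂ g₂)
    {r : G.V → ℕ} (hr : G.IsRanking Set.univ r) (hsp : G.IsSpanned Set.univ)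
    (hc : ∀ x, G.Conn Set.univ G.source x ∧ G.Conn Set.univ x G.sink) {u m w : G.V}
    (hu : ¬ G.IsCut Set.univ u) (hm : G.IsCut Set.univ m) (hw : ¬ G.IsCut Set.univ w)
    (hum : G.Conn Set.univ u m) (hmw : G.Conn Set.univ m w) : False := by
  have hum' : u ≠ m := fun h => hu (h ▸ hm)
  have hmw' : m ≠ w := fun h => hw (h ▸ hm)
  have rum := hr.lt_of_conn hum hum'
  have rmw := hr.lt_of_conn hmw hmw'
  have huw : u ≠ w := fun h => by
    rw [h] at rum
    omega
  have huniv : ∀ p : List G.E, ∀ e ∈ p, e ∈ Set.univ := fun _ _ _ => Set.mem_univ _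
  obtain ⟨P, hP, -, huP⟩ := not_isCut_iff.1 hu
  obtain ⟨P', hP', -, hwP'⟩ := not_isCut_iff.1 hw
  obtain ⟨x, f₁, g₁, F₁, hf⟩ := exists_isFork hr (hc u).1 (hc u).2 hP (huniv P) huP
  obtain ⟨y, f₂, g₂, F₂, hmem₂, hg₂, hwy, hyw, ⟨B₂, hB₂, hB₂F, -⟩, ⟨p₁', p₂', hP'eq, hp₁'F, hg₂F⟩,
    htr₂⟩ := exists_isFork_rev hr (hc w).1 (hc w).2 hP' (huniv P') hwP'
  have rxu := hr.lt_of_conn hf.conn_x hf.ne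
  have rwy := hr.lt_of_conn hwy (Ne.symm hyw)
  obtain ⟨W, hW, -⟩ := hum
  obtain ⟨W', hW', -⟩ := hmw
  cases W with
  | nil => exact hum' hW
  | cons b₁ W =>
  obtain ⟨b₂, hb₂W, hb₂⟩ := hW'.exists_tgt_eq (by rintro rfl; exact hmw' hW')
  have hb₁ : G.src b₁ = u := hW.1
  have hF₁ : ∀ {p z}, G.IsWalk u p z → ∀ e ∈ p, e ∈ F₁ := fun hp e he =>
    hf.conn_mem e trivial (hp.conn_src (huniv _) he)
  have hF₂ : ∀ {p z}, G.IsWalk z p w → ∀ e ∈ p, e ∈ F₂ := fun hp e he =>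
    hmem₂ e trivial (hp.conn_tgt (huniv _) he)
  have huw' := hW.append hW'
  -- As `u` and `w` are not cuts, `b₁` is the only edge out of `u` and `b₂` the only edge into `w`.
  have hb₁u : ∀ e, G.src e = u → e = b₁ := fun e he =>
    eq_of_src_eq_of_not_isCut hno hr hsp trivial trivial (he.trans hb₁.symm) (hb₁ ▸ hu)
  have hb₂u : ∀ e, G.tgt e = w → e = b₂ := fun e he =>
    eq_of_tgt_eq_of_not_isCut hno hr hsp trivial trivial (he.trans hb₂.symm) (hb₂ ▸ hw)
  have hand : ∀ p : List G.E, (∀ e ∈ p, e ∈ F₁) → (∀ e ∈ p, e ∈ F₂) → ∀ e ∈ p, e ∈ F₁ ∩ F₂ :=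
    fun p h h' e he => ⟨h e he, h' e he⟩
  obtain ⟨B₁, hB₁, hB₁F, -⟩ := hf.branch
  -- The first agent travels from `u` to `y`: she leaves by `b₁` and arrives either through `w`, by
  -- `b₂`, or by `g₂`. The second travels from `x` to `w`: she arrives by `b₂` and starts either
  -- towards `u`, and so uses `b₁`, or by `g₁`. The cut `m` makes the options by `g₁` and `g₂`
  -- available.
  refine hno' (F₁ ∩ F₂) u y x w b₁ g₁ b₂ g₂ ⟨⟨r, hr.mono (Set.subset_univ _)⟩, ?_, ?_, ?_, ?_, ?_, ?_⟩
  · intro p hp hpF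
    refine ⟨?_, ?_, ?_⟩
    · cases p with
      | nil =>
        obtain rfl : u = y := hp
        omega
      | cons e p => simp [hb₁u e hp.1]
    · intro h
      have := hr.le_of_conn (hp.conn_src (huniv _) h)
      rw [hf.src_g] at this
      omega
    · rcases htr₂ u ⟨_, huw', huniv _⟩ huw p hp fun e he => (hpF e he).2 with
        ⟨h1, h2⟩ | ⟨h1, e, he, h2⟩
      · exact Or.inr ⟨fun h => h2 _ h hb₂, h1⟩
      · exact Or.inl ⟨hb₂u e h2 ▸ he, h1⟩
  · intro p hp hpF
    refine ⟨?_, ?_, ?_⟩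
    · obtain ⟨e, he, hew⟩ := hp.exists_tgt_eq (by
        rintro rfl
        obtain rfl : x = w := hp
        omega)
      exact hb₂u e hew ▸ he
    · intro h
      have := hr.le_of_conn (hp.conn_tgt (huniv _) h)
      rw [hg₂] at this
      omega
    · rcases hf.trace w ⟨_, huw', huniv _⟩ (Ne.symm huw) p hp fun e he => (hpF e he).1 with
        ⟨h1, -, h2⟩ | ⟨h1, -, e, he, h2⟩
      · exact Or.inr ⟨fun h => h2 _ h hb₁, h1⟩
      · exact Or.inl ⟨hb₁u e h2 ▸ he, h1⟩
  · refine ⟨b₁ :: W ++ W' ++ B₂, huw'.append hB₂, hand _ (hF₁ (huw'.append hB₂)) fun e he => ?_,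
      by simp [hb₂W]⟩
    rcases List.mem_append.1 he with he | he
    · exact hF₂ huw' e he
    · exact hB₂F e he
  -- The walk `P'` visits the cut `m`, and by rank it does so before `g₂`. Going from `u` to `m` and
  -- on along `P'` avoids `w`.
  · subst hP'eq
    have hw₂ := isWalk_append_cons.1 hP'
    have hmS : m ∈ G.support G.source p₁' ++ G.support (G.tgt g₂) p₂' := by
      have := hm _ hP' (huniv _)
      simpa [support] using this
    rcases List.mem_append.1 hmS with h | h
    · obtain ⟨p₃, p₄, rfl, -, hp₄⟩ := hw₂.1.split h
      have hwalk : G.IsWalk u (b₁ :: W ++ (p₄ ++ [g₂])) y :=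
        hW.append (hp₄.append ⟨rfl, hg₂⟩)
      refine ⟨_, hwalk, hand _ (hF₁ hwalk) fun e he => ?_, by simp⟩
      rcases List.mem_append.1 he with he | he
      · exact hF₂ huw' e (List.mem_append_left _ he)
      · rcases List.mem_append.1 he with he | he
        · exact hp₁'F e (List.mem_append_right _ he)
        · rw [List.mem_singleton] at he
          exact he ▸ hg₂F
    · have := hr.le_of_conn (hw₂.2.conn_of_mem (huniv _) h).1
      rw [hg₂] at this
      omega
  · refine ⟨B₁ ++ (b₁ :: W ++ W'), hB₁.append huw', hand _ (fun e he => ?_)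
      (hF₂ (hB₁.append huw')), by simp⟩
    rcases List.mem_append.1 he with he | he
    · exact hB₁F e he
    · exact hF₁ huw' e he
  · obtain ⟨p₁, p₂, rfl, hgF⟩ := hf.main
    have hw₂ := isWalk_append_cons.1 hP
    have hmS : m ∈ G.support G.source p₁ ++ G.support (G.tgt g₁) p₂ := by
      have := hm _ hP (huniv _)
      simpa [support] using this
    rcases List.mem_append.1 hmS with h | h
    · have := hr.le_of_conn (hw₂.1.conn_of_mem (huniv _) h).2
      rw [hf.src_g] at this
      omega
    · obtain ⟨p₃, p₄, rfl, hp₃, -⟩ := hw₂.2.split h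
      have hwalk : G.IsWalk x (g₁ :: p₃ ++ W') w := IsWalk.append (b := m) ⟨hf.src_g, hp₃⟩ hW'
      refine ⟨_, hwalk, hand _ (fun e he => ?_) (hF₂ hwalk), by simp⟩
      rcases List.mem_append.1 he with he | he
      · refine hgF e ?_
        rcases List.mem_cons.1 he with rfl | he
        · simp
        · simp [he]
      · exact hF₁ huw' e (List.mem_append_right _ he)

end Network

/-! ### Subnetworks, and isomorphisms with compositions -/

namespace Network

variable {G : Network.{u, v}}

/-- The maps go from `H` to `G` because the nodes of a composition form a quotient, out of which
maps are easy to define. -/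
theorem nonempty_iso_of_bijective {G : Network.{u, v}} {H : Network.{u', v'}} (F : H.V → G.V)
    (K : H.E → G.E) (hF : F.Bijective) (hK : K.Bijective)
    (hsrc : ∀ e, F (H.src e) = G.src (K e)) (htgt : ∀ e, F (H.tgt e) = G.tgt (K e))
    (hsource : F H.source = G.source) (hsink : F H.sink = G.sink) : Nonempty (Iso G H) := by
  let φ := Equiv.ofBijective F hF
  let ψ := Equiv.ofBijective K hK
  have hψ : ∀ e, K (ψ.symm e) = e := fun e => ψ.apply_symm_apply e
  refine ⟨⟨φ.symm, ψ.symm, fun e => ?_, fun e => ?_, (Equiv.symm_apply_eq φ).2 hsource.symm,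
    (Equiv.symm_apply_eq φ).2 hsink.symm⟩⟩ <;> rw [eq_comm, Equiv.symm_apply_eq]
  · exact ((hsrc _).trans (by rw [hψ])).symm
  · exact ((htgt _).trans (by rw [hψ])).symm

/-- The subnetwork with nodes `N` and edges `M`. -/
def sub (G : Network.{u, v}) (N : Set G.V) (M : Set G.E)
    (h : ∀ e ∈ M, G.src e ∈ N ∧ G.tgt e ∈ N) {s t : G.V} (hs : s ∈ N) (ht : t ∈ N) :
    Network.{u, v} where
  V := N
  E := M
  src e := ⟨G.src e, (h e e.2).1⟩
  tgt e := ⟨G.tgt e, (h e e.2).2⟩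
  source := ⟨s, hs⟩
  sink := ⟨t, ht⟩

section Sub

variable {N N' : Set G.V} {M M' : Set G.E} {h : ∀ e ∈ M, G.src e ∈ N ∧ G.tgt e ∈ N}
  {h' : ∀ e ∈ M', G.src e ∈ N' ∧ G.tgt e ∈ N'} {s t : G.V} {hs : s ∈ N} {ht : t ∈ N}

instance [Finite G.V] : Finite (G.sub N M h hs ht).V := inferInstanceAs (Finite N)

instance [Finite G.E] : Finite (G.sub N M h hs ht).E := inferInstanceAs (Finite M)

theorem isWalk_sub {a b : N} {p : List M} :
    (G.sub N M h hs ht).IsWalk a p b ↔ G.IsWalk a.1 (p.map Subtype.val) b.1 := by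
  induction p generalizing a with
  | nil => exact Subtype.ext_iff
  | cons e p ih =>
    exact and_congr Subtype.ext_iff (ih (a := (G.sub N M h hs ht).tgt e))

theorem mem_support_sub {a x : N} {p : List M} :
    x ∈ (G.sub N M h hs ht).support a p ↔ x.1 ∈ G.support a.1 (p.map Subtype.val) := by
  constructor
  · intro hx
    rcases mem_support.1 hx with hx | ⟨e, he, hx⟩
    · exact mem_support.2 (Or.inl (congrArg _ hx))
    · exact mem_support.2 (Or.inr ⟨_, List.mem_map_of_mem he, congrArg Subtype.val hx⟩)
  · intro hx
    rcases mem_support.1 hx with hx | ⟨e, he, hx⟩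
    · exact mem_support.2 (Or.inl (Subtype.ext hx))
    · obtain ⟨d, hd, rfl⟩ := List.mem_map.1 he
      exact mem_support.2 (Or.inr ⟨d, hd, Subtype.ext hx⟩)

theorem exists_map_val_eq {p : List G.E} (hp : ∀ e ∈ p, e ∈ M) :
    ∃ q : List M, q.map Subtype.val = p :=
  ⟨p.attach.map fun e => ⟨e.1, hp e.1 e.2⟩, by simp⟩

theorem conn_sub {a b : N} (hc : ∃ p, G.IsWalk a.1 p b.1 ∧ ∀ e ∈ p, e ∈ M) :
    (G.sub N M h hs ht).Conn Set.univ a b := by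
  obtain ⟨p, hp, hpM⟩ := hc
  obtain ⟨q, rfl⟩ := exists_map_val_eq hpM
  exact ⟨q, isWalk_sub.2 hp, fun _ _ => Set.mem_univ _⟩

theorem Conn.of_sub {a b : N} (hc : (G.sub N M h hs ht).Conn Set.univ a b) :
    G.Conn Set.univ a.1 b.1 := by
  obtain ⟨p, hp, -⟩ := hc
  exact ⟨_, isWalk_sub.1 hp, fun _ _ => Set.mem_univ _⟩

theorem IsRanking.sub {r : G.V → ℕ} (hr : G.IsRanking Set.univ r) :
    (G.sub N M h hs ht).IsRanking Set.univ fun x => r x.1 :=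
  fun e _ => hr e.1 (Set.mem_univ _)

theorem sumElim_bijective {α β γ : Type*} {A B : Set γ} (hAB : ∀ x, x ∈ A → x ∉ B)
    (hcov : ∀ x, x ∈ A ∨ x ∈ B) (φ : A ≃ α) (ψ : B ≃ β) :
    Function.Bijective (Sum.elim (fun x => (φ.symm x).1) fun x => (ψ.symm x).1) := by
  constructor
  · refine Function.Injective.sumElim (Subtype.val_injective.comp φ.symm.injective)
      (Subtype.val_injective.comp ψ.symm.injective) fun a b hab => ?_
    exact hAB _ (φ.symm a).2 (hab ▸ (ψ.symm b).2)
  · intro x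
    rcases hcov x with hx | hx
    · exact ⟨Sum.inl (φ ⟨x, hx⟩), by simp⟩
    · exact ⟨Sum.inr (ψ ⟨x, hx⟩), by simp⟩

theorem Iso.src_symm {G : Network.{u, v}} {H : Network.{u', v'}} (φ : Iso G H) (e : H.E) :
    φ.node.symm (H.src e) = G.src (φ.edge.symm e) := by
  rw [Equiv.symm_apply_eq, ← φ.map_src, Equiv.apply_symm_apply]

theorem Iso.tgt_symm {G : Network.{u, v}} {H : Network.{u', v'}} (φ : Iso G H) (e : H.E) :
    φ.node.symm (H.tgt e) = G.tgt (φ.edge.symm e) := by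
  rw [Equiv.symm_apply_eq, ← φ.map_tgt, Equiv.apply_symm_apply]

theorem Iso.source_symm {G : Network.{u, v}} {H : Network.{u', v'}} (φ : Iso G H) :
    φ.node.symm H.source = G.source := by
  rw [Equiv.symm_apply_eq, φ.map_source]

theorem Iso.sink_symm {G : Network.{u, v}} {H : Network.{u', v'}} (φ : Iso G H) :
    φ.node.symm H.sink = G.sink := by
  rw [Equiv.symm_apply_eq, φ.map_sink]

theorem nonempty_iso_series {x : G.V} {hs : G.source ∈ N} {hx : x ∈ N} {hx' : x ∈ N'}
    {ht : G.sink ∈ N'} (hN : ∀ y, y ∈ N → y ∈ N' → y = x) (hNc : ∀ y, y ∈ N ∨ y ∈ N')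
    (hM : ∀ e, e ∈ M → e ∉ M') (hMc : ∀ e, e ∈ M ∨ e ∈ M') {B B' : Network.{u', v'}}
    (φ : Iso (G.sub N M h hs hx) B) (φ' : Iso (G.sub N' M' h' hx' ht) B') :
    Nonempty (Iso G (B.series B')) := by
  have h1 : (φ.node.symm B.sink).1 = x := congrArg Subtype.val φ.sink_symm
  have h2 : (φ'.node.symm B'.source).1 = x := congrArg Subtype.val φ'.source_symm
  refine nonempty_iso_of_bijective
    (Quot.lift (Sum.elim (fun y => (φ.node.symm y).1) fun y => (φ'.node.symm y).1) ?_)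
    (Sum.elim (fun e => (φ.edge.symm e).1) fun e => (φ'.edge.symm e).1) ⟨?_, ?_⟩
    (sumElim_bijective hM hMc φ.edge φ'.edge) ?_ ?_ ?_ ?_
  · rintro _ _ ⟨rfl, rfl⟩
    exact h1.trans h2.symm
  · rintro ⟨a | a⟩ ⟨b | b⟩ hab
    · rw [φ.node.symm.injective (Subtype.ext hab)]
    · have hab' : (φ.node.symm a).1 = (φ'.node.symm b).1 := hab
      have h3 := hN _ (φ.node.symm a).2 (hab' ▸ (φ'.node.symm b).2)
      have ha := φ.node.symm.injective (Subtype.ext (h3.trans h1.symm))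
      have hb := φ'.node.symm.injective (Subtype.ext ((hab'.symm.trans h3).trans h2.symm))
      subst ha hb
      exact Quot.sound ⟨rfl, rfl⟩
    · have hab' : (φ.node.symm b).1 = (φ'.node.symm a).1 := Eq.symm hab
      have h3 := hN _ (φ.node.symm b).2 (hab' ▸ (φ'.node.symm a).2)
      have ha := φ.node.symm.injective (Subtype.ext (h3.trans h1.symm))
      have hb := φ'.node.symm.injective (Subtype.ext ((hab'.symm.trans h3).trans h2.symm))
      subst ha hb
      exact (Quot.sound ⟨rfl, rfl⟩).symm
    · rw [φ'.node.symm.injective (Subtype.ext hab)]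
  · intro y
    rcases hNc y with hy | hy
    · exact ⟨Quot.mk _ (Sum.inl (φ.node ⟨y, hy⟩)),
        congrArg Subtype.val (φ.node.symm_apply_apply ⟨y, hy⟩)⟩
    · exact ⟨Quot.mk _ (Sum.inr (φ'.node ⟨y, hy⟩)),
        congrArg Subtype.val (φ'.node.symm_apply_apply ⟨y, hy⟩)⟩
  · rintro (e | e)
    · exact congrArg Subtype.val (φ.src_symm e)
    · exact congrArg Subtype.val (φ'.src_symm e)
  · rintro (e | e)
    · exact congrArg Subtype.val (φ.tgt_symm e)
    · exact congrArg Subtype.val (φ'.tgt_symm e)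
  · exact congrArg Subtype.val φ.source_symm
  · exact congrArg Subtype.val φ'.sink_symm

theorem nonempty_iso_parallel {hs : G.source ∈ N} {ht : G.sink ∈ N} {hs' : G.source ∈ N'}
    {ht' : G.sink ∈ N'} (hN : ∀ y, y ∈ N → y ∈ N' → y = G.source ∨ y = G.sink)
    (hNc : ∀ y, y ∈ N ∨ y ∈ N') (hM : ∀ e, e ∈ M → e ∉ M') (hMc : ∀ e, e ∈ M ∨ e ∈ M')
    {B B' : Network.{u', v'}} (φ : Iso (G.sub N M h hs ht) B)
    (φ' : Iso (G.sub N' M' h' hs' ht') B') : Nonempty (Iso G (B.parallel B')) := by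
  have h1 : (φ.node.symm B.sink).1 = G.sink := congrArg Subtype.val φ.sink_symm
  have h2 : (φ'.node.symm B'.sink).1 = G.sink := congrArg Subtype.val φ'.sink_symm
  have h3 : (φ.node.symm B.source).1 = G.source := congrArg Subtype.val φ.source_symm
  have h4 : (φ'.node.symm B'.source).1 = G.source := congrArg Subtype.val φ'.source_symm
  have key : ∀ a b, (φ.node.symm a).1 = (φ'.node.symm b).1 →
      (a = B.source ∧ b = B'.source) ∨ (a = B.sink ∧ b = B'.sink) := by
    intro a b hab
    rcases hN _ (φ.node.symm a).2 (hab ▸ (φ'.node.symm b).2) with h | h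
    · exact Or.inl ⟨φ.node.symm.injective (Subtype.ext (h.trans h3.symm)),
        φ'.node.symm.injective (Subtype.ext ((hab.symm.trans h).trans h4.symm))⟩
    · exact Or.inr ⟨φ.node.symm.injective (Subtype.ext (h.trans h1.symm)),
        φ'.node.symm.injective (Subtype.ext ((hab.symm.trans h).trans h2.symm))⟩
  refine nonempty_iso_of_bijective
    (Quot.lift (Sum.elim (fun y => (φ.node.symm y).1) fun y => (φ'.node.symm y).1) ?_)
    (Sum.elim (fun e => (φ.edge.symm e).1) fun e => (φ'.edge.symm e).1) ⟨?_, ?_⟩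
    (sumElim_bijective hM hMc φ.edge φ'.edge) ?_ ?_ ?_ ?_
  · rintro _ _ (⟨rfl, rfl⟩ | ⟨rfl, rfl⟩)
    · exact h3.trans h4.symm
    · exact h1.trans h2.symm
  · rintro ⟨a | a⟩ ⟨b | b⟩ hab
    · rw [φ.node.symm.injective (Subtype.ext hab)]
    · refine Quot.sound ?_
      rcases key a b hab with ⟨rfl, rfl⟩ | ⟨rfl, rfl⟩
      · exact Or.inl ⟨rfl, rfl⟩
      · exact Or.inr ⟨rfl, rfl⟩
    · refine (Quot.sound ?_).symm
      rcases key b a hab.symm with ⟨rfl, rfl⟩ | ⟨rfl, rfl⟩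
      · exact Or.inl ⟨rfl, rfl⟩
      · exact Or.inr ⟨rfl, rfl⟩
    · rw [φ'.node.symm.injective (Subtype.ext hab)]
  · intro y
    rcases hNc y with hy | hy
    · exact ⟨Quot.mk _ (Sum.inl (φ.node ⟨y, hy⟩)),
        congrArg Subtype.val (φ.node.symm_apply_apply ⟨y, hy⟩)⟩
    · exact ⟨Quot.mk _ (Sum.inr (φ'.node ⟨y, hy⟩)),
        congrArg Subtype.val (φ'.node.symm_apply_apply ⟨y, hy⟩)⟩
  · rintro (e | e)
    · exact congrArg Subtype.val (φ.src_symm e)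
    · exact congrArg Subtype.val (φ'.src_symm e)
  · rintro (e | e)
    · exact congrArg Subtype.val (φ.tgt_symm e)
    · exact congrArg Subtype.val (φ'.tgt_symm e)
  · exact congrArg Subtype.val φ.source_symm
  · exact congrArg Subtype.val φ.sink_symm

end Sub

theorem nonempty_iso_simplePath {p : List G.E} (hp : G.IsPath G.source p G.sink) {m : ℕ}
    (hm : p.length = m + 1) (hV : ∀ x, x ∈ G.support G.source p) (hE : ∀ e, e ∈ p) :
    Nonempty (Iso G (simplePath m)) := by
  have hlen : (G.support G.source p).length = m + 2 := by simp [support, hm]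
  refine nonempty_iso_of_bijective
    (fun i : Fin (m + 2) => (G.support G.source p)[i.1]'(by omega))
    (fun i : Fin (m + 1) => p[i.1]'(by omega)) ⟨fun i j hij => ?_, fun x => ?_⟩
    ⟨fun i j hij => ?_, fun e => ?_⟩ (fun e => ?_) (fun e => ?_) rfl ?_
  · exact Fin.ext ((hp.2.getElem_inj_iff).1 hij)
  · obtain ⟨i, hi, rfl⟩ := List.getElem_of_mem (hV x)
    exact ⟨⟨i, by omega⟩, rfl⟩
  · exact Fin.ext ((hp.edges_nodup.getElem_inj_iff).1 hij)
  · obtain ⟨i, hi, rfl⟩ := List.getElem_of_mem (hE e)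
    exact ⟨⟨i, by omega⟩, rfl⟩
  · exact (hp.1.src_getElem _ _).symm
  · exact (tgt_getElem _ _).symm
  · have : ∀ (p : List G.E) (a b : G.V), G.IsWalk a p b →
        (G.support a p)[p.length]? = some b := by
      intro p
      induction p with
      | nil =>
        rintro a b rfl
        rfl
      | cons e p ih => exact fun a b h => by simpa using ih _ _ h.2
    have h1 := this p _ _ hp.1
    rw [List.getElem?_eq_some_iff] at h1
    obtain ⟨h2, h3⟩ := h1
    have h4 : (Fin.last (m + 1)).1 = p.length := by simp [hm]
    show (G.support G.source p)[(Fin.last (m + 1)).1] = _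
    simp only [h4, h3]

end Network

/-! ### Decomposition into blocks -/

namespace Network

variable {G : Network.{u, v}}

theorem IsWalk.exists_src_eq {a b x : G.V} {p : List G.E} (hp : G.IsWalk a p b)
    (hx : x ∈ G.support a p) (hxb : x ≠ b) : ∃ c ∈ p, G.src c = x := by
  obtain ⟨p₁, p₂, rfl, -, h⟩ := hp.split hx
  cases p₂ with
  | nil => exact absurd h hxb
  | cons c p₂ => exact ⟨c, by simp, h.1⟩

/-- A network without directed cycles in which every node can be reached from the source and can
reach the sink. -/
structure IsAcyclic (G : Network.{u, v}) : Prop where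
  ranking : ∃ r, G.IsRanking Set.univ r
  conn : ∀ x, G.Conn Set.univ G.source x ∧ G.Conn Set.univ x G.sink
  ne : G.source ≠ G.sink

theorem IsAcyclic.tgt_ne_source (hG : G.IsAcyclic) (e : G.E) : G.tgt e ≠ G.source := by
  intro h
  obtain ⟨r, hr⟩ := hG.ranking
  have h1 := hr.le_of_conn (hG.conn (G.src e)).1
  have h2 := hr e trivial
  rw [h] at h2
  omega

theorem IsAcyclic.src_ne_sink (hG : G.IsAcyclic) (e : G.E) : G.src e ≠ G.sink := by
  intro h
  obtain ⟨r, hr⟩ := hG.ranking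
  have h1 := hr.le_of_conn (hG.conn (G.tgt e)).2
  have h2 := hr e trivial
  rw [h] at h2
  omega

/-- All edges at the inner nodes of `p` belong to `p`, so a walk does not leave or enter `p` in
between. -/
theorem forall_mem_or_forall_notMem (hG : G.IsAcyclic)
    (hout : ∀ d e, G.src d = G.src e → G.src e ≠ G.source → d = e)
    (hin : ∀ d e, G.tgt d = G.tgt e → G.tgt e ≠ G.sink → d = e) {p : List G.E}
    (hp : G.IsWalk G.source p G.sink) {q : List G.E} {a b : G.V} (hq : G.IsWalk a q b) :
    (∀ e ∈ q, e ∈ p) ∨ ∀ e ∈ q, e ∉ p := by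
  induction q generalizing a with
  | nil => simp
  | cons e q ih =>
    cases q with
    | nil => simpa using em _
    | cons d q =>
      have hde : G.src d = G.tgt e := hq.2.1
      have h1 := hG.src_ne_sink d
      have h2 := hG.tgt_ne_source e
      have hiff : e ∈ p ↔ d ∈ p := by
        constructor <;> intro h
        · obtain ⟨c, hc, hcx⟩ := hp.exists_src_eq (tgt_mem_support h) (hde ▸ h1)
          rwa [hout d c (hde.trans hcx.symm) (hcx ▸ h2)]
        · rcases mem_support.1 (hp.src_mem_support h) with h3 | ⟨c, hc, h3⟩
          · exact absurd (hde.symm.trans h3) h2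
          · rwa [hin e c (hde.symm.trans h3.symm) (h3 ▸ h1)]
      rcases ih hq.2 with h | h
      · left
        simp only [List.forall_mem_cons] at h ⊢
        exact ⟨hiff.2 h.1, h⟩
      · right
        simp only [List.forall_mem_cons] at h ⊢
        exact ⟨fun h' => h.1 (hiff.1 h'), h⟩

/-- Inner nodes have at most one edge in and one out, so no walk changes between a source-sink path
`p` and the rest. Split off `p` and use induction on the number of edges. The middle conclusion
records that without inner nodes all the paths are single edges. -/
theorem exists_isParallelPaths (n : ℕ) : ∀ (G : Network.{u, v}) [Finite G.E], Nat.card G.E ≤ n →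
    G.IsAcyclic → (∀ d e, G.src d = G.src e → G.src e ≠ G.source → d = e) →
    (∀ d e, G.tgt d = G.tgt e → G.tgt e ≠ G.sink → d = e) →
    ∃ B : Network.{0, 0}, B.IsParallelPaths ∧
      ((∀ x, x = G.source ∨ x = G.sink) → B.IsParallelEdges) ∧ Nonempty (Iso G B) := by
  induction n with
  | zero =>
    intro G _ hn hG _ _
    obtain ⟨p, hp, -⟩ := (hG.conn G.source).2
    cases p with
    | nil => exact absurd hp hG.ne
    | cons e p =>
      have : Nonempty G.E := ⟨e⟩
      have := Nat.card_pos (α := G.E)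
      omega
  | succ n ih =>
    intro G _ hn hG hout hin
    obtain ⟨r, hr⟩ := hG.ranking
    obtain ⟨p, hp, -⟩ := (hG.conn G.source).2
    have hpath := hr.isPath hp fun _ _ => trivial
    have hpne : p ≠ [] := by
      rintro rfl
      exact hG.ne hp
    obtain ⟨m, hm⟩ : ∃ m, p.length = m + 1 := ⟨p.length - 1, by
      have := List.length_pos_iff.2 hpne
      omega⟩
    have hedge : (∀ x, x = G.source ∨ x = G.sink) → (simplePath m).IsParallelEdges := by
      intro hall
      have hm0 : m = 0 := by
        cases p with
        | nil => simp at hm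
        | cons e p =>
          have h1 := (hall (G.tgt e)).resolve_left (hG.tgt_ne_source e)
          cases p with
          | nil => simpa using hm.symm
          | cons d p => exact absurd (hp.2.1.trans h1) (hG.src_ne_sink d)
      subst hm0
      exact .edge
    by_cases hall : ∀ e, e ∈ p
    · refine ⟨simplePath m, .path m, hedge, nonempty_iso_simplePath hpath hm (fun x => ?_) hall⟩
      obtain ⟨q, hq, -⟩ := (hG.conn x).1
      by_cases hqe : q = []
      · subst hqe
        exact mem_support.2 (Or.inl hq.symm)
      · obtain ⟨d, -, hd⟩ := hq.exists_tgt_eq hqe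
        exact hd ▸ tgt_mem_support (hall d)
    · push Not at hall
      obtain ⟨e₀, he₀⟩ := hall
      have hfa := fun {q : List G.E} {a b : G.V} (hq : G.IsWalk a q b) =>
        forall_mem_or_forall_notMem hG hout hin hp hq
      let N : Set G.V := {x | x ∈ G.support G.source p}
      let M : Set G.E := {e | e ∈ p}
      -- Only the inner nodes of `p` are removed; the two terminals belong to both parts.
      let N' : Set G.V := {x | x ∈ G.support G.source p → x = G.source ∨ x = G.sink}
      let M' : Set G.E := {e | e ∉ p}
      have h : ∀ e ∈ M, G.src e ∈ N ∧ G.tgt e ∈ N := fun e he =>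
        ⟨hp.src_mem_support he, tgt_mem_support he⟩
      have h' : ∀ e ∈ M', G.src e ∈ N' ∧ G.tgt e ∈ N' := by
        refine fun e he => ⟨fun hx => ?_, fun hx => ?_⟩ <;> by_contra hne <;> push Not at hne
        · obtain ⟨c, hc, hce⟩ := hp.exists_src_eq hx hne.2
          exact he (hout e c hce.symm (hce ▸ hne.1) ▸ hc)
        · obtain ⟨c, hc, hce⟩ := (mem_support.1 hx).resolve_left hne.1
          exact he (hin e c hce.symm (hce ▸ hne.2) ▸ hc)
      have hs : G.source ∈ N := mem_support.2 (Or.inl rfl)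
      have ht : G.sink ∈ N := hp.end_mem_support
      have hs' : G.source ∈ N' := fun _ => Or.inl rfl
      have ht' : G.sink ∈ N' := fun _ => Or.inr rfl
      -- the rest of the network
      have hst : ∃ q, G.IsWalk G.source q G.sink ∧ ∀ e ∈ q, e ∈ M' := by
        obtain ⟨q₁, hq₁, -⟩ := (hG.conn (G.src e₀)).1
        obtain ⟨q₂, hq₂, -⟩ := (hG.conn (G.tgt e₀)).2
        have hq := isWalk_append_cons.2 ⟨hq₁, hq₂⟩
        refine ⟨_, hq, (hfa hq).resolve_left fun hc => he₀ (hc e₀ (by simp))⟩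
      have hG' : (G.sub N' M' h' hs' ht').IsAcyclic := by
        refine ⟨⟨_, hr.sub⟩, fun x => ⟨conn_sub ?_, conn_sub ?_⟩, fun hne =>
          hG.ne (congrArg Subtype.val hne)⟩
        · obtain ⟨q, hq, -⟩ := (hG.conn x.1).1
          by_cases hqe : q = []
          · exact ⟨q, hq, by simp [hqe]⟩
          -- The given walk to the sink may run along `p`, so here a source-sink walk off `p` is
          -- needed; any other node of the rest is reached off `p` anyway.
          · by_cases hxt : x.1 = G.sink
            · rw [hxt]
              exact hst
            · refine ⟨q, hq, (hfa hq).resolve_left fun hc => ?_⟩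
              obtain ⟨d, hd, hdx⟩ := hq.exists_tgt_eq hqe
              rcases x.2 (hdx ▸ tgt_mem_support (hc d hd)) with h1 | h1
              · exact hG.tgt_ne_source d (hdx.trans h1)
              · exact hxt h1
        · obtain ⟨q, hq, -⟩ := (hG.conn x.1).2
          cases q with
          | nil => exact ⟨[], hq, by simp⟩
          | cons d q =>
            by_cases hxs : x.1 = G.source
            · rw [hxs]
              exact hst
            · refine ⟨d :: q, hq, (hfa hq).resolve_left fun hc => ?_⟩
              rcases x.2 (hq.1 ▸ hp.src_mem_support (hc d (by simp))) with h1 | h1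
              · exact hxs h1
              · exact hG.src_ne_sink d (hq.1.trans h1)
      have hcard : Nat.card (G.sub N' M' h' hs' ht').E ≤ n := by
        obtain ⟨d, hd⟩ := List.exists_mem_of_ne_nil p hpne
        have h1 : Nat.card M' < Nat.card G.E := Finite.card_subtype_lt (x := d) fun h => h hd
        exact Nat.le_of_lt_succ (lt_of_lt_of_le h1 hn)
      obtain ⟨B', hB', hB'e, ⟨φ'⟩⟩ := ih (G.sub N' M' h' hs' ht') hcard hG'
        (fun d e hde hne => Subtype.ext (hout _ _ (congrArg Subtype.val hde) fun hc =>
          hne (Subtype.ext hc)))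
        (fun d e hde hne => Subtype.ext (hin _ _ (congrArg Subtype.val hde) fun hc =>
          hne (Subtype.ext hc)))
      obtain ⟨φ⟩ : Nonempty (Iso (G.sub N M h hs ht) (simplePath m)) := by
        obtain ⟨q, hqp⟩ := exists_map_val_eq (M := M) (p := p) fun _ h => h
        have hq : (G.sub N M h hs ht).IsWalk ⟨_, hs⟩ q ⟨_, ht⟩ :=
          isWalk_sub.2 (hqp.symm ▸ hp)
        refine nonempty_iso_simplePath (hr.sub.isPath hq fun _ _ => trivial)
          ((List.length_map _).symm.trans ((congrArg List.length hqp).trans hm))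
          (fun x => mem_support_sub.2 (hqp.symm ▸ x.2)) fun e => ?_
        have hep : e.1 ∈ q.map Subtype.val := hqp.symm ▸ (show e.1 ∈ p from e.2)
        obtain ⟨d, hd, hde⟩ := List.mem_map.1 hep
        obtain rfl : d = e := Subtype.ext hde
        exact hd
      refine ⟨(simplePath m).parallel B', .parallel (.path m) hB', fun hx =>
        .parallel (hedge hx) (hB'e fun x => ?_), nonempty_iso_parallel (N := N) (N' := N') (M := M)
          (M' := M') (fun y hy hy' => hy' hy) (fun y => ?_) (fun e he he' => he' he) (fun e => em _) φ φ'⟩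
      · exact (hx x.1).imp (fun h => Subtype.ext h) fun h => Subtype.ext h
      · by_cases hy : y ∈ N
        · exact Or.inl hy
        · exact Or.inr fun hy' => absurd hy' hy

/-- The local structure of the networks that admit a strong equilibrium. -/
structure IsThin (G : Network.{u, v}) : Prop extends G.IsAcyclic where
  out_eq : ∀ d e, G.src d = G.src e → ¬ G.IsCut Set.univ (G.src e) → d = e
  in_eq : ∀ d e, G.tgt d = G.tgt e → ¬ G.IsCut Set.univ (G.tgt e) → d = e
  between : ∀ u m w, ¬ G.IsCut Set.univ u → G.IsCut Set.univ m → ¬ G.IsCut Set.univ w →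
    G.Conn Set.univ u m → G.Conn Set.univ m w → False

theorem IsParallelEdges.isParallelPaths {B : Network.{0, 0}} (h : B.IsParallelEdges) :
    B.IsParallelPaths := by
  induction h with
  | edge => exact .path 0
  | parallel _ _ h1 h2 => exact .parallel h1 h2

/-- Split at the first inner cut `v`. The part before `v` has no inner cut and consists of parallel
paths; the part after `v` is thin again. The third conclusion is there for the induction: it makes
all later blocks parallel edges once a block with inner nodes has been met. -/
theorem IsThin.exists_seriesAll (n : ℕ) : ∀ (G : Network.{u, v}) [Finite G.V] [Finite G.E],
    Nat.card G.V ≤ n → G.IsThin →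
    ∃ (k : ℕ) (B : Fin (k + 1) → Network.{0, 0}) (l : Fin (k + 1)),
      (B l).IsParallelPaths ∧ (∀ i, i ≠ l → (B i).IsParallelEdges) ∧
        ((∀ x, G.IsCut Set.univ x) → ∀ i, (B i).IsParallelEdges) ∧
          Nonempty (Iso G (seriesAll B)) := by
  induction n with
  | zero =>
    intro G _ _ hn
    have : Nonempty G.V := ⟨G.source⟩
    have := Nat.card_pos (α := G.V)
    omega
  | succ n ih =>
    intro G _ _ hn hG
    have hA := hG.toIsAcyclic
    obtain ⟨r, hr⟩ := hA.ranking
    by_cases hcut : ∃ x, G.IsCut Set.univ x ∧ x ≠ G.source ∧ x ≠ G.sink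
    swap
    · push Not at hcut
      obtain ⟨B, hB, hBe, hiso⟩ := exists_isParallelPaths _ G le_rfl hA
        (fun d e hde hne => hG.out_eq d e hde fun hc => hA.src_ne_sink e (hcut _ hc hne))
        (fun d e hde hne => hG.in_eq d e hde fun hc => hne (hcut _ hc (hA.tgt_ne_source e)))
      refine ⟨0, fun _ => B, 0, hB, fun i hi => absurd (Fin.ext (by omega)) hi,
        fun hc _ => hBe fun x => ?_, hiso⟩
      by_cases hx : x = G.source
      · exact Or.inl hx
      · exact Or.inr (hcut x (hc x) hx)
    -- Minimality of the rank ensures that no node strictly between the source and `v` is a cut.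
    obtain ⟨v, ⟨hvcut, hvs, hvt⟩, hvmin⟩ := exists_minimalFor_of_wellFoundedLT
      (fun x => G.IsCut Set.univ x ∧ x ≠ G.source ∧ x ≠ G.sink) r hcut
    have hanti : ∀ {x y}, G.Conn Set.univ x y → G.Conn Set.univ y x → x = y := by
      intro x y h1 h2
      by_contra hne
      have := hr.lt_of_conn h1 hne
      have := hr.le_of_conn h2
      omega
    let N : Set G.V := {x | G.Conn Set.univ x v}
    let M : Set G.E := {e | G.Conn Set.univ (G.tgt e) v}
    let N' : Set G.V := {x | G.Conn Set.univ v x}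
    let M' : Set G.E := {e | G.Conn Set.univ v (G.src e)}
    have hedge : ∀ e, G.Conn Set.univ (G.src e) (G.tgt e) := fun e => conn_edge trivial
    have h : ∀ e ∈ M, G.src e ∈ N ∧ G.tgt e ∈ N := fun e he => ⟨(hedge e).trans he, he⟩
    have h' : ∀ e ∈ M', G.src e ∈ N' ∧ G.tgt e ∈ N' := fun e he => ⟨he, Conn.trans he (hedge e)⟩
    have hs : G.source ∈ N := (hA.conn v).1
    have hv : v ∈ N := Conn.refl v
    have hv' : v ∈ N' := Conn.refl v
    have ht : G.sink ∈ N' := (hA.conn v).2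
    have hNc : ∀ y, y ∈ N ∨ y ∈ N' := by
      intro y
      obtain ⟨p, hp, -⟩ := (hA.conn y).1
      obtain ⟨q, hq, -⟩ := (hA.conn y).2
      have hmem := hvcut _ (hp.append hq) fun _ _ => trivial
      rcases mem_support.1 hmem with h1 | ⟨e, he, h1⟩
      · exact absurd h1 hvs
      · rcases List.mem_append.1 he with he | he
        · exact Or.inr (show G.Conn _ v y from h1 ▸ hp.conn_tgt (fun _ _ => trivial) he)
        · exact Or.inl (show G.Conn _ y v from
            h1 ▸ (hq.conn_src (fun _ _ => trivial) he).trans (hedge e))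
    have hMc : ∀ e, e ∈ M ∨ e ∈ M' := by
      intro e
      rcases hNc (G.tgt e) with h1 | h1
      · exact Or.inl h1
      · rcases hNc (G.src e) with h2 | h2
        · obtain ⟨p, hp, -⟩ := (hA.conn (G.src e)).1
          obtain ⟨q, hq, -⟩ := (hA.conn (G.tgt e)).2
          have hmem := hvcut _ (isWalk_append_cons.2 ⟨hp, hq⟩) fun _ _ => trivial
          have : v ∈ G.support G.source p ++ G.support (G.tgt e) q := by
            simpa [support] using hmem
          rcases List.mem_append.1 this with h3 | h3
          · exact Or.inr (hp.conn_of_mem (fun _ _ => trivial) h3).2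
          · exact Or.inl (hq.conn_of_mem (fun _ _ => trivial) h3).1
        · exact Or.inr h2
    have hM : ∀ e, e ∈ M → e ∉ M' := by
      intro e he he'
      have h1 := hr.le_of_conn he
      have h2 := hr.le_of_conn he'
      have h3 := hr e trivial
      omega
    have hNN : ∀ y, y ∈ N → y ∈ N' → y = v := fun y h1 h2 => hanti h1 h2
    have hnoncut : ∀ x ∈ N, x ≠ G.source → x ≠ v → ¬ G.IsCut Set.univ x := by
      intro x hx hxs hxv hxc
      have h1 := hr.lt_of_conn hx hxv
      have hxt : x ≠ G.sink := by
        rintro rfl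
        have := hr.le_of_conn ht
        omega
      have := hvmin ⟨hxc, hxs, hxt⟩ (le_of_lt h1)
      omega
    -- the first part
    have hA₁ : (G.sub N M h hs hv).IsAcyclic := by
      refine ⟨⟨_, hr.sub⟩, fun x => ⟨conn_sub ?_, conn_sub ?_⟩, fun hne =>
        hvs (congrArg Subtype.val hne).symm⟩
      · obtain ⟨p, hp, -⟩ := (hA.conn x.1).1
        exact ⟨p, hp, fun e he => (hp.conn_tgt (fun _ _ => trivial) he).trans x.2⟩
      · obtain ⟨p, hp, -⟩ := x.2
        exact ⟨p, hp, fun e he => hp.conn_tgt (fun _ _ => trivial) he⟩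
    obtain ⟨B₁, hB₁, hB₁e, ⟨φ₁⟩⟩ := exists_isParallelPaths _ (G.sub N M h hs hv) le_rfl hA₁
      (fun d e hde hne => Subtype.ext (hG.out_eq _ _ (congrArg Subtype.val hde)
        (hnoncut _ (h e.1 e.2).1 (fun hc => hne (Subtype.ext hc))
          fun hc => hA₁.src_ne_sink e (Subtype.ext hc))))
      (fun d e hde hne => Subtype.ext (hG.in_eq _ _ (congrArg Subtype.val hde)
        (hnoncut _ (h e.1 e.2).2 (fun hc => hA₁.tgt_ne_source e (Subtype.ext hc))
          fun hc => hne (Subtype.ext hc))))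
    -- the second part
    have hlift : ∀ {p : List G.E} {a b : G.V}, G.IsWalk a p b → a ∈ N' → ∀ e ∈ p, e ∈ M' :=
      fun hp ha e he => Conn.trans ha (hp.conn_src (fun _ _ => trivial) he)
    have hcut₂ : ∀ x : N', (G.sub N' M' h' hv' ht).IsCut Set.univ x ↔ G.IsCut Set.univ x.1 := by
      intro x
      constructor
      · intro hx p hp _
        obtain ⟨p₁, p₂, rfl, hp₁, hp₂⟩ := hp.split (hvcut p hp fun _ _ => trivial)
        obtain ⟨q, rfl⟩ := exists_map_val_eq (hlift hp₂ hv')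
        have hq : (G.sub N' M' h' hv' ht).IsWalk ⟨v, hv'⟩ q ⟨_, ht⟩ := isWalk_sub.2 hp₂
        rcases mem_support.1 (mem_support_sub.1 (hx q hq fun _ _ => trivial)) with h1 | ⟨e, he, h1⟩
        · have h2 : x.1 = v := h1
          rw [h2]
          exact hvcut _ hp fun _ _ => trivial
        · exact mem_support.2 (Or.inr ⟨e, List.mem_append_right _ he, h1⟩)
      · intro hx q hq _
        obtain ⟨p, hp, -⟩ := (hA.conn v).1
        have hq' : G.IsWalk v (q.map Subtype.val) G.sink := isWalk_sub.1 hq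
        have hmem := hx _ (hp.append hq') fun _ _ => trivial
        refine mem_support_sub.2 (mem_support.2 ?_)
        have hstart : x.1 ∈ G.support G.source p → x.1 = v := fun h1 =>
          hanti (hp.conn_of_mem (fun _ _ => trivial) h1).2 x.2
        rcases mem_support.1 hmem with h1 | ⟨e, he, h1⟩
        · exact Or.inl (hstart (mem_support.2 (Or.inl h1)))
        · rcases List.mem_append.1 he with he | he
          · exact Or.inl (hstart (mem_support.2 (Or.inr ⟨e, he, h1⟩)))
          · exact Or.inr ⟨e, he, h1⟩
    have hG₂ : (G.sub N' M' h' hv' ht).IsThin := by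
      refine ⟨⟨⟨_, hr.sub⟩, fun x => ⟨conn_sub ?_, conn_sub ?_⟩, fun hne =>
        hvt (congrArg Subtype.val hne)⟩, fun d e hde hc => ?_, fun d e hde hc => ?_,
        fun u m w hu hm hw hum hmw => ?_⟩
      · obtain ⟨p, hp, -⟩ := x.2
        exact ⟨p, hp, hlift hp hv'⟩
      · obtain ⟨p, hp, -⟩ := (hA.conn x.1).2
        exact ⟨p, hp, hlift hp x.2⟩
      · exact Subtype.ext (hG.out_eq _ _ (congrArg Subtype.val hde) fun hx =>
          hc ((hcut₂ _).2 hx))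
      · exact Subtype.ext (hG.in_eq _ _ (congrArg Subtype.val hde) fun hx =>
          hc ((hcut₂ _).2 hx))
      · exact hG.between u.1 m.1 w.1 (fun hc => hu ((hcut₂ u).2 hc)) ((hcut₂ m).1 hm)
          (fun hc => hw ((hcut₂ w).2 hc)) hum.of_sub hmw.of_sub
    have hcard : Nat.card (G.sub N' M' h' hv' ht).V ≤ n := by
      have h1 : Nat.card N' < Nat.card G.V :=
        Finite.card_subtype_lt (x := G.source) fun h => hvs (hanti h (hA.conn v).1)
      exact Nat.le_of_lt_succ (lt_of_lt_of_le h1 hn)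
    obtain ⟨k, B, l, hBl, hBe, hBc, ⟨φ₂⟩⟩ := ih (G.sub N' M' h' hv' ht) hcard hG₂
    have hiso := nonempty_iso_series hNN hNc hM hMc φ₁ φ₂
    -- If the first block has no inner node, it consists of parallel edges and the exceptional block
    -- comes later. Otherwise an inner node `u` is not a cut, and since `v` lies below it, every
    -- node of the second part must be a cut.
    by_cases hin : ∀ x : (G.sub N M h hs hv).V, x = (G.sub N M h hs hv).source ∨
        x = (G.sub N M h hs hv).sink
    · refine ⟨k + 1, Fin.cons B₁ B, l.succ, by simpa using hBl, fun i hi => ?_, fun hc i => ?_,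
        hiso⟩
      · refine Fin.cases ?_ (fun i => ?_) i hi
        · exact fun _ => hB₁e hin
        · exact fun hi => hBe i fun hil => hi (by rw [hil])
      · refine Fin.cases ?_ (fun i => ?_) i
        · exact hB₁e hin
        · exact hBc (fun x => (hcut₂ x).2 (hc x.1)) i
    · push Not at hin
      obtain ⟨u, hus, huv⟩ := hin
      have hu := hnoncut u.1 u.2 (fun hc => hus (Subtype.ext hc)) fun hc => huv (Subtype.ext hc)
      have hall : ∀ x, (G.sub N' M' h' hv' ht).IsCut Set.univ x := fun x => (hcut₂ x).2 <| by
        by_contra hx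
        exact hG.between u.1 v x.1 hu hvcut hx u.2 x.2
      refine ⟨k + 1, Fin.cons B₁ B, 0, hB₁, fun i hi => ?_, fun hc => absurd (hc u.1) hu, hiso⟩
      refine Fin.cases ?_ (fun i => ?_) i hi
      · exact fun h0 => absurd rfl h0
      · exact fun _ => hBc hall i

end Network

/-! ### Necessity assembled, and invariance under isomorphism -/

namespace Network

theorem isThin_of_admitsSE {G : Network.{u, v}} [Finite G.V] [Finite G.E] (hG : G.IsTwoTerminal)
    (hSE : G.AdmitsSE) : G.IsThin := by
  have hno : ∀ F x y e₁ e₂ f g, ¬ G.HasTriple F x y e₁ e₂ f g :=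
    fun _ _ _ _ _ _ _ h => h.not_admitsSE hSE
  have hno' : ∀ F x₁ y₁ x₂ y₂ b₁ g₁ b₂ g₂, ¬ G.HasDilemma F x₁ y₁ x₂ y₂ b₁ g₁ b₂ g₂ :=
    fun _ _ _ _ _ _ _ _ _ h => h.not_admitsSE hSE
  obtain ⟨r, hr⟩ := exists_isRanking_univ hno hG
  have hconn : ∀ x, G.Conn Set.univ G.source x ∧ G.Conn Set.univ x G.sink := by
    intro x
    obtain ⟨p, hp, hx⟩ := hG.node_on_path x
    exact hp.1.conn_of_mem (fun _ _ => trivial) hx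
  have hsp : G.IsSpanned Set.univ := fun e _ => ⟨(hconn _).1, (hconn _).2⟩
  exact ⟨⟨⟨r, hr⟩, hconn, hG.source_ne_sink⟩,
    fun d e hde hc => eq_of_src_eq_of_not_isCut hno hr hsp trivial trivial hde hc,
    fun d e hde hc => eq_of_tgt_eq_of_not_isCut hno hr hsp trivial trivial hde hc,
    fun u m w hu hm hw hum hmw => false_of_isCut_between hno hno' hr hsp hconn hu hm hw hum hmw⟩

theorem Iso.isWalk_map {G : Network.{u, v}} {H : Network.{u', v'}} (φ : Iso G H) {a b : G.V}
    {p : List G.E} : H.IsWalk (φ.node a) (p.map φ.edge) (φ.node b) ↔ G.IsWalk a p b := by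
  induction p generalizing a with
  | nil => exact φ.node.injective.eq_iff
  | cons e p ih =>
    rw [List.map_cons, isWalk_cons, isWalk_cons, φ.map_src, φ.map_tgt, ih,
      φ.node.injective.eq_iff]

theorem Iso.isPath_map {G : Network.{u, v}} {H : Network.{u', v'}} (φ : Iso G H) {a b : G.V}
    {p : List G.E} : H.IsPath (φ.node a) (p.map φ.edge) (φ.node b) ↔ G.IsPath a p b := by
  have h : H.support (φ.node a) (p.map φ.edge) = (G.support a p).map φ.node := by
    simp [support, φ.map_tgt]
  rw [IsPath, IsPath, φ.isWalk_map, h, List.nodup_map_iff φ.node.injective]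

theorem AdmitsSE.of_iso {G : Network.{u, v}} {H : Network.{u', v'}} (φ : Iso G H)
    (hH : H.AdmitsSE) : G.AdmitsSE := by
  rintro Γ ⟨s₀, hs₀⟩
  let Γ' : CCSGame H := ⟨Γ.n, fun i => φ.node (Γ.source i), fun i => φ.node (Γ.sink i),
    fun e => Γ.cost (φ.edge.symm e), fun e => Γ.cap (φ.edge.symm e)⟩
  let τ : Γ.Profile → Γ'.Profile := fun s i => ⟨(s i).1.map φ.edge, φ.isPath_map.2 (s i).2⟩
  have hsurj : ∀ s', ∃ s, τ s = s' := by
    intro s'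
    have h : ∀ i, ((s' i).1.map φ.edge.symm).map φ.edge = (s' i).1 := fun i => by simp
    refine ⟨fun i => ⟨(s' i).1.map φ.edge.symm, φ.isPath_map.1 ?_⟩, ?_⟩
    · rw [h]
      exact (s' i).2
    · funext i
      exact Subtype.ext (h i)
  have hload : ∀ s e, Γ'.load (τ s) (φ.edge e) = Γ.load s e := by
    intro s e
    classical
    rw [CCSGame.load, CCSGame.load]
    congr 1
    ext i
    simp [τ]
  have hfeas : ∀ s, Γ'.IsFeasible (τ s) ↔ Γ.IsFeasible s := by
    intro s
    constructor
    · intro h e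
      simpa [hload, Γ'] using h (φ.edge e)
    · intro h e
      obtain ⟨e, rfl⟩ := φ.edge.surjective e
      simpa [hload, Γ'] using h e
  have hcost : ∀ s i, Γ'.agentCost (τ s) i = Γ.agentCost s i := by
    intro s i
    unfold CCSGame.agentCost
    rw [hfeas]
    simp [τ, Γ', hload, Function.comp_def]
  obtain ⟨s', hs'⟩ := hH Γ' ⟨τ s₀, (hfeas s₀).2 hs₀⟩
  obtain ⟨s, rfl⟩ := hsurj s'
  refine ⟨s, fun C hC t => ?_⟩
  obtain ⟨j, hj, hle⟩ := hs' C hC (τ t)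
  have hdev : Γ'.deviate (τ s) (τ t) C = τ (Γ.deviate s t C) := by
    funext i
    by_cases hi : i ∈ C <;> simp only [CCSGame.deviate, τ, hi, if_true, if_false] <;> rfl
  rw [hdev, hcost, hcost] at hle
  exact ⟨j, hj, hle⟩

end Network

/-! ### Priority-stable profiles -/

namespace CCSGame

variable {G : Network.{u, v}}

theorem load_eq_natCard (Γ : CCSGame G) (s : Γ.Profile) (e : G.E) :
    Γ.load s e = Nat.card {i // e ∈ (s i).1} := by
  classical
  rw [Nat.card_eq_fintype_card, Fintype.card_subtype, load]

/-- No agent can profit from a deviation in which no agent of higher priority takes part. -/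
def IsPriorityStable (Γ : CCSGame G) (π : Fin Γ.n → ℕ) (s : Γ.Profile) : Prop :=
  Γ.IsFeasible s ∧ ∀ j s', Γ.IsFeasible s' → (∀ i, π i < π j → s' i = s i) →
    Γ.share s j ≤ Γ.share s' j

/-- In any coalition the member with the smallest value of `π` does not gain, since all agents
before her stay put. -/
theorem IsPriorityStable.isStrongEquilibrium {Γ : CCSGame G} {π : Fin Γ.n → ℕ} {s : Γ.Profile}
    (hs : Γ.IsPriorityStable π s) : Γ.IsStrongEquilibrium s := by
  intro C hC s'
  obtain ⟨j, hj, hmin⟩ := C.exists_min_image π hC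
  refine ⟨j, hj, ?_⟩
  by_cases hf : Γ.IsFeasible (Γ.deviate s s' C)
  · rw [agentCost_of_feasible hs.1, agentCost_of_feasible hf]
    refine ENNReal.coe_le_coe.2 (hs.2 j _ hf fun i hi => ?_)
    exact if_neg fun hiC => absurd (hmin i hiC) (not_le.2 hi)
  · rw [agentCost_of_not_feasible hf]
    exact le_top

end CCSGame

namespace Network

/-- Every feasible game has a priority-stable profile for every order of the agents. -/
def IsFlexible (G : Network.{u, v}) : Prop :=
  ∀ Γ : CCSGame G, (∃ s, Γ.IsFeasible s) → ∀ π : Fin Γ.n → ℕ, π.Injective →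
    ∃ s, Γ.IsPriorityStable π s

/-- Every feasible game has a priority-stable profile for some order of the agents. -/
def IsSemiflexible (G : Network.{u, v}) : Prop :=
  ∀ Γ : CCSGame G, (∃ s, Γ.IsFeasible s) → ∃ π : Fin Γ.n → ℕ, π.Injective ∧
    ∃ s, Γ.IsPriorityStable π s

theorem IsSemiflexible.admitsSE {G : Network.{u, v}} (h : G.IsSemiflexible) : G.AdmitsSE := by
  intro Γ hΓ
  obtain ⟨π, -, s, hs⟩ := h Γ hΓ
  exact ⟨s, hs.isStrongEquilibrium⟩

/-- A network without directed cycles, ranked from its source. -/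
def IsRanked (G : Network.{u, v}) : Prop := ∃ r, G.IsRanking Set.univ r ∧ r G.source = 0

theorem IsRanked.isPath {G : Network.{u, v}} (h : G.IsRanked) {a b : G.V} {p : List G.E}
    (hp : G.IsWalk a p b) : G.IsPath a p b :=
  h.choose_spec.1.isPath hp fun _ _ => trivial

theorem IsRanked.eq_nil {G : Network.{u, v}} (h : G.IsRanked) {a : G.V} {p : List G.E}
    (hp : G.IsWalk a p a) : p = [] := by
  by_contra hne
  obtain ⟨e, he, hea⟩ := hp.exists_tgt_eq hne
  exact (h.isPath hp).source_ne he hea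

/-! ### Priority stability in series compositions -/

section Series

variable {G H : Network.{u, v}}

theorem IsRanked.series (hG : G.IsRanked) (hH : H.IsRanked) : (G.series H).IsRanked := by
  obtain ⟨r, hr, hr0⟩ := hG
  obtain ⟨r', hr', hr0'⟩ := hH
  refine ⟨Quot.lift (Sum.elim r fun y => r G.sink + r' y) ?_, ?_, hr0⟩
  · rintro _ _ ⟨rfl, rfl⟩
    simp [hr0']
  · rintro (e | e) -
    · exact hr e trivial
    · exact Nat.add_lt_add_left (hr' e trivial) _

/-- The node of `G` that is nearest to a node of `G.series H`. -/
def toFst : (G.series H).V → G.V :=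
  Quot.lift (Sum.elim id fun _ => G.sink) (by rintro _ _ ⟨rfl, rfl⟩; rfl)

/-- The node of `H` that is nearest to a node of `G.series H`. -/
def toSnd : (G.series H).V → H.V :=
  Quot.lift (Sum.elim (fun _ => H.source) id) (by rintro _ _ ⟨rfl, rfl⟩; rfl)

/-- The edges of `G` on a walk in `G.series H`. -/
def lefts (p : List (G.E ⊕ H.E)) : List G.E := p.filterMap Sum.getLeft?

/-- The edges of `H` on a walk in `G.series H`. -/
def rights (p : List (G.E ⊕ H.E)) : List H.E := p.filterMap Sum.getRight?

theorem mem_lefts {p : List (G.E ⊕ H.E)} {e : G.E} : e ∈ lefts p ↔ Sum.inl e ∈ p := by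
  simp [lefts]

theorem mem_rights {p : List (G.E ⊕ H.E)} {e : H.E} : e ∈ rights p ↔ Sum.inr e ∈ p := by
  simp [rights]

theorem isWalk_lefts {a b : (G.series H).V} {p : List (G.E ⊕ H.E)}
    (hp : (G.series H).IsWalk a p b) : G.IsWalk (toFst a) (lefts p) (toFst b) := by
  induction p generalizing a with
  | nil => exact congrArg toFst hp
  | cons e p ih =>
    obtain ⟨h1, h2⟩ := hp
    subst h1
    rcases e with e | e
    · exact ⟨rfl, ih h2⟩
    · exact ih (a := (G.series H).tgt (Sum.inr e)) h2

theorem isWalk_rights {a b : (G.series H).V} {p : List (G.E ⊕ H.E)}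
    (hp : (G.series H).IsWalk a p b) : H.IsWalk (toSnd a) (rights p) (toSnd b) := by
  induction p generalizing a with
  | nil => exact congrArg toSnd hp
  | cons e p ih =>
    obtain ⟨h1, h2⟩ := hp
    subst h1
    rcases e with e | e
    · exact ih (a := (G.series H).tgt (Sum.inl e)) h2
    · exact ⟨rfl, ih h2⟩

theorem isWalk_map_inl {a b : G.V} {p : List G.E} (hp : G.IsWalk a p b) :
    (G.series H).IsWalk (Quot.mk _ (Sum.inl a)) (p.map Sum.inl) (Quot.mk _ (Sum.inl b)) := by
  induction p generalizing a with
  | nil => exact congrArg (fun a => Quot.mk _ (Sum.inl a)) hp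
  | cons e p ih => exact ⟨congrArg (fun a => Quot.mk _ (Sum.inl a)) hp.1, ih hp.2⟩

theorem isWalk_map_inr {a b : H.V} {p : List H.E} (hp : H.IsWalk a p b) :
    (G.series H).IsWalk (Quot.mk _ (Sum.inr a)) (p.map Sum.inr) (Quot.mk _ (Sum.inr b)) := by
  induction p generalizing a with
  | nil => exact congrArg (fun a => Quot.mk _ (Sum.inr a)) hp
  | cons e p ih => exact ⟨congrArg (fun a => Quot.mk _ (Sum.inr a)) hp.1, ih hp.2⟩

theorem lefts_append_map (p : List G.E) (q : List H.E) :
    lefts (p.map Sum.inl ++ q.map Sum.inr) = p ∧ rights (p.map Sum.inl ++ q.map Sum.inr) = q ∧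
      lefts (q.map Sum.inr ++ p.map Sum.inl) = p ∧ rights (q.map Sum.inr ++ p.map Sum.inl) = q := by
  simp [lefts, rights, List.filterMap_append, List.filterMap_map, Function.comp_def]

/-- If both ends lie in one factor, the walk in the other factor is closed, hence empty by
acyclicity. Otherwise the two walks are glued at the common node. -/
theorem exists_isWalk_series (hG : G.IsRanked) (hH : H.IsRanked) {a b : (G.series H).V}
    {p : List G.E} {q : List H.E} (hp : G.IsWalk (toFst a) p (toFst b))
    (hq : H.IsWalk (toSnd a) q (toSnd b)) :
    ∃ w : List (G.E ⊕ H.E), (G.series H).IsWalk a w b ∧ lefts w = p ∧ rights w = q := by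
  have hglue : (Quot.mk _ (Sum.inl G.sink) : (G.series H).V) = Quot.mk _ (Sum.inr H.source) :=
    Quot.sound ⟨rfl, rfl⟩
  obtain ⟨h1, h2, h3, h4⟩ := lefts_append_map p q
  rcases a with ⟨a | a⟩ <;> rcases b with ⟨b | b⟩
  · obtain rfl : q = [] := hH.eq_nil hq
    exact ⟨_, (isWalk_map_inl hp).append (q := []) rfl, h1, h2⟩
  · have hp' := isWalk_map_inl (H := H) hp
    exact ⟨_, hp'.append (hglue ▸ isWalk_map_inr hq), h1, h2⟩
  · have hq' := isWalk_map_inr (G := G) hq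
    exact ⟨_, hq'.append (hglue ▸ isWalk_map_inl hp), h3, h4⟩
  · obtain rfl : p = [] := hG.eq_nil hp
    exact ⟨_, (isWalk_map_inr hq).append (q := []) rfl, h3, h4⟩

theorem sum_map_lefts_add_sum_map_rights (c : G.E ⊕ H.E → ℝ≥0) (p : List (G.E ⊕ H.E)) :
    (p.map c).sum = ((lefts p).map fun e => c (Sum.inl e)).sum +
      ((rights p).map fun e => c (Sum.inr e)).sum := by
  induction p with
  | nil => simp [lefts, rights]
  | cons e p ih =>
    rcases e with e | e <;> simp_all [lefts, rights, List.filterMap_cons] <;> ring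

/-- The part of a game on `G.series H` that is played on `G`. -/
def fstGame (Γ : CCSGame (G.series H)) : CCSGame G :=
  ⟨Γ.n, fun i => toFst (Γ.source i), fun i => toFst (Γ.sink i), fun e => Γ.cost (Sum.inl e),
    fun e => Γ.cap (Sum.inl e)⟩

/-- The part of a game on `G.series H` that is played on `H`. -/
def sndGame (Γ : CCSGame (G.series H)) : CCSGame H :=
  ⟨Γ.n, fun i => toSnd (Γ.source i), fun i => toSnd (Γ.sink i), fun e => Γ.cost (Sum.inr e),
    fun e => Γ.cap (Sum.inr e)⟩

/-- Strategies restrict to the factors and can be recombined from them; loads are preserved and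
shares add up. Hence stability in both factors gives stability in the composition, but only for a
common order `π`. -/
theorem exists_isPriorityStable_series (hG : G.IsRanked) (hH : H.IsRanked)
    (Γ : CCSGame (G.series H)) (hΓ : ∃ s, Γ.IsFeasible s) :
    ((∃ s, (fstGame Γ).IsFeasible s) ∧ ∃ s, (sndGame Γ).IsFeasible s) ∧
      ∀ π : Fin Γ.n → ℕ, (∃ s, (fstGame Γ).IsPriorityStable π s) →
        (∃ s, (sndGame Γ).IsPriorityStable π s) → ∃ s, Γ.IsPriorityStable π s := by
  let P₁ : Γ.Profile → (fstGame Γ).Profile := fun s i =>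
    ⟨lefts (s i).1, hG.isPath (isWalk_lefts (s i).2.1)⟩
  let P₂ : Γ.Profile → (sndGame Γ).Profile := fun s i =>
    ⟨rights (s i).1, hH.isPath (isWalk_rights (s i).2.1)⟩
  have hl₁ : ∀ s e, (fstGame Γ).load (P₁ s) e = Γ.load s (Sum.inl e) := by
    intro s e
    exact (CCSGame.load_eq_natCard _ _ _).trans ((Nat.card_congr
      (Equiv.subtypeEquivRight fun i => mem_lefts)).trans (CCSGame.load_eq_natCard Γ s (Sum.inl e)).symm)
  have hl₂ : ∀ s e, (sndGame Γ).load (P₂ s) e = Γ.load s (Sum.inr e) := by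
    intro s e
    exact (CCSGame.load_eq_natCard _ _ _).trans ((Nat.card_congr
      (Equiv.subtypeEquivRight fun i => mem_rights)).trans (CCSGame.load_eq_natCard Γ s (Sum.inr e)).symm)
  have hfeas : ∀ s, Γ.IsFeasible s ↔ (fstGame Γ).IsFeasible (P₁ s) ∧
      (sndGame Γ).IsFeasible (P₂ s) := by
    intro s
    simp only [CCSGame.IsFeasible, hl₁, hl₂]
    exact ⟨fun h => ⟨fun e => h _, fun e => h _⟩, fun h e => e.casesOn h.1 h.2⟩
  have hshare : ∀ s i, Γ.share s i =
      (fstGame Γ).share (P₁ s) i + (sndGame Γ).share (P₂ s) i := by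
    intro s i
    simp only [CCSGame.share, hl₁, hl₂]
    exact sum_map_lefts_add_sum_map_rights _ _
  obtain ⟨s₀, hs₀⟩ := hΓ
  refine ⟨⟨⟨_, ((hfeas s₀).1 hs₀).1⟩, _, ((hfeas s₀).1 hs₀).2⟩, ?_⟩
  rintro π ⟨s₁, hs₁⟩ ⟨s₂, hs₂⟩
  choose w hw hw₁ hw₂ using fun i => exists_isWalk_series hG hH (s₁ i).2.1 (s₂ i).2.1
  let s : Γ.Profile := fun i => ⟨w i, (hG.series hH).isPath (hw i)⟩
  have h₁ : P₁ s = s₁ := funext fun i => Subtype.ext (hw₁ i)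
  have h₂ : P₂ s = s₂ := funext fun i => Subtype.ext (hw₂ i)
  refine ⟨s, (hfeas s).2 ⟨h₁ ▸ hs₁.1, h₂ ▸ hs₂.1⟩, fun j s' hs' hss' => ?_⟩
  rw [hshare, hshare, h₁, h₂]
  refine add_le_add (hs₁.2 j _ ((hfeas s').1 hs').1 fun i hi => ?_)
    (hs₂.2 j _ ((hfeas s').1 hs').2 fun i hi => ?_)
  · rw [← h₁]
    exact Subtype.ext (congrArg (fun p => lefts p.1) (hss' i hi))
  · rw [← h₂]
    exact Subtype.ext (congrArg (fun p => rights p.1) (hss' i hi))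

theorem IsFlexible.series (hG : G.IsRanked) (hH : H.IsRanked) (hG' : G.IsFlexible)
    (hH' : H.IsFlexible) : (G.series H).IsFlexible := by
  intro Γ hΓ π hπ
  obtain ⟨⟨h1, h2⟩, h⟩ := exists_isPriorityStable_series hG hH Γ hΓ
  exact h π (hG' _ h1 π hπ) (hH' _ h2 π hπ)

theorem IsFlexible.series_isSemiflexible (hG : G.IsRanked) (hH : H.IsRanked) (hG' : G.IsFlexible)
    (hH' : H.IsSemiflexible) : (G.series H).IsSemiflexible := by
  intro Γ hΓ
  obtain ⟨⟨h1, h2⟩, h⟩ := exists_isPriorityStable_series hG hH Γ hΓ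
  obtain ⟨π, hπ, hs⟩ := hH' _ h2
  exact ⟨π, hπ, h π (hG' _ h1 π hπ) hs⟩

theorem IsSemiflexible.series_isFlexible (hG : G.IsRanked) (hH : H.IsRanked)
    (hG' : G.IsSemiflexible) (hH' : H.IsFlexible) : (G.series H).IsSemiflexible := by
  intro Γ hΓ
  obtain ⟨⟨h1, h2⟩, h⟩ := exists_isPriorityStable_series hG hH Γ hΓ
  obtain ⟨π, hπ, hs⟩ := hG' _ h1
  exact ⟨π, hπ, h π hs (hH' _ h2 π hπ)⟩

end Series

end Network

/-! ### Greedy sharing of resources -/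

theorem exists_initial_segment {ι : Type*} [DecidableEq ι] {π : ι → ℕ} (hπ : π.Injective)
    (A : Finset ι) (t : ℕ) (ht : t ≤ A.card) :
    ∃ S ⊆ A, S.card = t ∧ ∀ i ∈ S, ∀ j ∈ A \ S, π i < π j := by
  induction t with
  | zero => exact ⟨∅, by simp⟩
  | succ t ih =>
    obtain ⟨S, hS, hSt, hlt⟩ := ih (by omega)
    have hne : (A \ S).Nonempty := by
      rw [← Finset.card_pos, Finset.card_sdiff_of_subset hS]
      omega
    obtain ⟨a, ha, hmin⟩ := Finset.exists_min_image (A \ S) π hne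
    rw [Finset.mem_sdiff] at ha
    refine ⟨insert a S, Finset.insert_subset ha.1 hS, by
      rw [Finset.card_insert_of_notMem ha.2, hSt], fun i hi j hj => ?_⟩
    rw [Finset.mem_sdiff, Finset.mem_insert, not_or] at hj
    have hj' : j ∈ A \ S := Finset.mem_sdiff.2 ⟨hj.1, hj.2.2⟩
    rcases Finset.mem_insert.1 hi with rfl | hi
    · exact lt_of_le_of_ne (hmin j hj') fun h => hj.2.1 (hπ h).symm
    · exact hlt i hi j hj'

/-- Agents in `A` share resources with capacities `k` and costs `c` that decrease with the load. If
the agents choose greedily in the order `π`, then no agent can gain as long as all previous agents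
stick to their choices. -/
theorem exists_greedy {ι β : Type*} [DecidableEq ι] [Fintype β] [DecidableEq β] [Nonempty β]
    {π : ι → ℕ} (hπ : π.Injective) (c : β → ℕ → ℝ≥0)
    (hc : ∀ b x y, 1 ≤ x → x ≤ y → c b y ≤ c b x) (A : Finset ι) : ∀ k : β → ℕ,
    A.card ≤ ∑ b, k b → ∃ g : ι → β, (∀ b, (A.filter (g · = b)).card ≤ k b) ∧
      ∀ j ∈ A, ∀ g' : ι → β, (∀ b, (A.filter (g' · = b)).card ≤ k b) →
        (∀ i ∈ A, π i < π j → g' i = g i) →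
        c (g j) (A.filter (g · = g j)).card ≤ c (g' j) (A.filter (g' · = g' j)).card := by
  induction A using Finset.strongInduction with
  | H A ih =>
  intro k hk
  rcases A.eq_empty_or_nonempty with rfl | hA
  · exact ⟨fun _ => Classical.arbitrary β, by simp⟩
  have hApos := hA.card_pos
  -- Costs decrease with the load, so a resource is cheapest when filled as far as possible, and `b`
  -- attains the least cost that anybody can ever pay. Resources of capacity 0 are left out, as
  -- their value at load 0 means nothing.
  obtain ⟨b, hb, hmin⟩ := Finset.exists_min_image (Finset.univ.filter fun b => 1 ≤ k b)
    (fun b => c b (min (k b) A.card)) (by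
      by_contra h
      rw [Finset.not_nonempty_iff_eq_empty, Finset.filter_eq_empty_iff] at h
      have : ∑ b, k b = 0 := Finset.sum_eq_zero fun b hb => by
        have := h hb
        omega
      omega)
  rw [Finset.mem_filter] at hb
  have hkb := hb.2
  obtain ⟨S, hSA, hSt, hlt⟩ := exists_initial_segment hπ A (min (k b) A.card) (min_le_right _ _)
  have hSne : S.Nonempty := by
    rw [← Finset.card_pos, hSt]
    omega
  have hcard : (A \ S).card = A.card - min (k b) A.card := by
    rw [Finset.card_sdiff_of_subset hSA, hSt]
  have hsum : ∑ b', k b' = k b + ∑ b', Function.update k b 0 b' := by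
    rw [← Finset.add_sum_erase _ _ (Finset.mem_univ b),
      ← Finset.add_sum_erase _ (Function.update k b 0) (Finset.mem_univ b),
      Function.update_self, zero_add]
    congr 1
    exact Finset.sum_congr rfl fun b' hb' =>
      (Function.update_of_ne (Finset.ne_of_mem_erase hb') _ _).symm
  -- The agents left over may not use `b`: if there are any, then `S` fills it.
  obtain ⟨g₂, hg₂, hst⟩ := ih (A \ S) (Finset.sdiff_ssubset hSA hSne) (Function.update k b 0)
    (by rw [hcard]; omega)
  -- the loads split into those on `S` and those on `A \ S`
  have hsplit : ∀ (f : ι → β) b', (A.filter (f · = b')).card =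
      (S.filter (f · = b')).card + ((A \ S).filter (f · = b')).card := by
    intro f b'
    rw [← Finset.card_union_of_disjoint, ← Finset.filter_union, Finset.union_sdiff_of_subset hSA]
    exact Finset.disjoint_filter_filter Finset.disjoint_sdiff
  have hload_self : ∀ (f : ι → β), (∀ i ∈ S, f i = b) → (S.filter (f · = b)).card = S.card :=
    fun f hf => by rw [Finset.filter_true_of_mem hf]
  have hload_ne : ∀ (f : ι → β), (∀ i ∈ S, f i = b) → ∀ b', b' ≠ b →
      (S.filter (f · = b')).card = 0 := fun f hf b' hb' => by
    rw [Finset.card_eq_zero, Finset.filter_eq_empty_iff]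
    exact fun i hi h => hb' (h.symm.trans (hf i hi))
  let g : ι → β := fun i => if i ∈ S then b else g₂ i
  have hgS : ∀ i ∈ S, g i = b := fun i hi => if_pos hi
  have hgA : ∀ i ∈ A \ S, g i = g₂ i := fun i hi => if_neg (Finset.mem_sdiff.1 hi).2
  have hg₂A : ∀ b', ((A \ S).filter (g · = b')) = ((A \ S).filter (g₂ · = b')) := fun b' =>
    Finset.filter_congr fun i hi => by rw [hgA i hi]
  have hg₂b : ((A \ S).filter (g₂ · = b)).card = 0 := by
    simpa using hg₂ b
  refine ⟨g, fun b' => ?_, fun j hj g' hg' hag => ?_⟩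
  · rw [hsplit, hg₂A]
    by_cases hb' : b' = b
    · subst hb'
      rw [hload_self g hgS, hg₂b, hSt]
      omega
    · rw [hload_ne g hgS b' hb']
      simpa [Function.update_of_ne hb'] using hg₂ b'
  -- Agents in `S` pay the least possible cost. For any other agent the members of `S` come first
  -- and keep occupying `b`, so that the claim reduces to the one for `A \ S`.
  by_cases hjS : j ∈ S
  · rw [hgS j hjS, hsplit g, hg₂A, hload_self g hgS, hg₂b, hSt, add_zero]
    have h1 : 1 ≤ (A.filter (g' · = g' j)).card :=
      Finset.card_pos.2 ⟨j, Finset.mem_filter.2 ⟨hj, rfl⟩⟩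
    have h2 := hg' (g' j)
    have h3 : (A.filter (g' · = g' j)).card ≤ A.card := Finset.card_filter_le _ _
    exact (hmin (g' j) (Finset.mem_filter.2 ⟨Finset.mem_univ _, h1.trans h2⟩)).trans
      (hc _ _ _ h1 (le_min h2 h3))
  · have hjA : j ∈ A \ S := Finset.mem_sdiff.2 ⟨hj, hjS⟩
    have hg'S : ∀ i ∈ S, g' i = b := fun i hi =>
      (hag i (hSA hi) (hlt i hi j hjA)).trans (hgS i hi)
    have hlt' : S.card < A.card := Finset.card_lt_card
      ((Finset.ssubset_iff_of_subset hSA).2 ⟨j, hj, hjS⟩)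
    have hSk : S.card = k b := by omega
    have hg'b : ((A \ S).filter (g' · = b)).card = 0 := by
      have := hg' b
      rw [hsplit, hload_self g' hg'S] at this
      omega
    have hne : ∀ (f : ι → β), ((A \ S).filter (f · = b)).card = 0 → f j ≠ b := fun f hf h => by
      rw [Finset.card_eq_zero, Finset.filter_eq_empty_iff] at hf
      exact hf hjA h
    have h := hst j hjA g' (fun b' => ?_) fun i hi hij => ?_
    · rw [hgA j hjA, hsplit g, hsplit g', hg₂A, hload_ne g hgS _ (hne g₂ hg₂b),
        hload_ne g' hg'S _ (hne g' hg'b), zero_add, zero_add]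
      exact h
    · by_cases hb' : b' = b
      · subst hb'
        rw [hg'b]
        exact Nat.zero_le _
      · rw [Function.update_of_ne hb']
        exact le_trans (by rw [hsplit g']; omega) (hg' b')
    · rw [hag i (Finset.mem_sdiff.1 hi).1 hij, hgA i hi]

/-! ### Games on networks of parallel paths -/

namespace Network

/-- The intrinsic structure of networks of parallel paths. -/
structure IsBranching (B : Network.{u, v}) : Prop where
  -- The rank of the sink can be any large number, so that the rankings of two networks can be
  -- matched in a parallel composition.
  ranking : ∃ N₀, ∀ N ≥ N₀, ∃ r, B.IsRanking Set.univ r ∧ r B.source = 0 ∧ r B.sink = N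
  ne : B.source ≠ B.sink
  src_ne_sink : ∀ e, B.src e ≠ B.sink
  out_eq : ∀ d e, B.src d = B.src e → B.src e ≠ B.source → d = e
  in_eq : ∀ d e, B.tgt d = B.tgt e → B.tgt e ≠ B.sink → d = e

theorem IsBranching.isRanked {B : Network.{u, v}} (hB : B.IsBranching) : B.IsRanked := by
  obtain ⟨N, hN⟩ := hB.ranking
  obtain ⟨r, hr, hr', -⟩ := hN N le_rfl
  exact ⟨r, hr, hr'⟩

theorem IsBranching.tgt_ne_source {B : Network.{u, v}} (hB : B.IsBranching) (e : B.E) :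
    B.tgt e ≠ B.source := by
  obtain ⟨r, hr, hr'⟩ := hB.isRanked
  intro h
  have := hr e trivial
  rw [h, hr'] at this
  omega

/-- Away from the source each step is forced, and no edge leads back to the source. -/
theorem IsBranching.walk_eq_of_ne_source {B : Network.{u, v}} (hB : B.IsBranching) {a b : B.V}
    {p q : List B.E} (hp : B.IsWalk a p b) (hq : B.IsWalk a q b) (ha : a ≠ B.source) : p = q := by
  induction p generalizing a q with
  | nil =>
    obtain rfl : a = b := hp
    exact (hB.isRanked.eq_nil hq).symm
  | cons e p ih =>
    cases q with
    | nil =>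
      obtain rfl : a = b := hq
      exact hB.isRanked.eq_nil hp
    | cons d q =>
      obtain rfl := hB.out_eq e d (hp.1.trans hq.1.symm) (hq.1 ▸ ha)
      rw [ih hp.2 hq.2 (hB.tgt_ne_source e)]

theorem IsBranching.walk_eq_of_ne_sink {B : Network.{u, v}} (hB : B.IsBranching) {a b : B.V}
    {p q : List B.E} (hp : B.IsWalk a p b) (hq : B.IsWalk a q b) (hb : b ≠ B.sink) : p = q := by
  induction p using List.reverseRecOn generalizing b q with
  | nil =>
    obtain rfl : a = b := hp
    exact (hB.isRanked.eq_nil hq).symm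
  | append_singleton p e ih =>
    rcases List.eq_nil_or_concat q with rfl | ⟨q, d, rfl⟩
    · obtain rfl : a = b := hq
      exact hB.isRanked.eq_nil hp
    · rw [List.concat_eq_append] at hq ⊢
      have h1 := isWalk_append_cons.1 hp
      have h2 := isWalk_append_cons.1 hq
      have h3 : B.tgt e = b := h1.2
      have h4 : B.tgt d = b := h2.2
      obtain rfl := hB.in_eq e d (h3.trans h4.symm) (h4 ▸ hb)
      rw [ih h1.1 h2.1 (hB.src_ne_sink e)]

theorem IsBranching.walk_eq_of_mem {B : Network.{u, v}} (hB : B.IsBranching) {p q : List B.E}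
    (hp : B.IsWalk B.source p B.sink) (hq : B.IsWalk B.source q B.sink) {e : B.E} (he : e ∈ p)
    (he' : e ∈ q) : p = q := by
  obtain ⟨p₁, p₂, rfl⟩ := List.append_of_mem he
  obtain ⟨q₁, q₂, rfl⟩ := List.append_of_mem he'
  have h1 := isWalk_append_cons.1 hp
  have h2 := isWalk_append_cons.1 hq
  rw [hB.walk_eq_of_ne_sink h1.1 h2.1 (hB.src_ne_sink e),
    hB.walk_eq_of_ne_source h1.2 h2.2 (hB.tgt_ne_source e)]

instance {B : Network.{u, v}} [Finite B.E] (a b : B.V) : Finite (B.Path a b) := by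
  classical
  have := Fintype.ofFinite B.E
  exact Finite.of_injective (β := {l : List B.E // l.Nodup})
    (fun p => ⟨p.1, p.2.edges_nodup⟩) fun p q h =>
      Subtype.ext (congrArg (fun l : {l : List B.E // l.Nodup} => l.1) h : p.1 = q.1)

/-- Only the free agents, from the source to the sink, have a choice. Distinct source-sink paths
share no edge, so the paths are separate resources on which the forced agents are a constant load,
and the greedy assignment serves the free agents in any order. A forced agent could still gain if
free agents joined her path; this is ruled out if they all precede her, or if her path is empty. -/
theorem IsBranching.exists_isPriorityStable {B : Network.{u, v}} [Finite B.E] (hB : B.IsBranching)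
    (Γ : CCSGame B) (hΓ : ∃ s, Γ.IsFeasible s) {π : Fin Γ.n → ℕ} (hπ : π.Injective)
    (h : (∀ i j, (Γ.source i = B.source ∧ Γ.sink i = B.sink) →
        ¬ (Γ.source j = B.source ∧ Γ.sink j = B.sink) → π i < π j) ∨
      ∀ e, B.src e = B.source ∧ B.tgt e = B.sink) :
    ∃ s, Γ.IsPriorityStable π s := by
  classical
  obtain ⟨s₀, hs₀⟩ := hΓ
  let Free : Fin Γ.n → Prop := fun i => Γ.source i = B.source ∧ Γ.sink i = B.sink
  have huniq : ∀ (s : Γ.Profile) i, ¬ Free i → s i = s₀ i := by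
    intro s i hi
    refine Subtype.ext ?_
    by_cases h1 : Γ.source i = B.source
    · exact hB.walk_eq_of_ne_sink (s i).2.1 (s₀ i).2.1 fun h2 => hi ⟨h1, h2⟩
    · exact hB.walk_eq_of_ne_source (s i).2.1 (s₀ i).2.1 h1
  by_cases hfree : ∃ i, Free i
  swap
  · push Not at hfree
    refine ⟨s₀, hs₀, fun j s' _ _ => ?_⟩
    rw [show s' = s₀ from funext fun i => huniq s' i (hfree i)]
  let β := B.Path B.source B.sink
  have hpath : ∀ (s : Γ.Profile) i, Free i → B.IsPath B.source (s i).1 B.sink :=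
    fun s i hi => hi.1 ▸ hi.2 ▸ (s i).2
  obtain ⟨i₀, hi₀⟩ := hfree
  have : Nonempty β := ⟨⟨_, hpath s₀ i₀ hi₀⟩⟩
  have := Fintype.ofFinite β
  let f : B.E → ℕ := fun e => (Finset.univ.filter fun i => ¬ Free i ∧ e ∈ (s₀ i).1).card
  let c : β → ℕ → ℝ≥0 := fun b x => (b.1.map fun e => Γ.cost e / ((x + f e : ℕ) : ℝ≥0)).sum
  -- The number of free agents that the path can take besides the forced load. The bound `Γ.n` is
  -- harmless, since no more agents exist.
  let k : β → ℕ := fun b => Nat.findGreatest (fun x => ∀ e ∈ b.1, x + f e ≤ Γ.cap e) Γ.n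
  let A : Finset (Fin Γ.n) := Finset.univ.filter Free
  let asg : Γ.Profile → Fin Γ.n → β := fun s i =>
    if hi : Free i then ⟨(s i).1, hpath s i hi⟩ else Classical.arbitrary β
  have hasg : ∀ s i, Free i → (asg s i).1 = (s i).1 := by
    intro s i hi
    simp [asg, hi]
  have hload_split : ∀ (s : Γ.Profile) e, Γ.load s e =
      (A.filter fun i => e ∈ (s i).1).card + f e := by
    intro s e
    rw [CCSGame.load, ← Finset.card_filter_add_card_filter_not Free]
    congr 1
    · rw [Finset.filter_filter, Finset.filter_filter]
      congr 1
      ext i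
      simp [and_comm]
    · rw [Finset.filter_filter]
      congr 1
      ext i
      simp only [Finset.mem_filter, Finset.mem_univ, true_and]
      constructor
      · rintro ⟨h1, h2⟩
        exact ⟨h2, huniq s i h2 ▸ h1⟩
      · rintro ⟨h1, h2⟩
        exact ⟨huniq s i h1 ▸ h2, h1⟩
  have hload : ∀ (s : Γ.Profile) (b : β) e, e ∈ b.1 →
      Γ.load s e = (A.filter (asg s · = b)).card + f e := by
    intro s b e he
    rw [hload_split]
    congr 2
    refine Finset.filter_congr fun i hi => ?_
    have hi' : Free i := (Finset.mem_filter.1 hi).2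
    constructor
    · intro h1
      exact Subtype.ext ((hasg s i hi').trans
        (hB.walk_eq_of_mem (hpath s i hi').1 b.2.1 h1 he))
    · rintro rfl
      exact hasg s i hi' ▸ he
  have hf : ∀ e, f e ≤ Γ.cap e := fun e => by
    have := hs₀ e
    rw [hload_split] at this
    omega
  have hcapa : ∀ (s : Γ.Profile), Γ.IsFeasible s → ∀ b, (A.filter (asg s · = b)).card ≤ k b := by
    intro s hs b
    refine Nat.le_findGreatest ?_ fun e he => ?_
    · exact (Finset.card_le_univ _).trans (by simp)
    · rw [← hload s b e he]
      exact hs e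
  have hk : ∀ b : β, ∀ e ∈ b.1, k b + f e ≤ Γ.cap e := fun b =>
    Nat.findGreatest_spec (P := fun x => ∀ e ∈ b.1, x + f e ≤ Γ.cap e) (Nat.zero_le _)
      fun e _ => by simpa using hf e
  -- The condition `1 ≤ x` keeps the denominators positive; a quotient by 0 would count as 0.
  have hc : ∀ b x y, 1 ≤ x → x ≤ y → c b y ≤ c b x := by
    intro b x y hx hxy
    refine List.sum_le_sum fun e _ => ?_
    have h1 : (0 : ℝ≥0) < ((x + f e : ℕ) : ℝ≥0) := by
      exact_mod_cast (by omega : 0 < x + f e)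
    have h2 : ((x + f e : ℕ) : ℝ≥0) ≤ ((y + f e : ℕ) : ℝ≥0) := by
      exact_mod_cast (by omega : x + f e ≤ y + f e)
    exact div_le_div_of_nonneg_left zero_le h1 h2
  have hshare : ∀ (s : Γ.Profile) j, Free j →
      Γ.share s j = c (asg s j) (A.filter (asg s · = asg s j)).card := by
    intro s j hj
    simp only [CCSGame.share, c]
    rw [hasg s j hj]
    congr 1
    refine List.map_congr_left fun e he => ?_
    rw [hload s (asg s j) e (by rwa [hasg s j hj])]
  have hsum : A.card ≤ ∑ b, k b := by
    rw [Finset.card_eq_sum_card_fiberwise (f := asg s₀) (t := Finset.univ) (by simp)]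
    exact Finset.sum_le_sum fun b _ => hcapa s₀ hs₀ b
  obtain ⟨g, hg, hst⟩ := exists_greedy hπ c hc A k hsum
  let s : Γ.Profile := fun i => if hi : Free i then
    ⟨(g i).1, by rw [hi.1, hi.2]; exact (g i).2⟩ else s₀ i
  have hsg : ∀ i ∈ A, asg s i = g i := by
    intro i hi
    have hi' : Free i := (Finset.mem_filter.1 hi).2
    refine Subtype.ext ((hasg s i hi').trans ?_)
    simp [s, hi']
  have hfilter : ∀ b, A.filter (asg s · = b) = A.filter (g · = b) := fun b =>
    Finset.filter_congr fun i hi => by rw [hsg i hi]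
  refine ⟨s, fun e => ?_, fun j s' hs' hag => ?_⟩
  · by_cases he : ∃ b : β, e ∈ b.1
    · obtain ⟨b, hb⟩ := he
      rw [hload s b e hb, hfilter]
      exact (Nat.add_le_add_right (hg b) _).trans (hk b e hb)
    · rw [hload_split, Finset.filter_false_of_mem, Finset.card_empty, zero_add]
      · exact hf e
      · intro i hi hei
        exact he ⟨⟨_, hpath s i (Finset.mem_filter.1 hi).2⟩, hei⟩
  · by_cases hj : Free j
    · have hjA : j ∈ A := Finset.mem_filter.2 ⟨Finset.mem_univ _, hj⟩
      rw [hshare s j hj, hshare s' j hj, hfilter, hsg j hjA]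
      refine hst j hjA (asg s') (hcapa s' hs') fun i hi hij => ?_
      rw [← hsg i hi]
      simp only [asg, hag i hij]
    -- For a forced agent, either all free agents precede her and the profile cannot change at all,
    -- or all edges join the source to the sink; then a nonempty path would make her free, so hers
    -- is empty and costs nothing.
    · rcases h with h | h
      · have : s' = s := by
          funext i
          by_cases hi : Free i
          · exact hag i (h i j hi hj)
          · rw [huniq s i hi, huniq s' i hi]
        rw [this]
      · have hnil : (s j).1 = [] := by
          by_contra hne
          have hw := (s j).2.1
          obtain ⟨e, p, hep⟩ := List.exists_cons_of_ne_nil hne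
          rw [hep] at hw
          refine hj ⟨hw.1.symm.trans (h e).1, ?_⟩
          have hw2 := hw.2
          rw [(h e).2] at hw2
          cases p with
          | nil => exact hw2.symm
          | cons d p => exact absurd hw2.1 (hB.src_ne_sink d)
        simp [CCSGame.share, hnil]

theorem IsBranching.isSemiflexible {B : Network.{u, v}} [Finite B.E] (hB : B.IsBranching) :
    B.IsSemiflexible := by
  classical
  intro Γ hΓ
  -- Free agents get values below `Γ.n`, all others values from `Γ.n` on.
  let π : Fin Γ.n → ℕ := fun i =>
    if Γ.source i = B.source ∧ Γ.sink i = B.sink then i.1 else Γ.n + i.1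
  have hπ : π.Injective := by
    intro i j hij
    have hi := i.2
    have hj := j.2
    simp only [π] at hij
    refine Fin.ext ?_
    split_ifs at hij <;> omega
  refine ⟨π, hπ, hB.exists_isPriorityStable Γ hΓ hπ (Or.inl fun i j hi hj => ?_)⟩
  have := i.2
  simp only [π, if_pos hi, if_neg hj]
  omega

theorem IsBranching.isFlexible {B : Network.{u, v}} [Finite B.E] (hB : B.IsBranching)
    (h : ∀ e, B.src e = B.source ∧ B.tgt e = B.sink) : B.IsFlexible :=
  fun Γ hΓ _ hπ => hB.exists_isPriorityStable Γ hΓ hπ (Or.inr h)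

end Network

/-! ### Structure of parallel compositions, and the series of blocks -/

namespace Network

theorem isBranching_simplePath (m : ℕ) : (simplePath m).IsBranching where
  ranking := by
    refine ⟨m + 1, fun N hN => ?_⟩
    have h : ∀ e : Fin (m + 1),
        (if e.castSucc = Fin.last (m + 1) then N else e.castSucc.1) <
          if e.succ = Fin.last (m + 1) then N else e.succ.1 := fun e => by
      simp only [Fin.ext_iff, Fin.val_castSucc, Fin.val_last, Fin.val_succ]
      split_ifs <;> omega
    refine ⟨fun i : Fin (m + 2) => if i = Fin.last (m + 1) then N else i.1,
      fun e _ => h e, ?_, ?_⟩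
    · simp [simplePath, Fin.ext_iff]
    · simp [simplePath]
  ne := by simp [simplePath, Fin.ext_iff]
  src_ne_sink e := Fin.castSucc_ne_last (e : Fin (m + 1))
  out_eq _ _ h _ := Fin.castSucc_injective _ h
  in_eq _ _ h _ := Fin.succ_injective _ h

section Parallel

variable {G H : Network.{u, v}}

/-- Being equal to an inner node is a predicate that respects the gluing of the terminals, so it
descends to the quotient. -/
theorem parallel_inl_eq {x : G.V} (hx : x ≠ G.source) (hx' : x ≠ G.sink)
    {y : G.V ⊕ H.V} (h : (Quot.mk _ (Sum.inl x) : (G.parallel H).V) = Quot.mk _ y) :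
    y = Sum.inl x := by
  let F : (G.parallel H).V → Prop := Quot.lift (fun z => z = Sum.inl x) (by
    rintro _ _ (⟨rfl, rfl⟩ | ⟨rfl, rfl⟩) <;> simp [hx.symm, hx'.symm])
  exact (congrArg F h).mp rfl

theorem parallel_inr_eq {x : H.V} (hx : x ≠ H.source) (hx' : x ≠ H.sink)
    {y : G.V ⊕ H.V} (h : (Quot.mk _ (Sum.inr x) : (G.parallel H).V) = Quot.mk _ y) :
    y = Sum.inr x := by
  let F : (G.parallel H).V → Prop := Quot.lift (fun z => z = Sum.inr x) (by
    rintro _ _ (⟨rfl, rfl⟩ | ⟨rfl, rfl⟩) <;> simp [hx.symm, hx'.symm])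
  exact (congrArg F h).mp rfl

theorem parallel_source_eq : (Quot.mk _ (Sum.inr H.source) : (G.parallel H).V) =
    (G.parallel H).source := by
  refine Eq.symm (Quot.sound ?_)
  exact Or.inl ⟨rfl, rfl⟩

theorem parallel_sink_eq : (Quot.mk _ (Sum.inr H.sink) : (G.parallel H).V) =
    (G.parallel H).sink := by
  refine Eq.symm (Quot.sound ?_)
  exact Or.inr ⟨rfl, rfl⟩

theorem parallel_eq_sink (hG : G.source ≠ G.sink) (hH : H.source ≠ H.sink) {y : G.V ⊕ H.V}
    (h : (Quot.mk _ y : (G.parallel H).V) = (G.parallel H).sink) :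
    y = Sum.inl G.sink ∨ y = Sum.inr H.sink := by
  let F : (G.parallel H).V → Prop :=
    Quot.lift (fun z => z = Sum.inl G.sink ∨ z = Sum.inr H.sink) (by
      rintro _ _ (⟨rfl, rfl⟩ | ⟨rfl, rfl⟩) <;> simp [hG, hH])
  exact (congrArg F h).mpr (Or.inl rfl)

theorem IsBranching.parallel (hG : G.IsBranching) (hH : H.IsBranching) :
    (G.parallel H).IsBranching where
  ranking := by
    obtain ⟨N, hN⟩ := hG.ranking
    obtain ⟨N', hN'⟩ := hH.ranking
    refine ⟨max N N', fun M hM => ?_⟩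
    obtain ⟨r, hr, h0, h1⟩ := hN M (le_trans (le_max_left _ _) hM)
    obtain ⟨r', hr', h0', h1'⟩ := hN' M (le_trans (le_max_right _ _) hM)
    refine ⟨Quot.lift (Sum.elim r r') ?_, ?_, h0, h1⟩
    · rintro _ _ (⟨rfl, rfl⟩ | ⟨rfl, rfl⟩)
      · simp [h0, h0']
      · simp [h1, h1']
    · rintro (e | e) -
      · exact hr e trivial
      · exact hr' e trivial
  ne h := by
    rcases parallel_eq_sink hG.ne hH.ne h with h | h
    · exact hG.ne (Sum.inl_injective h)
    · simp at h
  src_ne_sink := by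
    rintro (e | e) h
    · rcases parallel_eq_sink hG.ne hH.ne h with h | h
      · exact hG.src_ne_sink e (Sum.inl_injective h)
      · simp at h
    · rcases parallel_eq_sink hG.ne hH.ne h with h | h
      · simp at h
      · exact hH.src_ne_sink e (Sum.inr_injective h)
  out_eq := by
    rintro (d | d) (e | e) h hne
    · have h1 : G.src e ≠ G.source := fun h1 => hne (congrArg (fun x => Quot.mk _ (Sum.inl x)) h1)
      have h2 := parallel_inl_eq h1 (hG.src_ne_sink e) h.symm
      rw [hG.out_eq d e (Sum.inl_injective h2) h1]
    · have h1 : H.src e ≠ H.source := fun h1 => hne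
        ((congrArg (fun x => Quot.mk _ (Sum.inr x)) h1).trans parallel_source_eq)
      have h2 := parallel_inr_eq h1 (hH.src_ne_sink e) h.symm
      simp at h2
    · have h1 : G.src e ≠ G.source := fun h1 => hne (congrArg (fun x => Quot.mk _ (Sum.inl x)) h1)
      have h2 := parallel_inl_eq h1 (hG.src_ne_sink e) h.symm
      simp at h2
    · have h1 : H.src e ≠ H.source := fun h1 => hne
        ((congrArg (fun x => Quot.mk _ (Sum.inr x)) h1).trans parallel_source_eq)
      have h2 := parallel_inr_eq h1 (hH.src_ne_sink e) h.symm
      rw [hH.out_eq d e (Sum.inr_injective h2) h1]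
  in_eq := by
    rintro (d | d) (e | e) h hne
    · have h1 : G.tgt e ≠ G.sink := fun h1 => hne (congrArg (fun x => Quot.mk _ (Sum.inl x)) h1)
      have h2 := parallel_inl_eq (hG.tgt_ne_source e) h1 h.symm
      rw [hG.in_eq d e (Sum.inl_injective h2) h1]
    · have h1 : H.tgt e ≠ H.sink := fun h1 => hne
        ((congrArg (fun x => Quot.mk _ (Sum.inr x)) h1).trans parallel_sink_eq)
      have h2 := parallel_inr_eq (hH.tgt_ne_source e) h1 h.symm
      simp at h2
    · have h1 : G.tgt e ≠ G.sink := fun h1 => hne (congrArg (fun x => Quot.mk _ (Sum.inl x)) h1)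
      have h2 := parallel_inl_eq (hG.tgt_ne_source e) h1 h.symm
      simp at h2
    · have h1 : H.tgt e ≠ H.sink := fun h1 => hne
        ((congrArg (fun x => Quot.mk _ (Sum.inr x)) h1).trans parallel_sink_eq)
      have h2 := parallel_inr_eq (hH.tgt_ne_source e) h1 h.symm
      rw [hH.in_eq d e (Sum.inr_injective h2) h1]

end Parallel

theorem IsParallelPaths.isBranching {B : Network.{0, 0}} (h : B.IsParallelPaths) :
    Finite B.E ∧ B.IsBranching := by
  induction h with
  | path m => exact ⟨inferInstanceAs (Finite (Fin (m + 1))), isBranching_simplePath m⟩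
  | @parallel G H _ _ h1 h2 =>
    have := h1.1
    have := h2.1
    exact ⟨inferInstanceAs (Finite (G.E ⊕ H.E)), h1.2.parallel h2.2⟩

theorem IsParallelEdges.src_eq_tgt_eq {B : Network.{0, 0}} (h : B.IsParallelEdges) (e : B.E) :
    B.src e = B.source ∧ B.tgt e = B.sink := by
  induction h with
  | edge =>
    exact ⟨congrArg Fin.castSucc (Subsingleton.elim (α := Fin 1) e 0),
      congrArg Fin.succ (Subsingleton.elim (α := Fin 1) e 0)⟩
  | @parallel G H _ _ h1 h2 =>
    rcases e with e | e
    · exact ⟨congrArg (fun x => Quot.mk _ (Sum.inl x)) (h1 e).1,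
        congrArg (fun x => Quot.mk _ (Sum.inl x)) (h1 e).2⟩
    · exact ⟨(congrArg (fun x => Quot.mk _ (Sum.inr x)) (h2 e).1).trans parallel_source_eq,
        (congrArg (fun x => Quot.mk _ (Sum.inr x)) (h2 e).2).trans parallel_sink_eq⟩

theorem IsParallelPaths.isRanked {B : Network.{0, 0}} (h : B.IsParallelPaths) : B.IsRanked :=
  h.isBranching.2.isRanked

theorem IsParallelPaths.isSemiflexible {B : Network.{0, 0}} (h : B.IsParallelPaths) :
    B.IsSemiflexible := by
  obtain ⟨_, hB⟩ := h.isBranching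
  exact hB.isSemiflexible

theorem IsParallelEdges.isFlexible {B : Network.{0, 0}} (h : B.IsParallelEdges) :
    B.IsFlexible := by
  obtain ⟨_, hB⟩ := h.isParallelPaths.isBranching
  exact hB.isFlexible h.src_eq_tgt_eq

theorem isRanked_seriesAll : ∀ {k : ℕ} (B : Fin (k + 1) → Network.{0, 0}),
    (∀ i, (B i).IsParallelPaths) → (seriesAll B).IsRanked
  | 0, _, h => (h 0).isRanked
  | _ + 1, _, h => (h 0).isRanked.series (isRanked_seriesAll _ fun i => h i.succ)

theorem isFlexible_seriesAll : ∀ {k : ℕ} (B : Fin (k + 1) → Network.{0, 0}),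
    (∀ i, (B i).IsParallelEdges) → (seriesAll B).IsFlexible
  | 0, _, h => (h 0).isFlexible
  | _ + 1, _, h => IsFlexible.series (h 0).isParallelPaths.isRanked
      (isRanked_seriesAll _ fun i => (h i.succ).isParallelPaths) (h 0).isFlexible
      (isFlexible_seriesAll _ fun i => h i.succ)

/-- Block `l` dictates the order of the agents, and all the other blocks accept it. -/
theorem isSemiflexible_seriesAll : ∀ {k : ℕ} (B : Fin (k + 1) → Network.{0, 0}) (l : Fin (k + 1)),
    (B l).IsParallelPaths → (∀ i, i ≠ l → (B i).IsParallelEdges) → (seriesAll B).IsSemiflexible := by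
  intro k
  induction k with
  | zero =>
    intro B l hl _
    obtain rfl : l = 0 := Fin.ext (by omega)
    exact hl.isSemiflexible
  | succ k ih =>
    intro B l hl h
    have hpaths : ∀ i, (B i).IsParallelPaths := fun i => by
      by_cases hi : i = l
      · exact hi ▸ hl
      · exact (h i hi).isParallelPaths
    have hranked := isRanked_seriesAll (fun i => B i.succ) fun i => hpaths i.succ
    refine Fin.cases (fun hl h => ?_) (fun l hl h => ?_) l hl h
    · exact IsSemiflexible.series_isFlexible (hpaths 0).isRanked hranked hl.isSemiflexible
        (isFlexible_seriesAll _ fun i => h i.succ (Fin.succ_ne_zero i))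
    · exact IsFlexible.series_isSemiflexible (hpaths 0).isRanked hranked
        (h 0 (Fin.succ_ne_zero l).symm).isFlexible
        (ih _ l hl fun i hi => h i.succ fun h => hi (Fin.succ_injective _ h))

end Network

theorem mainTheorem6 (G : Network.{u, v}) [Finite G.V] [Finite G.E] (hG : G.IsTwoTerminal) :
    G.AdmitsSE ↔
      ∃ (k : ℕ) (B : Fin (k + 1) → Network.{0, 0}) (l : Fin (k + 1)),
        (B l).IsParallelPaths ∧ (∀ i, i ≠ l → (B i).IsParallelEdges) ∧
          Nonempty (Network.Iso G (Network.seriesAll B)) := by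
  constructor
  · intro h
    obtain ⟨k, B, l, hl, hB, -, hiso⟩ :=
      (Network.isThin_of_admitsSE hG h).exists_seriesAll _ G le_rfl
    exact ⟨k, B, l, hl, hB, hiso⟩
  · rintro ⟨k, B, l, hl, hB, ⟨φ⟩⟩
    exact (Network.isSemiflexible_seriesAll B l hl hB).admitsSE.of_iso φ
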